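/- Let $I$ be an index set. For $v\in I$ let $A_v$ and $A'_v$ be $C^*$-algebras with distinguished projections $p_v\in A_v$ and $p'_v\in A'_v$ that are nonzero for all but finitely many $v$, let $X_v$ be a right Hilbert $C^*$-module over $A_v$ with a distinguished vector $x_v\in X_v$ such that $\langle x_v,x_v\rangle=p_v$ for all but finitely many $v$, and let $\alpha_v:A'_v\to\mathrm{End}^*_{A_v}(X_v)$ be $*$-homomorphisms into the adjointable operators such that $\alpha_v(p'_v)x_v=x_v$ for all but finitely many $v$. Write $\mathbb K_{A_v}(X_v)\subseteq\mathrm{End}^*_{A_v}(X_v)$ for the closed span of the operators $T_{\xi,\eta}:y\mapsto\xi\langle\eta,y\rangle$, and $p_{x_v}:=T_{x_v,x_v}$, which is a nonzero projection for all but finitely many $v$. Let $A=\bigotimes'_{v}(A_v,p_v)$, $A'=\bigotimes'_{v}(A'_v,p'_v)$ and $\bigotimes'_v(\mathrm{End}^*_{A_v}(X_v),p_{x_v})$ be the restricted tensor products of $C^*$-algebras, i.e. the completions in the spatial $C^*$-norm of the $*$-algebras spanned by the simple tensors $\otimes_v a_v$ with $a_v$ equal to the distinguished element for all but finitely many $v$.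 Let $X=\bigotimes'_v(X_v,x_v)$ be the Hilbert $A$-module obtained by completing the span of the simple tensors $\otimes_v w_v$ ($w_v=x_v$ for all but finitely many $v$) for the inner product $\langle\otimes_v w_v,\otimes_v z_v\rangle=\otimes_v\langle w_v,z_v\rangle$. Suppose that the collection is coherent, i.e. $\alpha_v(p'_v)=p_{x_v}$ for all but finitely many $v$. Then the following holds for the $*$-homomorphism $\alpha:A'\to\mathrm{End}^*_A(X)$ which is uniquely determined by $\alpha(\otimes_v a'_v)(\otimes_v w_v)=\otimes_v\alpha_v(a'_v)w_v$ (in particular, $\alpha$ exists). 1. $\alpha(A')\subseteq\bigotimes'_v(\mathrm{End}^*_{A_v}(X_v),p_{x_v})$, where the right-hand side is regarded as a subalgebra of $\mathrm{End}^*_A(X)$ through the natural inclusion, i.e. the unique $*$-homomorphism that satisfies $(\otimes_v T_v)(\otimes_v w_v)=\otimes_v T_vw_v$ (it exists and is injective). 2. If moreover $\alpha_v(A'_v)\subseteq\mathbb K_{A_v}(X_v)$ for all $v\in I$, then $\alpha(A')\subseteq\mathbb K_A(X)$. 3. If moreover $\alpha_v(A'_v)\supseteq\mathbb K_{A_v}(X_v)$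 for all $v\in I$, then $\alpha(A')\supseteq\mathbb K_A(X)$. -/

import Mathlib

open Filter
open scoped ComplexOrder Topology

/-- `X` is a right Hilbert `C⋆`-module over the `C⋆`-algebra `A`: a Banach space with a right action
`act x a = x · a` of `A` and an `A`-valued inner product `inn x y = ⟨x, y⟩_A`, which is linear in
the second variable, positive, and induces the norm of `X`. (In Mathlib's `CStarModule`, the inner
product satisfies `⟨x, a • y⟩ = a ⟨x, y⟩`, which is the convention for left modules.) -/
class HilbertModule (A X : Type*) [NonUnitalCStarAlgebra A] [NormedAddCommGroup X]
    [NormedSpace ℂ X] [CompleteSpace X] where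
  act : X → A → X
  inn : X → X → A
  add_act (x y : X) (a : A) : act (x + y) a = act x a + act y a
  act_add (x : X) (a b : A) : act x (a + b) = act x a + act x b
  act_mul (x : X) (a b : A) : act x (a * b) = act (act x a) b
  smul_act (c : ℂ) (x : X) (a : A) : act (c • x) a = c • act x a
  act_smul (c : ℂ) (x : X) (a : A) : act x (c • a) = c • act x a
  inn_add (x y z : X) : inn x (y + z) = inn x y + inn x z
  inn_smul (c : ℂ) (x y : X) : inn x (c • y) = c • inn x y
  inn_act (x y : X) (a : A) : inn x (act y a) = inn x y * a
  star_inn (x y : X) : star (inn x y) = inn y x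
  inn_self_pos (x : X) : ∃ a : A, inn x x = star a * a
  norm_sq (x : X) : ‖x‖ ^ 2 = ‖inn x x‖

namespace HilbertModule
section
variable {A X : Type*} [NonUnitalCStarAlgebra A] [NormedAddCommGroup X]
    [NormedSpace ℂ X] [CompleteSpace X] [HilbertModule A X]

theorem add_inn (x y z : X) : inn (A := A) (x + y) z = inn (A := A) x z + inn (A := A) y z := by
  rw [← star_inn, inn_add, star_add, star_inn, star_inn]

theorem smul_inn (c : ℂ) (x y : X) : inn (A := A) (c • x) y = star c • inn (A := A) x y := by
  rw [← star_inn, inn_smul, star_smul, star_inn]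

theorem act_inn (x y : X) (a : A) : inn (A := A) (act x a) y = star a * inn (A := A) x y := by
  rw [← star_inn, inn_act, star_mul, star_inn]

theorem inn_zero (x : X) : inn (A := A) x 0 = 0 := by
  simpa only [zero_smul] using inn_smul (A := A) 0 x 0

theorem inn_neg (x y : X) : inn (A := A) x (-y) = -inn (A := A) x y := by
  simpa using inn_smul (A := A) (-1) x y

theorem inn_sub (x y z : X) : inn (A := A) x (y - z) = inn (A := A) x y - inn (A := A) x z := by
  rw [sub_eq_add_neg, inn_add, inn_neg, sub_eq_add_neg]

theorem sub_inn (x y z : X) : inn (A := A) (x - y) z = inn (A := A) x z - inn (A := A) y z := by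
  rw [← star_inn, inn_sub, star_sub, star_inn, star_inn]

theorem inn_sum {ι : Type*} (s : Finset ι) (x : X) (y : ι → X) :
    inn (A := A) x (∑ i ∈ s, y i) = ∑ i ∈ s, inn (A := A) x (y i) :=
  map_sum (AddMonoidHom.mk' (fun z : X => inn (A := A) x z) (inn_add x)) y s

theorem sum_inn {ι : Type*} (s : Finset ι) (x : X) (y : ι → X) :
    inn (A := A) (∑ i ∈ s, y i) x = ∑ i ∈ s, inn (A := A) (y i) x :=
  map_sum (AddMonoidHom.mk' (fun z : X => inn (A := A) z x) (fun a b => add_inn a b x)) y s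

variable (A) in
theorem eq_zero_of_inn {x : X} (h : inn (A := A) x x = 0) : x = 0 := by
  have := norm_sq (A := A) x
  rw [h, norm_zero] at this
  exact norm_eq_zero.1 (pow_eq_zero_iff two_ne_zero |>.1 this)

variable (A) in
theorem ext_inn {x y : X} (h : ∀ z : X, inn (A := A) z x = inn (A := A) z y) : x = y := by
  refine sub_eq_zero.1 (eq_zero_of_inn A ?_)
  rw [inn_sub, h, sub_self]

/-- The Cauchy-Schwarz inequality. -/
theorem norm_inn_le (x y : X) : ‖inn (A := A) x y‖ ≤ ‖x‖ * ‖y‖ := by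
  let _ : PartialOrder Aᵐᵒᵖ := CStarAlgebra.spectralOrder Aᵐᵒᵖ
  have _ : StarOrderedRing Aᵐᵒᵖ := CStarAlgebra.spectralOrderedRing Aᵐᵒᵖ
  let _ : SMul Aᵐᵒᵖ X := ⟨fun a x => act x a.unop⟩
  let _ : CStarModule Aᵐᵒᵖ X :=
    { inner := fun x y => MulOpposite.op (inn (A := A) x y)
      inner_add_right := by intro x y z; simp [inn_add]
      inner_self_nonneg := by
        intro x
        obtain ⟨a, ha⟩ := inn_self_pos (A := A) x
        rw [ha]
        exact mul_star_self_nonneg (MulOpposite.op a)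
      inner_self := by
        intro x
        constructor
        · intro h
          exact eq_zero_of_inn A (by simpa using h)
        · rintro rfl
          simp [inn_zero]
      inner_op_smul_right := by
        intro a x y
        exact congrArg MulOpposite.op (inn_act x y a.unop)
      inner_smul_right_complex := by intro c x y; simp [inn_smul]
      star_inner := by intro x y; rw [← star_inn (A := A) x y]; rfl
      norm_eq_sqrt_norm_inner_self := by
        intro x
        have := norm_sq (A := A) x
        rw [MulOpposite.norm_op, ← this, Real.sqrt_sq (norm_nonneg _)] }
  exact CStarModule.norm_inner_le (A := Aᵐᵒᵖ) X (x := x) (y := y)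

theorem norm_le_of_inn {x : X} {C : ℝ} (hC : 0 ≤ C) (h : ∀ y : X, ‖inn (A := A) y x‖ ≤ C * ‖y‖) :
    ‖x‖ ≤ C := by
  have h1 := h x
  rw [← norm_sq, sq] at h1
  rcases eq_or_ne x 0 with rfl | hx
  · simpa using hC
  · exact le_of_mul_le_mul_right h1 (norm_pos_iff.2 hx)

end

/-- A `C⋆`-algebra as a Hilbert module over itself, with `⟨a, b⟩ = a⋆ b`. -/
instance self (A : Type*) [NonUnitalCStarAlgebra A] : HilbertModule A A where
  act a b := a * b
  inn a b := star a * b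
  add_act := add_mul
  act_add := mul_add
  act_mul a b c := (mul_assoc a b c).symm
  smul_act c a b := smul_mul_assoc c a b
  act_smul c a b := mul_smul_comm c a b
  inn_add a b c := mul_add _ _ _
  inn_smul c a b := mul_smul_comm _ _ _
  inn_act a b c := (mul_assoc _ _ _).symm
  star_inn a b := by simp
  inn_self_pos a := ⟨a, rfl⟩
  norm_sq a := by rw [CStarRing.norm_star_mul_self, sq]

end HilbertModule

open HilbertModule

section Adjointable

variable (A X : Type*) [NonUnitalCStarAlgebra A] [NormedAddCommGroup X]
    [NormedSpace ℂ X] [CompleteSpace X] [HilbertModule A X]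

/-- `S` is an adjoint of `T`. -/
def IsAdjointOf (T S : X →L[ℂ] X) : Prop := ∀ x y : X, inn (A := A) (T x) y = inn x (S y)

variable {A X}

theorem IsAdjointOf.symm {T S : X →L[ℂ] X} (h : IsAdjointOf A X T S) : IsAdjointOf A X S T := by
  intro x y
  rw [← star_inn, ← h, star_inn]

theorem IsAdjointOf.unique {T S S' : X →L[ℂ] X} (h : IsAdjointOf A X T S)
    (h' : IsAdjointOf A X T S') : S = S' := by
  ext y
  exact ext_inn A fun z => by rw [← h, ← h']

theorem IsAdjointOf.add {T S T' S' : X →L[ℂ] X} (h : IsAdjointOf A X T S)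
    (h' : IsAdjointOf A X T' S') : IsAdjointOf A X (T + T') (S + S') := by
  intro x y
  simp [add_inn, inn_add, h x y, h' x y]

theorem IsAdjointOf.smul {T S : X →L[ℂ] X} (c : ℂ) (h : IsAdjointOf A X T S) :
    IsAdjointOf A X (c • T) (star c • S) := by
  intro x y
  simp [smul_inn, inn_smul, h x y]

theorem IsAdjointOf.mul {T S T' S' : X →L[ℂ] X} (h : IsAdjointOf A X T S)
    (h' : IsAdjointOf A X T' S') : IsAdjointOf A X (T * T') (S' * S) := by
  intro x y
  simp [h _ y, h' x _]

theorem IsAdjointOf.norm_le {T S : X →L[ℂ] X} (h : IsAdjointOf A X T S) : ‖S‖ ≤ ‖T‖ := by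
  refine S.opNorm_le_bound (norm_nonneg _) fun y => ?_
  refine norm_le_of_inn (A := A) (by positivity) fun x => ?_
  rw [← h]
  calc _ ≤ ‖T x‖ * ‖y‖ := norm_inn_le _ _
    _ ≤ ‖T‖ * ‖x‖ * ‖y‖ := by gcongr; exact T.le_opNorm x
    _ = _ := by ring

theorem IsAdjointOf.norm_sq_le {T S : X →L[ℂ] X} (h : IsAdjointOf A X T S) :
    ‖T‖ * ‖T‖ ≤ ‖S * T‖ := by
  have : ‖T‖ ≤ √‖S * T‖ := by
    refine T.opNorm_le_bound (by positivity) fun x => ?_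
    refine le_of_sq_le_sq ?_ (by positivity)
    rw [norm_sq (A := A), mul_pow, Real.sq_sqrt (norm_nonneg _), h]
    calc _ ≤ ‖x‖ * ‖(S * T) x‖ := norm_inn_le _ _
      _ ≤ ‖x‖ * (‖S * T‖ * ‖x‖) := by gcongr; exact (S * T).le_opNorm x
      _ = _ := by ring
  calc _ ≤ √‖S * T‖ * √‖S * T‖ := by gcongr
    _ = _ := Real.mul_self_sqrt (norm_nonneg _)

variable (A X) in
/-- The adjointable operators, as a subalgebra of all bounded operators. -/
def adjointableSubalgebra : Subalgebra ℂ (X →L[ℂ] X) where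
  carrier := {T | ∃ S, IsAdjointOf A X T S}
  mul_mem' := fun ⟨_, h⟩ ⟨_, h'⟩ => ⟨_, h.mul h'⟩
  add_mem' := fun ⟨_, h⟩ ⟨_, h'⟩ => ⟨_, h.add h'⟩
  algebraMap_mem' c := ⟨star c • 1, by
    have h1 : IsAdjointOf A X 1 1 := fun x y => rfl
    simpa [Algebra.algebraMap_eq_smul_one] using h1.smul c⟩

theorem isClosed_adjointableSubalgebra :
    IsClosed (adjointableSubalgebra A X : Set (X →L[ℂ] X)) := by
  refine isClosed_of_closure_subset fun T hT => ?_
  obtain ⟨u, hu, hlim⟩ := mem_closure_iff_seq_limit.1 hT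
  choose s hs using hu
  have hc : CauchySeq s := by
    have := hlim.cauchySeq
    rw [Metric.cauchySeq_iff] at this ⊢
    intro ε hε
    obtain ⟨N, hN⟩ := this ε hε
    refine ⟨N, fun m hm n hn => lt_of_le_of_lt ?_ (hN m hm n hn)⟩
    have h1 := ((hs m).add ((hs n).smul (-1))).norm_le
    rw [dist_eq_norm, dist_eq_norm]
    simpa [sub_eq_add_neg] using h1
  obtain ⟨S, hS⟩ := cauchySeq_tendsto_of_complete hc
  refine ⟨S, fun x y => ?_⟩
  have e1 : Tendsto (fun n => inn (A := A) (u n x) y) atTop (𝓝 (inn (A := A) (T x) y)) := by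
    rw [tendsto_iff_norm_sub_tendsto_zero]
    have h0 : Tendsto (fun n => ‖u n - T‖ * ‖x‖ * ‖y‖) atTop (𝓝 0) := by
      have := tendsto_iff_norm_sub_tendsto_zero.1 hlim
      simpa using (this.mul_const ‖x‖).mul_const ‖y‖
    refine squeeze_zero (fun _ => norm_nonneg _) (fun n => ?_) h0
    rw [← sub_inn]
    refine (norm_inn_le _ _).trans ?_
    gcongr
    exact (u n - T).le_opNorm x
  have e2 : Tendsto (fun n => inn (A := A) x (s n y)) atTop (𝓝 (inn (A := A) x (S y))) := by
    rw [tendsto_iff_norm_sub_tendsto_zero]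
    have h0 : Tendsto (fun n => ‖x‖ * (‖s n - S‖ * ‖y‖)) atTop (𝓝 0) := by
      have := tendsto_iff_norm_sub_tendsto_zero.1 hS
      simpa using (this.mul_const ‖y‖).const_mul ‖x‖
    refine squeeze_zero (fun _ => norm_nonneg _) (fun n => ?_) h0
    rw [← inn_sub]
    refine (norm_inn_le _ _).trans ?_
    gcongr
    exact (s n - S).le_opNorm y
  refine tendsto_nhds_unique e1 (e2.congr fun n => (hs n x y).symm)

instance : CompleteSpace (adjointableSubalgebra A X) :=
  (isClosed_adjointableSubalgebra (A := A) (X := X)).completeSpace_coe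

noncomputable instance : Star (adjointableSubalgebra A X) :=
  ⟨fun T => ⟨T.2.choose, T.1, T.2.choose_spec.symm⟩⟩

theorem isAdjointOf_star (T : adjointableSubalgebra A X) : IsAdjointOf A X T.1 (star T).1 :=
  T.2.choose_spec

theorem star_eq_of_isAdjointOf {T S : adjointableSubalgebra A X} (h : IsAdjointOf A X T.1 S.1) :
    star T = S :=
  Subtype.ext ((isAdjointOf_star T).unique h)

noncomputable instance : StarRing (adjointableSubalgebra A X) where
  star_involutive T := star_eq_of_isAdjointOf (isAdjointOf_star T).symm
  star_mul S T := star_eq_of_isAdjointOf ((isAdjointOf_star S).mul (isAdjointOf_star T))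
  star_add S T := star_eq_of_isAdjointOf ((isAdjointOf_star S).add (isAdjointOf_star T))

noncomputable instance : CStarAlgebra (adjointableSubalgebra A X) where
  norm_mul_self_le T := (isAdjointOf_star T).norm_sq_le
  star_smul c T := star_eq_of_isAdjointOf ((isAdjointOf_star T).smul c)

variable (A X) in
/-- The `C⋆`-algebra `End⋆_A(X)` of adjointable operators on the Hilbert `A`-module `X`, with the
operator norm. -/
def Adjointable : Type _ := adjointableSubalgebra A X

namespace Adjointable

noncomputable instance : CStarAlgebra (Adjointable A X) :=
  inferInstanceAs (CStarAlgebra (adjointableSubalgebra A X))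

instance : CoeFun (Adjointable A X) fun _ => X → X := ⟨fun T => T.1⟩

theorem inn_apply_left (T : Adjointable A X) (x y : X) :
    inn (A := A) (T x) y = inn x (star T y) := isAdjointOf_star T x y

theorem star_eq {T S : Adjointable A X} (h : ∀ x y : X, inn (A := A) (T x) y = inn x (S y)) :
    star T = S :=
  star_eq_of_isAdjointOf h

/-- The rank one operator `T_{ξ,η} : x ↦ ξ⟨η, x⟩`. -/
noncomputable def rankOne (ξ η : X) : Adjointable A X :=
  have bd : ∀ (ξ η x : X), ‖act ξ (inn (A := A) η x)‖ ≤ ‖ξ‖ * ‖η‖ * ‖x‖ := fun ξ η x => by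
    refine norm_le_of_inn (A := A) (by positivity) fun y => ?_
    rw [inn_act]
    calc _ ≤ ‖inn (A := A) y ξ‖ * ‖inn (A := A) η x‖ := norm_mul_le _ _
      _ ≤ (‖y‖ * ‖ξ‖) * (‖η‖ * ‖x‖) := by gcongr <;> exact norm_inn_le _ _
      _ = _ := by ring
  let op (ξ η : X) : X →L[ℂ] X := LinearMap.mkContinuous
    { toFun := fun x => act ξ (inn (A := A) η x)
      map_add' := fun x y => by rw [inn_add, act_add]
      map_smul' := fun c x => by simp [inn_smul, act_smul] } (‖ξ‖ * ‖η‖) (bd ξ η)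
  ⟨op ξ η, op η ξ, fun x y => by
    change inn (A := A) (act ξ (inn η x)) y = inn x (act η (inn ξ y))
    rw [act_inn, inn_act, star_inn]⟩

theorem rankOne_apply (ξ η x : X) :
    (rankOne ξ η : Adjointable A X) x = act ξ (inn (A := A) η x) := rfl

variable (A X) in
/-- The compact operators `𝕂_A(X)`: norm limits of sums of rank one operators. -/
noncomputable def compacts : Submodule ℂ (Adjointable A X) :=
  (Submodule.span ℂ (Set.range fun ξη : X × X => rankOne (A := A) ξη.1 ξη.2)).topologicalClosure

end Adjointable
end Adjointable

section Operators

variable {H K : Type*} [NormedAddCommGroup H] [InnerProductSpace ℂ H] [CompleteSpace H]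
  [NormedAddCommGroup K] [InnerProductSpace ℂ K] [CompleteSpace K]

/-- A closed space `M` of operators, as a Hilbert module over a closed `⋆`-algebra `B` of operators:
the action is `S · T = S ∘ T` and the inner product is `⟨S, T⟩ = S⋆ ∘ T`. -/
noncomputable abbrev HilbertModule.ofOperators (B : NonUnitalStarSubalgebra ℂ (H →L[ℂ] H))
    [IsClosed (B : Set (H →L[ℂ] H))] (M : Submodule ℂ (H →L[ℂ] K)) [CompleteSpace M]
    (h1 : ∀ S ∈ M, ∀ T ∈ B, S ∘L T ∈ M)
    (h2 : ∀ S ∈ M, ∀ T ∈ M, S.adjoint ∘L T ∈ B) : HilbertModule B M where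
  act S T := ⟨S.1 ∘L T.1, h1 _ S.2 _ T.2⟩
  inn S T := ⟨S.1.adjoint ∘L T.1, h2 _ S.2 _ T.2⟩
  add_act S T a := Subtype.ext (ContinuousLinearMap.add_comp _ _ _)
  act_add S a b := Subtype.ext (ContinuousLinearMap.comp_add _ _ _)
  act_mul S a b := rfl
  smul_act c S a := Subtype.ext (ContinuousLinearMap.smul_comp _ _ _)
  act_smul c S a := Subtype.ext (ContinuousLinearMap.comp_smul _ _ _)
  inn_add S T U := Subtype.ext (ContinuousLinearMap.comp_add _ _ _)
  inn_smul c S T := Subtype.ext (ContinuousLinearMap.comp_smul _ _ _)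
  inn_act S T a := rfl
  star_inn S T := Subtype.ext (by
    change star (S.1.adjoint ∘L T.1) = T.1.adjoint ∘L S.1
    rw [ContinuousLinearMap.star_eq_adjoint, ContinuousLinearMap.adjoint_comp,
      ContinuousLinearMap.adjoint_adjoint])
  inn_self_pos S := by
    have h0 : 0 ≤ S.1.adjoint ∘L S.1 := by
      rw [ContinuousLinearMap.nonneg_iff_isPositive]
      exact ContinuousLinearMap.isPositive_adjoint_comp_self S.1
    refine ⟨⟨CFC.sqrt (S.1.adjoint ∘L S.1), ?_⟩, Subtype.ext ?_⟩
    · rw [CFC.sqrt_eq_real_sqrt _ h0]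
      exact cfcₙ_mem (𝕜' := ℂ) Real.sqrt (h2 _ S.2 _ S.2)
    · change S.1.adjoint ∘L S.1 = star (CFC.sqrt (S.1.adjoint ∘L S.1)) * CFC.sqrt (S.1.adjoint ∘L S.1)
      rw [(CFC.sqrt_nonneg (S.1.adjoint ∘L S.1)).isSelfAdjoint.star_eq,
        CFC.sqrt_mul_sqrt_self _ h0]
  norm_sq S := by
    rw [sq]
    exact (ContinuousLinearMap.norm_adjoint_comp_self S.1).symm

end Operators

section Kernel

variable {ι κ : Type*}

theorem posSemidef_of_local {k : Matrix ι ι ℂ}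
    (h : ∀ s : Finset ι, ∃ m : Matrix ι ι ℂ, m.PosSemidef ∧ ∀ i ∈ s, ∀ j ∈ s, k i j = m i j) :
    k.PosSemidef := by
  classical
  refine ⟨?_, fun x => ?_⟩
  · ext i j
    obtain ⟨m, hm, e⟩ := h {i, j}
    rw [Matrix.conjTranspose_apply, e i (by simp) j (by simp), e j (by simp) i (by simp)]
    exact hm.isHermitian.apply i j
  · obtain ⟨m, hm, e⟩ := h x.support
    refine (hm.2 x).trans_eq ?_
    refine Finset.sum_congr rfl fun i hi => Finset.sum_congr rfl fun j hj => ?_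
    simp only [e i hi j hj]

theorem posSemidef_mul {k l : Matrix ι ι ℂ} (hk : k.PosSemidef) (hl : l.PosSemidef) :
    (Matrix.of fun i j => k i j * l i j : Matrix ι ι ℂ).PosSemidef :=
  hk.hadamard hl

theorem posSemidef_rankOne (g : ι → ℂ) :
    (Matrix.of fun i j => star (g i) * g j : Matrix ι ι ℂ).PosSemidef := by
  refine ⟨?_, fun x => ?_⟩
  · ext i j
    simp [mul_comm]
  · have : (x.sum fun i xi => x.sum fun j xj =>
        star xi * (Matrix.of fun i j => star (g i) * g j : Matrix ι ι ℂ) i j * xj) =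
        star (x.sum fun i xi => g i * xi) * x.sum fun i xi => g i * xi := by
      simp only [Finsupp.sum, star_sum, Finset.sum_mul_sum]
      refine Finset.sum_congr rfl fun i hi => Finset.sum_congr rfl fun j hj => ?_
      simp
      ring
    rw [this]
    exact star_mul_self_nonneg _

theorem posSemidef_prod {σ : Type*} (s : Finset σ) {k : σ → Matrix ι ι ℂ}
    (h : ∀ v ∈ s, (k v).PosSemidef) :
    (Matrix.of fun i j => ∏ v ∈ s, k v i j : Matrix ι ι ℂ).PosSemidef := by
  classical
  induction s using Finset.induction_on with
  | empty => simpa using posSemidef_rankOne (fun _ : ι => (1 : ℂ))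
  | insert v s hv ih =>
    have := posSemidef_mul (h v (by simp)) (ih fun w hw => h w (by simp [hw]))
    simpa [hv] using this

theorem posSemidef_prod_sub {σ : Type*} (s : Finset σ) {k l : σ → Matrix ι ι ℂ} {C : σ → ℝ}
    (hl : ∀ v ∈ s, (l v).PosSemidef)
    (h : ∀ v ∈ s, (C v • k v - l v).PosSemidef) :
    (Matrix.of fun i j => (∏ v ∈ s, C v) • (∏ v ∈ s, k v i j) - ∏ v ∈ s, l v i j :
      Matrix ι ι ℂ).PosSemidef := by
  classical
  induction s using Finset.induction_on with
  | empty =>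
    convert (Matrix.PosSemidef.zero : (0 : Matrix ι ι ℂ).PosSemidef) using 1
    ext i j
    simp
  | insert v s hv ih =>
    have h1 := ih (fun w hw => hl w (by simp [hw])) (fun w hw => h w (by simp [hw]))
    have hs := posSemidef_prod s (fun w hw => hl w (by simp [hw]))
    have hCk : (C v • k v).PosSemidef := by
      have := (h v (by simp)).add (hl v (by simp))
      simpa using this
    have h2 := (posSemidef_mul hCk h1).add (posSemidef_mul (h v (by simp)) hs)
    convert h2 using 1
    ext i j
    simp [hv]
    ring

/-- The sesquilinear form on finitely supported functions given by a kernel. -/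
noncomputable def kernelForm (k : Matrix ι ι ℂ) (f g : ι →₀ ℂ) : ℂ :=
  f.sum fun i a => g.sum fun j b => star a * k i j * b

theorem kernelForm_single (k : Matrix ι ι ℂ) (i j : ι) :
    kernelForm k (Finsupp.single i 1) (Finsupp.single j 1) = k i j := by
  rw [kernelForm, Finsupp.sum_single_index, Finsupp.sum_single_index] <;> simp

theorem kernelForm_add (k : Matrix ι ι ℂ) (f g h : ι →₀ ℂ) :
    kernelForm k (f + g) h = kernelForm k f h + kernelForm k g h := by
  refine Finsupp.sum_add_index' (by simp) fun i a b => ?_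
  rw [← Finsupp.sum_add]
  simp [add_mul]

theorem kernelForm_smul (k : Matrix ι ι ℂ) (c : ℂ) (f g : ι →₀ ℂ) :
    kernelForm k (c • f) g = star c * kernelForm k f g := by
  rw [kernelForm, Finsupp.sum_smul_index (by simp), kernelForm, Finsupp.mul_sum]
  refine Finsupp.sum_congr fun i _ => ?_
  rw [Finsupp.mul_sum]
  simp [mul_assoc]

theorem kernelForm_symm {k : Matrix ι ι ℂ} (hk : k.PosSemidef) (f g : ι →₀ ℂ) :
    star (kernelForm k f g) = kernelForm k g f := by
  rw [kernelForm, kernelForm, Finsupp.sum_comm]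
  simp only [Finsupp.sum, star_sum]
  refine Finset.sum_congr rfl fun i _ => Finset.sum_congr rfl fun j _ => ?_
  rw [← hk.isHermitian.apply i j]
  simp
  ring

/-- The free vector space on `ι`, with the semi-inner product `⟨δ i, δ j⟩ = k i j`. -/
def PreKernelSpace (k : Matrix ι ι ℂ) (_ : k.PosSemidef) : Type _ := ι →₀ ℂ

variable {k : Matrix ι ι ℂ} {hk : k.PosSemidef} {l : Matrix κ κ ℂ} {hl : l.PosSemidef}

noncomputable instance : AddCommGroup (PreKernelSpace k hk) :=
  inferInstanceAs (AddCommGroup (ι →₀ ℂ))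
noncomputable instance : Module ℂ (PreKernelSpace k hk) :=
  inferInstanceAs (Module ℂ (ι →₀ ℂ))

/-- The semi-inner product of a positive semidefinite kernel. -/
noncomputable abbrev PreKernelSpace.core (k : Matrix ι ι ℂ) (hk : k.PosSemidef) :
    PreInnerProductSpace.Core ℂ (PreKernelSpace k hk) where
  inner f g := kernelForm k f g
  conj_inner_symm f g := kernelForm_symm hk g f
  re_inner_nonneg f := (RCLike.nonneg_iff.mp (hk.2 f)).1
  add_left f g h := kernelForm_add k f g h
  smul_left f g c := kernelForm_smul k c f g

noncomputable instance : SeminormedAddCommGroup (PreKernelSpace k hk) :=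
  InnerProductSpace.Core.toSeminormedAddCommGroup (c := PreKernelSpace.core k hk)
noncomputable instance : InnerProductSpace ℂ (PreKernelSpace k hk) :=
  InnerProductSpace.ofCore (PreKernelSpace.core k hk)

/-- The Hilbert space of a positive semidefinite kernel: it is generated by vectors `δ i`, with
`⟨δ i, δ j⟩ = k i j`. -/
def KernelSpace (k : Matrix ι ι ℂ) (hk : k.PosSemidef) : Type _ :=
  UniformSpace.Completion (PreKernelSpace k hk)

noncomputable instance : NormedAddCommGroup (KernelSpace k hk) :=
  inferInstanceAs (NormedAddCommGroup (UniformSpace.Completion (PreKernelSpace k hk)))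
noncomputable instance : InnerProductSpace ℂ (KernelSpace k hk) :=
  inferInstanceAs (InnerProductSpace ℂ (UniformSpace.Completion (PreKernelSpace k hk)))
instance : CompleteSpace (KernelSpace k hk) :=
  inferInstanceAs (CompleteSpace (UniformSpace.Completion (PreKernelSpace k hk)))

namespace KernelSpace

open scoped InnerProductSpace

/-- The generating vectors, before completion. -/
noncomputable def preδ (hk : k.PosSemidef) (i : ι) : PreKernelSpace k hk := Finsupp.single i (1 : ℂ)

/-- The canonical map to the completion. -/
noncomputable def ofPre (hk : k.PosSemidef) : PreKernelSpace k hk →L[ℂ] KernelSpace k hk :=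
  UniformSpace.Completion.toComplL

/-- The generating vectors. -/
noncomputable def δ (hk : k.PosSemidef) (i : ι) : KernelSpace k hk := ofPre hk (preδ hk i)

theorem inner_δ (i j : ι) : ⟪δ hk i, δ hk j⟫_ℂ = k i j :=
  (UniformSpace.Completion.inner_coe (𝕜 := ℂ) (preδ hk i) (preδ hk j)).trans
    (kernelForm_single k i j)

theorem dense_span_δ : Dense (Submodule.span ℂ (Set.range (δ hk)) : Set (KernelSpace k hk)) := by
  have h0 : ∀ f : PreKernelSpace k hk, ofPre hk f ∈ Submodule.span ℂ (Set.range (δ hk)) := by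
    intro f
    have h1 : f ∈ Submodule.span ℂ (Set.range (preδ hk)) := by
      have := (Finsupp.basisSingleOne (R := ℂ) (ι := ι)).mem_span f
      exact this
    induction h1 using Submodule.span_induction with
    | mem x hx =>
      obtain ⟨i, rfl⟩ := hx
      exact Submodule.subset_span ⟨i, rfl⟩
    | zero => rw [map_zero]; exact Submodule.zero_mem _
    | add x y _ _ hx hy => rw [map_add]; exact Submodule.add_mem _ hx hy
    | smul c x _ hx => rw [map_smul]; exact Submodule.smul_mem _ c hx
  have hd : DenseRange (ofPre hk) := UniformSpace.Completion.denseRange_coe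
  refine hd.mono ?_
  rintro _ ⟨f, rfl⟩
  exact h0 f

theorem ext_δ {E : Type*} [NormedAddCommGroup E] [NormedSpace ℂ E] {S T : KernelSpace k hk →L[ℂ] E}
    (h : ∀ i, S (δ hk i) = T (δ hk i)) : S = T := by
  refine ContinuousLinearMap.ext_on dense_span_δ ?_
  rintro _ ⟨i, rfl⟩
  exact h i

theorem ext_inner_δ {x y : KernelSpace k hk} (h : ∀ i, ⟪δ hk i, x⟫_ℂ = ⟪δ hk i, y⟫_ℂ) :
    x = y := by
  have : innerSL ℂ x = innerSL ℂ y := ext_δ fun i => by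
    rw [innerSL_apply_apply, innerSL_apply_apply, ← inner_conj_symm, h, inner_conj_symm]
  refine ext_inner_right ℂ fun z => ?_
  exact DFunLike.congr_fun this z

theorem kernelForm_mapDomain (τ : ι → κ) (f g : ι →₀ ℂ) :
    kernelForm l (f.mapDomain τ) (g.mapDomain τ) =
      kernelForm (Matrix.of fun i j => l (τ i) (τ j)) f g := by
  rw [kernelForm, Finsupp.sum_mapDomain_index (by simp) (by
    intro b m n; rw [← Finsupp.sum_add]; simp [add_mul])]
  refine Finsupp.sum_congr fun i _ => ?_
  rw [Finsupp.sum_mapDomain_index (by simp) (by intro b m n; ring)]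
  simp

/-- The operator `δ i ↦ δ (τ i)`, for a map `τ` that contracts the kernels up to a constant. -/
noncomputable def lift (hk : k.PosSemidef) (hl : l.PosSemidef) (τ : ι → κ)
    (h : ∃ C : ℝ, (Matrix.of fun i j => C • k i j - l (τ i) (τ j)).PosSemidef) :
    KernelSpace k hk →L[ℂ] KernelSpace l hl :=
  (LinearMap.mkContinuousOfExistsBound
    (show PreKernelSpace k hk →ₗ[ℂ] PreKernelSpace l hl from Finsupp.lmapDomain ℂ ℂ τ) (by
      obtain ⟨C, hC⟩ := h
      have hC' : ∀ f : ι →₀ ℂ, (kernelForm l (f.mapDomain τ) (f.mapDomain τ)).re ≤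
          C * (kernelForm k f f).re := by
        intro f
        rw [kernelForm_mapDomain]
        have h1 := (RCLike.nonneg_iff.mp (hC.2 f)).1
        have h2 : kernelForm (Matrix.of fun i j => C • k i j - l (τ i) (τ j)) f f =
            C * kernelForm k f f - kernelForm (Matrix.of fun i j => l (τ i) (τ j)) f f := by
          simp only [kernelForm, Finsupp.sum, Finset.mul_sum, ← Finset.sum_sub_distrib]
          refine Finset.sum_congr rfl fun i _ => Finset.sum_congr rfl fun j _ => ?_
          simp
          ring
        have h3 : 0 ≤ (kernelForm (Matrix.of fun i j => C • k i j - l (τ i) (τ j)) f f).re := h1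
        rw [h2] at h3
        simpa using h3
      have hn : ∀ f : PreKernelSpace k hk, ‖f‖ ^ 2 = (kernelForm k f f).re := fun f =>
        (inner_self_eq_norm_sq (𝕜 := ℂ) f).symm
      have hn' : ∀ f : PreKernelSpace l hl, ‖f‖ ^ 2 = (kernelForm l f f).re := fun f =>
        (inner_self_eq_norm_sq (𝕜 := ℂ) f).symm
      refine ⟨√(max C 0), fun f => ?_⟩
      refine le_of_sq_le_sq ?_ (by positivity)
      rw [mul_pow, Real.sq_sqrt (le_max_right _ _), hn, hn']
      refine (hC' f).trans ?_
      have : 0 ≤ (kernelForm k f f).re := by rw [← hn f]; positivity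
      gcongr
      exact le_max_left _ _)).completion

theorem lift_δ (τ : ι → κ)
    (h : ∃ C : ℝ, (Matrix.of fun i j => C • k i j - l (τ i) (τ j)).PosSemidef) (i : ι) :
    lift hk hl τ h (δ hk i) = δ hl (τ i) := by
  refine (ContinuousLinearMap.completion_apply_coe _ (preδ hk i)).trans ?_
  exact congrArg (ofPre hl) (Finsupp.mapDomain_single (f := τ) (a := i) (b := (1 : ℂ)))

end KernelSpace
end Kernel

section Functional

variable {A X : Type*} [NonUnitalCStarAlgebra A] [NormedAddCommGroup X]
    [NormedSpace ℂ X] [CompleteSpace X] [HilbertModule A X]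

theorem functional_star {φ : A →ₗ[ℂ] ℂ} (hφ : ∀ a, 0 ≤ φ (star a * a)) (a : A) :
    φ (star a) = star (φ a) := by
  let _ : PartialOrder A := CStarAlgebra.spectralOrder A
  have _ : StarOrderedRing A := CStarAlgebra.spectralOrderedRing A
  let f : A →ₚ[ℂ] ℂ := PositiveLinearMap.mk₀ φ fun b hb => by
    obtain ⟨c, rfl⟩ := CStarAlgebra.nonneg_iff_eq_star_mul_self.1 hb
    exact hφ c
  exact map_star f a

theorem functional_le {φ : A →ₗ[ℂ] ℂ} (hφ : ∀ a, 0 ≤ φ (star a * a)) (b : A) (u : A) :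
    φ (star u * (star b * b) * u) ≤ ‖b‖ ^ 2 • φ (star u * u) := by
  let _ : PartialOrder A := CStarAlgebra.spectralOrder A
  have _ : StarOrderedRing A := CStarAlgebra.spectralOrderedRing A
  let f : A →ₚ[ℂ] ℂ := PositiveLinearMap.mk₀ φ fun b hb => by
    obtain ⟨c, rfl⟩ := CStarAlgebra.nonneg_iff_eq_star_mul_self.1 hb
    exact hφ c
  have h1 : star u * (star b * b) * u ≤ ‖star b * b‖ • (star u * u) :=
    CStarAlgebra.star_left_conjugate_le_norm_smul (IsSelfAdjoint.star_mul_self b)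
  have h2 : f (star u * (star b * b) * u) ≤ f (‖star b * b‖ • (star u * u)) :=
    OrderHomClass.mono f h1
  have h3 : f (‖star b * b‖ • (star u * u)) = ‖star b * b‖ • φ (star u * u) := by
    rw [← Complex.coe_smul, ← Complex.coe_smul]
    exact φ.map_smul _ _
  rw [h3, CStarRing.norm_star_mul_self, ← sq] at h2
  exact h2

theorem act_sum {ι : Type*} (s : Finset ι) (x : X) (a : ι → A) :
    act x (∑ i ∈ s, a i) = ∑ i ∈ s, act x (a i) :=
  map_sum (AddMonoidHom.mk' (fun b : A => act x b) (act_add x)) a s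

theorem sum_functional_inn (φ : A →ₗ[ℂ] ℂ) {ι : Type*} (w : ι → X) (c : ι →₀ ℂ) :
    (c.sum fun i a => c.sum fun j b => star a * φ (inn (w i) (w j)) * b) =
      φ (inn (c.sum fun i a => a • w i) (c.sum fun i a => a • w i)) := by
  simp only [Finsupp.sum, sum_inn, inn_sum, map_sum, smul_inn, inn_smul, map_smul, smul_eq_mul,
    Finset.mul_sum]
  rw [Finset.sum_comm]
  refine Finset.sum_congr rfl fun i _ => Finset.sum_congr rfl fun j _ => ?_
  ring

/-- The kernel `(i, j) ↦ φ ⟨w i, w j⟩` is positive semidefinite. -/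
theorem posSemidef_functional {φ : A →ₗ[ℂ] ℂ} (hφ : ∀ a, 0 ≤ φ (star a * a)) {ι : Type*}
    (w : ι → X) : (Matrix.of fun i j => φ (inn (w i) (w j)) : Matrix ι ι ℂ).PosSemidef := by
  refine ⟨?_, fun c => ?_⟩
  · ext i j
    rw [Matrix.conjTranspose_apply, Matrix.of_apply, Matrix.of_apply, ← functional_star hφ,
      star_inn]
  · obtain ⟨a, ha⟩ := inn_self_pos (A := A) (c.sum fun i a => a • w i)
    refine le_of_le_of_eq ?_ (sum_functional_inn φ w c).symm
    rw [ha]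
    exact hφ a

theorem posSemidef_functional_sub {φ : A →ₗ[ℂ] ℂ} (hφ : ∀ a, 0 ≤ φ (star a * a)) (w : X)
    {C : ℝ} (hC : ‖w‖ ^ 2 ≤ C) {ι : Type*} (a : ι → A) :
    (C • (Matrix.of fun i j => φ (star (a i) * a j) : Matrix ι ι ℂ) -
      (Matrix.of fun i j => φ (inn (act w (a i)) (act w (a j))))).PosSemidef := by
  have p1 := posSemidef_functional (X := A) hφ a
  have p2 := posSemidef_functional hφ (fun i => act w (a i))
  have h1 : (C • (Matrix.of fun i j => φ (star (a i) * a j) : Matrix ι ι ℂ)).IsHermitian := by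
    ext i j
    have := p1.isHermitian.apply i j
    simp only [Matrix.of_apply] at this
    simp only [Matrix.conjTranspose_apply, Matrix.smul_apply, Matrix.of_apply, star_smul]
    rw [show star (φ (star (a j) * a i)) = φ (star (a i) * a j) from this]
    simp
  refine ⟨h1.sub p2.isHermitian, fun c => ?_⟩
  set u : A := c.sum fun i r => r • a i with hu
  have e1 := sum_functional_inn φ a c
  have e2 := sum_functional_inn φ (fun i => act w (a i)) c
  have e3 : (c.sum fun i r => r • act w (a i)) = act w u := by
    rw [hu, Finsupp.sum, Finsupp.sum, act_sum]
    simp only [act_smul]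
  rw [e3] at e2
  have e4 : (c.sum fun i xi => c.sum fun j xj => star xi *
      (C • (Matrix.of fun i j => φ (star (a i) * a j) : Matrix ι ι ℂ) -
      (Matrix.of fun i j => φ (inn (act w (a i)) (act w (a j))))) i j * xj) =
      C • φ (star u * u) - φ (inn (act w u) (act w u)) := by
    rw [← e2, show φ (star u * u) = φ (inn u u) from rfl, ← e1]
    simp only [Finsupp.sum, Finset.smul_sum, ← Finset.sum_sub_distrib]
    refine Finset.sum_congr rfl fun i _ => Finset.sum_congr rfl fun j _ => ?_
    simp [inn]
    ring
  rw [e4, sub_nonneg]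
  obtain ⟨d, hd⟩ := inn_self_pos (A := A) w
  have hdn : ‖d‖ ^ 2 = ‖w‖ ^ 2 := by
    rw [norm_sq (A := A) w, hd, CStarRing.norm_star_mul_self, sq]
  rw [inn_act, act_inn, hd]
  refine (functional_le hφ d u).trans ?_
  rw [hdn]
  exact smul_le_smul_of_nonneg_right hC (hφ u)

end Functional

section Restricted

variable {I : Type*}

/-- Families that agree with the distinguished family `q` at all but finitely many places. They
index the simple tensors of a restricted tensor product. -/
@[ext]
structure RestrictedFamily {Y : I → Type*} (q : ∀ v, Y v) where
  val : ∀ v, Y v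
  eventually_eq : ∀ᶠ v in cofinite, val v = q v

instance {Y : I → Type*} (q : ∀ v, Y v) : CoeFun (RestrictedFamily q) fun _ => ∀ v, Y v :=
  ⟨RestrictedFamily.val⟩

/-- A family of elements `p v` of the `C⋆`-algebras `A v`, which are nonzero projections at all but
finitely many places. -/
structure ProjectionFamily (A : I → Type*) [∀ v, NonUnitalCStarAlgebra (A v)] where
  proj : ∀ v, A v
  isStarProjection : ∀ᶠ v in cofinite, IsStarProjection (proj v)
  ne_zero : ∀ᶠ v in cofinite, proj v ≠ 0

variable {A : I → Type*} [∀ v, NonUnitalCStarAlgebra (A v)]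

/-- Vectors `x v` in Hilbert `A v`-modules, with `⟨x v, x v⟩ = p v` at all but finitely many
places. -/
structure CompatibleVectors (p : ProjectionFamily A) (X : I → Type*)
    [∀ v, NormedAddCommGroup (X v)] [∀ v, NormedSpace ℂ (X v)] [∀ v, CompleteSpace (X v)]
    [∀ v, HilbertModule (A v) (X v)] where
  vec : ∀ v, X v
  inn_vec : ∀ᶠ v in cofinite, inn (A := A v) (vec v) (vec v) = p.proj v

/-- The algebras `A v`, with their distinguished projections, as Hilbert modules over themselves. -/
abbrev ProjectionFamily.toVectors (p : ProjectionFamily A) : CompatibleVectors p A where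
  vec := p.proj
  inn_vec := p.isStarProjection.mono fun v h => by
    change star (p.proj v) * p.proj v = p.proj v
    rw [h.isSelfAdjoint.star_eq, h.isIdempotentElem.eq]

/-- A product `⊗ φ v` of positive functionals, with `φ v (p v) = 1` at all but finitely many
places. -/
structure ProductFunctional (p : ProjectionFamily A) where
  toFun : ∀ v, A v →ₗ[ℂ] ℂ
  nonneg : ∀ v (a : A v), 0 ≤ toFun v (star a * a)
  normalized : ∀ᶠ v in cofinite, toFun v (p.proj v) = 1

namespace CompatibleVectors

variable {p : ProjectionFamily A} {X : I → Type*}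
    [∀ v, NormedAddCommGroup (X v)] [∀ v, NormedSpace ℂ (X v)] [∀ v, CompleteSpace (X v)]
    [∀ v, HilbertModule (A v) (X v)] (x : CompatibleVectors p X)

/-- The index set of the simple tensors `⊗ w v` with `w v = x v` at all but finitely many places. -/
abbrev Family : Type _ := RestrictedFamily x.vec

theorem act_vec : ∀ᶠ v in cofinite, act (x.vec v) (p.proj v) = x.vec v := by
  filter_upwards [x.inn_vec, p.isStarProjection] with v h hp
  have hs := hp.isSelfAdjoint.star_eq
  have hi := hp.isIdempotentElem.eq
  refine sub_eq_zero.1 (eq_zero_of_inn (A v) ?_)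
  simp [inn_sub, sub_inn, inn_act, act_inn, h, hs, hi]

theorem norm_vec_le : ∀ᶠ v in cofinite, ‖x.vec v‖ ^ 2 ≤ 1 := by
  filter_upwards [x.inn_vec, p.isStarProjection] with v h hp
  rw [norm_sq (A := A v), h]
  exact hp.norm_le

/-- `(⊗ w v) · (⊗ a v) = ⊗ (w v · a v)`. -/
def famAct (w : x.Family) (a : p.toVectors.Family) : x.Family :=
  ⟨fun v => act (w v) (a v), by
    filter_upwards [w.2, a.2, x.act_vec] with v h1 h2 h3
    rw [h1, h2]
    exact h3⟩

/-- `⟨⊗ w v, ⊗ z v⟩ = ⊗ ⟨w v, z v⟩`. -/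
def famInn (w z : x.Family) : p.toVectors.Family :=
  ⟨fun v => inn (w v) (z v), by
    filter_upwards [w.2, z.2, x.inn_vec] with v h1 h2 h3
    rw [h1, h2]
    exact h3⟩

open Classical in
/-- The kernel `⟨(φ, w), (φ, z)⟩ = ∏ φ v ⟨w v, z v⟩`; vectors that belong to different product
functionals are orthogonal. -/
noncomputable def kernel : Matrix (ProductFunctional p × x.Family)
    (ProductFunctional p × x.Family) ℂ :=
  Matrix.of fun i j =>
    if i.1 = j.1 then ∏ᶠ v, i.1.toFun v (inn (A := A v) (i.2 v) (j.2 v)) else 0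

theorem eventually_finset (s : Finset (ProductFunctional p × x.Family)) :
    ∀ᶠ v in cofinite, ∀ i ∈ s, ∀ j ∈ s, i.1.toFun v (inn (A := A v) (i.2 v) (j.2 v)) = 1 := by
  have h1 : ∀ᶠ v in cofinite, ∀ i ∈ s, i.2 v = x.vec v :=
    (eventually_all_finset s).2 fun i _ => i.2.2
  have h2 : ∀ᶠ v in cofinite, ∀ i ∈ s, i.1.toFun v (p.proj v) = 1 :=
    (eventually_all_finset s).2 fun i _ => i.1.normalized
  filter_upwards [h1, h2, x.inn_vec] with v h1 h2 h3 i hi j hj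
  rw [h1 i hi, h1 j hj, h3, h2 i hi]

open Classical in
theorem kernel_eq_sum {s : Finset (ProductFunctional p × x.Family)} {S : Finset I}
    (hS : ∀ v ∉ S, ∀ i ∈ s, ∀ j ∈ s, i.1.toFun v (inn (A := A v) (i.2 v) (j.2 v)) = 1)
    {F : Finset (ProductFunctional p)} (hF : ∀ i ∈ s, i.1 ∈ F)
    {i j : ProductFunctional p × x.Family} (hi : i ∈ s) (hj : j ∈ s) :
    x.kernel i j = ∑ χ ∈ F, (star (if i.1 = χ then 1 else 0 : ℂ) * (if j.1 = χ then 1 else 0)) *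
      ∏ v ∈ S, χ.toFun v (inn (A := A v) (i.2 v) (j.2 v)) := by
  rw [Finset.sum_eq_single i.1]
  · rw [kernel, Matrix.of_apply]
    by_cases h : i.1 = j.1
    · rw [if_pos h, finprod_eq_prod_of_mulSupport_subset (s := S)]
      · simp [h]
      · intro v hv
        by_contra hvS
        exact hv (hS v hvS i hi j hj)
    · simp [h, Ne.symm h]
  · intro χ _ hχ
    simp [Ne.symm hχ]
  · intro h
    exact absurd (hF i hi) h

theorem kernel_posSemidef : x.kernel.PosSemidef := by
  classical
  refine posSemidef_of_local fun s => ?_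
  have hfin := x.eventually_finset s
  rw [eventually_cofinite] at hfin
  refine ⟨∑ χ ∈ s.image Prod.fst, Matrix.of fun i j : ProductFunctional p × x.Family =>
    (Matrix.of fun i j : ProductFunctional p × x.Family =>
      star (if i.1 = χ then 1 else 0 : ℂ) * (if j.1 = χ then 1 else 0) : Matrix _ _ ℂ) i j *
    (Matrix.of fun i j : ProductFunctional p × x.Family =>
      ∏ v ∈ hfin.toFinset, (Matrix.of fun i j : ProductFunctional p × x.Family =>
        χ.toFun v (inn (A := A v) (i.2 v) (j.2 v)) : Matrix _ _ ℂ) i j : Matrix _ _ ℂ) i j,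
    Matrix.posSemidef_sum _ fun χ _ => posSemidef_mul (posSemidef_rankOne _)
      (posSemidef_prod _ fun v _ => posSemidef_functional (χ.nonneg v) _), fun i hi j hj => ?_⟩
  rw [x.kernel_eq_sum (s := s) (S := hfin.toFinset) (F := s.image Prod.fst)
    (fun v hv => by simpa using hv) (fun i hi => Finset.mem_image_of_mem _ hi) hi hj,
    Matrix.sum_apply]
  rfl

theorem kernel_sub_posSemidef (w : x.Family) : ∃ C : ℝ,
    (Matrix.of fun i j : ProductFunctional p × p.toVectors.Family =>
      C • p.toVectors.kernel i j -
        x.kernel (i.1, x.famAct w i.2) (j.1, x.famAct w j.2)).PosSemidef := by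
  classical
  have hw : ∀ᶠ v in cofinite, ‖w v‖ ^ 2 ≤ 1 := by
    filter_upwards [w.2, x.norm_vec_le] with v h1 h2
    rwa [h1]
  have hwf := hw
  rw [eventually_cofinite] at hwf
  set c : I → ℝ := fun v => if v ∈ hwf.toFinset then ‖w v‖ ^ 2 else 1 with hc
  refine ⟨∏ v ∈ hwf.toFinset, c v, ?_⟩
  refine posSemidef_of_local fun s => ?_
  set t : Finset (ProductFunctional p × x.Family) := s.image fun i => (i.1, x.famAct w i.2) with ht
  have hfin := (p.toVectors.eventually_finset s).and ((x.eventually_finset t).and hw)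
  rw [eventually_cofinite] at hfin
  set S := hfin.toFinset with hS
  have hSS : hwf.toFinset ⊆ S := by
    intro v hv
    simp only [hS, Set.Finite.mem_toFinset, Set.mem_ofPred_eq] at hv ⊢
    tauto
  have hprod : ∏ v ∈ hwf.toFinset, c v = ∏ v ∈ S, c v :=
    Finset.prod_subset hSS fun v _ hv => by simp only [hc, if_neg hv]
  rw [hprod]
  have hS' : ∀ v ∉ S, _ := fun v hv => by
    have := hv
    rw [hS, Set.Finite.mem_toFinset, Set.mem_ofPred_eq, not_not] at this
    exact this
  refine ⟨∑ χ ∈ s.image Prod.fst, Matrix.of fun i j : ProductFunctional p × p.toVectors.Family =>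
    (Matrix.of fun i j : ProductFunctional p × p.toVectors.Family =>
      star (if i.1 = χ then 1 else 0 : ℂ) * (if j.1 = χ then 1 else 0) : Matrix _ _ ℂ) i j *
    (Matrix.of fun i j : ProductFunctional p × p.toVectors.Family =>
      (∏ v ∈ S, c v) • (∏ v ∈ S, (Matrix.of fun i j : ProductFunctional p × p.toVectors.Family =>
        χ.toFun v (star (i.2 v) * (j.2 v)) : Matrix _ _ ℂ) i j) -
      ∏ v ∈ S, (Matrix.of fun i j : ProductFunctional p × p.toVectors.Family =>
        χ.toFun v (inn (A := A v) (act (w v) (i.2 v)) (act (w v) (j.2 v))) : Matrix _ _ ℂ) i j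
        : Matrix _ _ ℂ) i j,
    Matrix.posSemidef_sum _ fun χ _ => posSemidef_mul (posSemidef_rankOne _)
      (posSemidef_prod_sub _ (fun v _ => posSemidef_functional (χ.nonneg v) _)
        fun v hv => posSemidef_functional_sub (χ.nonneg v) (w v) ?_ _), fun i hi j hj => ?_⟩
  · simp only [hc]
    split_ifs with h
    · exact le_rfl
    · simpa using h
  · have e1 := p.toVectors.kernel_eq_sum (s := s) (S := S) (F := s.image Prod.fst)
      (fun v hv => (hS' v hv).1) (fun i hi => Finset.mem_image_of_mem _ hi) hi hj
    have e2 := x.kernel_eq_sum (s := t) (S := S) (F := s.image Prod.fst)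
      (fun v hv => (hS' v hv).2.1) (fun i hi => by
        obtain ⟨i', hi', rfl⟩ := Finset.mem_image.1 hi
        exact Finset.mem_image_of_mem _ hi')
      (Finset.mem_image_of_mem (fun i => (i.1, x.famAct w i.2)) hi)
      (Finset.mem_image_of_mem (fun i => (i.1, x.famAct w i.2)) hj)
    rw [Matrix.of_apply, e1, e2, Finset.smul_sum, ← Finset.sum_sub_distrib, Matrix.sum_apply]
    refine Finset.sum_congr rfl fun χ _ => ?_
    simp only [Matrix.of_apply, mul_sub, mul_smul_comm]
    rfl

/-- The Hilbert space direct sum, over all product functionals `φ`, of the restricted tensor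
products of the spaces obtained from `X v` by completion for the inner product `φ v ⟨w, z⟩`. -/
abbrev GNSSpace : Type _ := KernelSpace x.kernel x.kernel_posSemidef

/-- The generating vector of `GNSSpace` given by the simple tensor `⊗ w v` in the summand of `φ`. -/
noncomputable abbrev gnsVec (φ : ProductFunctional p) (w : x.Family) : x.GNSSpace :=
  KernelSpace.δ x.kernel_posSemidef (φ, w)

open scoped InnerProductSpace

/-- The simple tensor `⊗ w v`, as the operator `⊗ a v ↦ ⊗ (w v · a v)`. -/
noncomputable def tensorOp (w : x.Family) : p.toVectors.GNSSpace →L[ℂ] x.GNSSpace :=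
  KernelSpace.lift _ _ (fun i => (i.1, x.famAct w i.2)) (x.kernel_sub_posSemidef w)

theorem tensorOp_gnsVec (w : x.Family) (φ : ProductFunctional p) (a : p.toVectors.Family) :
    x.tensorOp w (p.toVectors.gnsVec φ a) = x.gnsVec φ (x.famAct w a) :=
  KernelSpace.lift_δ _ _ _

/-- `⟨⊗ w v, ⊗ z v⟩ = ⊗ ⟨w v, z v⟩`. -/
theorem adjoint_tensorOp_comp (w z : x.Family) :
    (x.tensorOp w).adjoint ∘L x.tensorOp z = p.toVectors.tensorOp (x.famInn w z) := by
  refine KernelSpace.ext_δ fun ⟨ψ, b⟩ => KernelSpace.ext_inner_δ fun ⟨φ, a⟩ => ?_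
  rw [ContinuousLinearMap.comp_apply, ContinuousLinearMap.adjoint_inner_right,
    tensorOp_gnsVec, tensorOp_gnsVec, tensorOp_gnsVec, KernelSpace.inner_δ, KernelSpace.inner_δ,
    kernel, kernel, Matrix.of_apply, Matrix.of_apply]
  classical
  refine if_congr Iff.rfl (finprod_congr fun v => ?_) rfl
  change φ.toFun v (inn (act (w v) (a v)) (act (z v) (b v))) =
    φ.toFun v (star (a v) * (inn (w v) (z v) * b v))
  rw [inn_act, act_inn, mul_assoc]

/-- `(⊗ w v) · (⊗ a v) = ⊗ (w v · a v)`. -/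
theorem tensorOp_comp (w : x.Family) (a : p.toVectors.Family) :
    x.tensorOp w ∘L p.toVectors.tensorOp a = x.tensorOp (x.famAct w a) := by
  refine KernelSpace.ext_δ fun ⟨ψ, b⟩ => ?_
  rw [ContinuousLinearMap.comp_apply, tensorOp_gnsVec, tensorOp_gnsVec, tensorOp_gnsVec]
  refine congrArg (x.gnsVec ψ) (RestrictedFamily.ext (funext fun v => ?_))
  exact act_mul (A := A v) (w v) (a v) (b v)

end CompatibleVectors

namespace ProjectionFamily

variable (p : ProjectionFamily A)

open scoped InnerProductSpace

/-- `(⊗ a v)⋆ = ⊗ (a v)⋆`. -/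
def famStar (a : p.toVectors.Family) : p.toVectors.Family :=
  ⟨fun v => star (a v), by
    filter_upwards [a.2, p.isStarProjection] with v h hp
    rw [h]
    exact hp.isSelfAdjoint.star_eq⟩

theorem star_tensorOp (a : p.toVectors.Family) :
    star (p.toVectors.tensorOp a) = p.toVectors.tensorOp (p.famStar a) := by
  refine KernelSpace.ext_δ fun ⟨ψ, b⟩ => KernelSpace.ext_inner_δ fun ⟨φ, c⟩ => ?_
  rw [ContinuousLinearMap.star_eq_adjoint, ContinuousLinearMap.adjoint_inner_right,
    CompatibleVectors.tensorOp_gnsVec, CompatibleVectors.tensorOp_gnsVec, KernelSpace.inner_δ,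
    KernelSpace.inner_δ, CompatibleVectors.kernel, Matrix.of_apply, Matrix.of_apply]
  classical
  refine if_congr Iff.rfl (finprod_congr fun v => ?_) rfl
  change φ.toFun v (star (a v * c v) * b v) = φ.toFun v (star (c v) * (star (a v) * b v))
  rw [star_mul, mul_assoc]

/-- The `⋆`-algebra spanned by the simple tensors. -/
noncomputable def algebraicSubalgebra :
    NonUnitalStarSubalgebra ℂ (p.toVectors.GNSSpace →L[ℂ] p.toVectors.GNSSpace) where
  carrier := Submodule.span ℂ (Set.range p.toVectors.tensorOp)
  zero_mem' := Submodule.zero_mem _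
  add_mem' := Submodule.add_mem _
  smul_mem' c _ := Submodule.smul_mem _ c
  mul_mem' {S T} hS hT := by
    induction hS using Submodule.span_induction with
    | mem S hS =>
      obtain ⟨a, rfl⟩ := hS
      induction hT using Submodule.span_induction with
      | mem T hT =>
        obtain ⟨b, rfl⟩ := hT
        exact Submodule.subset_span ⟨_, (p.toVectors.tensorOp_comp a b).symm⟩
      | zero => rw [mul_zero]; exact Submodule.zero_mem _
      | add S T _ _ hS hT => rw [mul_add]; exact Submodule.add_mem _ hS hT
      | smul c T _ hT => rw [mul_smul_comm]; exact Submodule.smul_mem _ c hT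
    | zero => rw [zero_mul]; exact Submodule.zero_mem _
    | add S T _ _ hS hT => rw [add_mul]; exact Submodule.add_mem _ hS hT
    | smul c T _ hT => rw [smul_mul_assoc]; exact Submodule.smul_mem _ c hT
  star_mem' {S} hS := by
    induction hS using Submodule.span_induction with
    | mem S hS =>
      obtain ⟨a, rfl⟩ := hS
      exact Submodule.subset_span ⟨_, (p.star_tensorOp a).symm⟩
    | zero => rw [star_zero]; exact Submodule.zero_mem _
    | add S T _ _ hS hT => rw [star_add]; exact Submodule.add_mem _ hS hT
    | smul c T _ hT => rw [star_smul]; exact Submodule.smul_mem _ _ hT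

/-- The restricted tensor product of the `C⋆`-algebras `A v` with respect to the projections `p v`,
as an algebra of operators: the norm closure of the span of the simple tensors. The norm of the
span is the spatial one: it is the supremum, over all product functionals `⊗ φ v`, of the operator
norms in the representation obtained from `⊗ φ v` by the Gelfand-Naimark-Segal construction. -/
noncomputable def restrictedSubalgebra :
    NonUnitalStarSubalgebra ℂ (p.toVectors.GNSSpace →L[ℂ] p.toVectors.GNSSpace) :=
  p.algebraicSubalgebra.topologicalClosure

instance : IsClosed (p.restrictedSubalgebra : Set (p.toVectors.GNSSpace →L[ℂ] p.toVectors.GNSSpace)) :=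
  p.algebraicSubalgebra.isClosed_topologicalClosure

/-- The restricted tensor product `⊗' (A v, p v)`. -/
def RestrictedTensor : Type _ := p.restrictedSubalgebra

noncomputable instance : NonUnitalCStarAlgebra p.RestrictedTensor :=
  inferInstanceAs (NonUnitalCStarAlgebra p.restrictedSubalgebra)

/-- The index set of the simple tensors `⊗ a v` with `a v = p v` at all but finitely many places. -/
abbrev Family : Type _ := RestrictedFamily p.proj

/-- The simple tensor `⊗ a v`. -/
noncomputable def tmul (a : p.Family) : p.RestrictedTensor :=
  ⟨p.toVectors.tensorOp a, p.algebraicSubalgebra.le_topologicalClosure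
    (Submodule.subset_span ⟨a, rfl⟩)⟩

end ProjectionFamily

namespace CompatibleVectors

variable {p : ProjectionFamily A} {X : I → Type*}
    [∀ v, NormedAddCommGroup (X v)] [∀ v, NormedSpace ℂ (X v)] [∀ v, CompleteSpace (X v)]
    [∀ v, HilbertModule (A v) (X v)] (x : CompatibleVectors p X)

/-- The restricted tensor product of the Hilbert modules `X v`, as a space of operators: the norm
closure of the span of the simple tensors. -/
noncomputable def restrictedSubmodule : Submodule ℂ (p.toVectors.GNSSpace →L[ℂ] x.GNSSpace) :=
  (Submodule.span ℂ (Set.range x.tensorOp)).topologicalClosure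

/-- The restricted tensor product `⊗' (X v, x v)`. -/
def RestrictedTensor : Type _ := x.restrictedSubmodule

noncomputable instance : NormedAddCommGroup x.RestrictedTensor :=
  inferInstanceAs (NormedAddCommGroup x.restrictedSubmodule)

noncomputable instance : NormedSpace ℂ x.RestrictedTensor :=
  inferInstanceAs (NormedSpace ℂ x.restrictedSubmodule)

instance : CompleteSpace x.RestrictedTensor :=
  (Submodule.isClosed_topologicalClosure _).completeSpace_coe

/-- The simple tensor `⊗ w v`. -/
noncomputable def tmul (w : x.Family) : x.RestrictedTensor :=
  ⟨x.tensorOp w, Submodule.le_topologicalClosure _ (Submodule.subset_span ⟨w, rfl⟩)⟩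

theorem comp_mem {S : p.toVectors.GNSSpace →L[ℂ] x.GNSSpace}
    {T : p.toVectors.GNSSpace →L[ℂ] p.toVectors.GNSSpace}
    (hS : S ∈ x.restrictedSubmodule) (hT : T ∈ p.restrictedSubalgebra) :
    S ∘L T ∈ x.restrictedSubmodule := by
  refine map_mem_closure₂ (f := fun (S : p.toVectors.GNSSpace →L[ℂ] x.GNSSpace)
    (T : p.toVectors.GNSSpace →L[ℂ] p.toVectors.GNSSpace) => S ∘L T) (by fun_prop) hS hT ?_
  intro S hS T hT
  change S ∈ Submodule.span ℂ _ at hS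
  change T ∈ Submodule.span ℂ _ at hT
  change S ∘L T ∈ Submodule.span ℂ _
  induction hS using Submodule.span_induction with
  | mem S hS =>
    obtain ⟨a, rfl⟩ := hS
    induction hT using Submodule.span_induction with
    | mem T hT =>
      obtain ⟨b, rfl⟩ := hT
      exact Submodule.subset_span ⟨_, (x.tensorOp_comp a b).symm⟩
    | zero => rw [ContinuousLinearMap.comp_zero]; exact Submodule.zero_mem _
    | add S T _ _ hS hT => rw [ContinuousLinearMap.comp_add]; exact Submodule.add_mem _ hS hT
    | smul c T _ hT => rw [ContinuousLinearMap.comp_smul]; exact Submodule.smul_mem _ c hT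
  | zero => rw [ContinuousLinearMap.zero_comp]; exact Submodule.zero_mem _
  | add S T _ _ hS hT => rw [ContinuousLinearMap.add_comp]; exact Submodule.add_mem _ hS hT
  | smul c T _ hT => rw [ContinuousLinearMap.smul_comp]; exact Submodule.smul_mem _ c hT

theorem adjoint_comp_mem {S T : p.toVectors.GNSSpace →L[ℂ] x.GNSSpace}
    (hS : S ∈ x.restrictedSubmodule) (hT : T ∈ x.restrictedSubmodule) :
    S.adjoint ∘L T ∈ p.restrictedSubalgebra := by
  refine map_mem_closure₂ (f := fun (S : p.toVectors.GNSSpace →L[ℂ] x.GNSSpace)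
    (T : p.toVectors.GNSSpace →L[ℂ] x.GNSSpace) => S.adjoint ∘L T)
    (by
      have : Continuous fun S : p.toVectors.GNSSpace →L[ℂ] x.GNSSpace => S.adjoint :=
        ContinuousLinearMap.adjoint.continuous
      fun_prop) hS hT ?_
  intro S hS T hT
  change S ∈ Submodule.span ℂ _ at hS
  change T ∈ Submodule.span ℂ _ at hT
  change S.adjoint ∘L T ∈ Submodule.span ℂ _
  induction hS using Submodule.span_induction with
  | mem S hS =>
    obtain ⟨a, rfl⟩ := hS
    induction hT using Submodule.span_induction with
    | mem T hT =>
      obtain ⟨b, rfl⟩ := hT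
      exact Submodule.subset_span ⟨_, (x.adjoint_tensorOp_comp a b).symm⟩
    | zero => rw [ContinuousLinearMap.comp_zero]; exact Submodule.zero_mem _
    | add S T _ _ hS hT => rw [ContinuousLinearMap.comp_add]; exact Submodule.add_mem _ hS hT
    | smul c T _ hT => rw [ContinuousLinearMap.comp_smul]; exact Submodule.smul_mem _ c hT
  | zero => rw [map_zero, ContinuousLinearMap.zero_comp]; exact Submodule.zero_mem _
  | add S T _ _ hS hT =>
    rw [map_add, ContinuousLinearMap.add_comp]; exact Submodule.add_mem _ hS hT
  | smul c T _ hT =>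
    rw [map_smulₛₗ, ContinuousLinearMap.smul_comp]; exact Submodule.smul_mem _ _ hT

/-- `⊗' (X v, x v)` is a Hilbert module over `⊗' (A v, p v)`; on simple tensors, the inner product
and the action are computed place by place. -/
noncomputable instance : HilbertModule p.RestrictedTensor x.RestrictedTensor :=
  haveI : CompleteSpace x.restrictedSubmodule :=
    (Submodule.isClosed_topologicalClosure _).completeSpace_coe
  HilbertModule.ofOperators p.restrictedSubalgebra x.restrictedSubmodule
    (fun _ hS _ hT => x.comp_mem hS hT) (fun _ hS _ hT => x.adjoint_comp_mem hS hT)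

theorem inn_tmul (w z : x.Family) : inn (x.tmul w) (x.tmul z) = p.tmul (x.famInn w z) :=
  Subtype.ext (x.adjoint_tensorOp_comp w z)

theorem act_tmul (w : x.Family) (a : p.Family) :
    act (x.tmul w) (p.tmul a) = x.tmul (x.famAct w a) :=
  Subtype.ext (x.tensorOp_comp w a)

/-- The rank one operators `p_{x v} = T_{x v, x v}` on the modules `X v`; they are projections at
all but finitely many places. -/
noncomputable def rankOneProjections : ProjectionFamily fun v => Adjointable (A v) (X v) where
  proj v := Adjointable.rankOne (x.vec v) (x.vec v)
  isStarProjection := by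
    filter_upwards [x.inn_vec, x.act_vec] with v h h'
    refine ⟨?_, ?_⟩
    · refine Subtype.ext (ContinuousLinearMap.ext fun y => ?_)
      change act (x.vec v) (inn (A := A v) (x.vec v) (act (x.vec v) (inn (x.vec v) y))) =
        act (x.vec v) (inn (A := A v) (x.vec v) y)
      rw [inn_act, h, act_mul, h']
    · refine Adjointable.star_eq fun y z => ?_
      change inn (A := A v) (act (x.vec v) (inn (x.vec v) y)) z =
        inn y (act (x.vec v) (inn (x.vec v) z))
      rw [act_inn, inn_act, star_inn]
  ne_zero := by
    filter_upwards [x.inn_vec, x.act_vec, p.ne_zero] with v h h' h0 h1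
    have h2 : act (x.vec v) (inn (A := A v) (x.vec v) (x.vec v)) = 0 :=
      congrArg (fun T : Adjointable (A v) (X v) => T (x.vec v)) h1
    rw [h, h'] at h2
    rw [h2, inn_zero] at h
    exact h0 h.symm

end CompatibleVectors

section Correspondence

variable {A' : I → Type*} [∀ v, NonUnitalCStarAlgebra (A' v)]

/-- A collection of correspondences: left actions `α v : A' v → End⋆(X v)`, with
`α v (p' v) (x v) = x v` at all but finitely many places. -/
structure CorrespondenceFamily (p' : ProjectionFamily A') {p : ProjectionFamily A} {X : I → Type*}
    [∀ v, NormedAddCommGroup (X v)] [∀ v, NormedSpace ℂ (X v)] [∀ v, CompleteSpace (X v)]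
    [∀ v, HilbertModule (A v) (X v)] (x : CompatibleVectors p X) where
  hom : ∀ v, A' v →⋆ₙₐ[ℂ] Adjointable (A v) (X v)
  hom_proj_vec : ∀ᶠ v in cofinite, hom v (p'.proj v) (x.vec v) = x.vec v

variable {p' : ProjectionFamily A'} {p : ProjectionFamily A} {X : I → Type*}
    [∀ v, NormedAddCommGroup (X v)] [∀ v, NormedSpace ℂ (X v)] [∀ v, CompleteSpace (X v)]
    [∀ v, HilbertModule (A v) (X v)] {x : CompatibleVectors p X}

namespace CorrespondenceFamily

/-- `(⊗ a v) (⊗ w v) = ⊗ (α v (a v) (w v))`. -/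
noncomputable def famApply (α : CorrespondenceFamily p' x) (a : p'.Family) (w : x.Family) : x.Family :=
  ⟨fun v => α.hom v (a v) (w v), by
    filter_upwards [a.2, w.2, α.hom_proj_vec] with v h1 h2 h3
    rw [h1, h2, h3]⟩

/-- `Φ` is the left action of `⊗' (A' v, p' v)` on `⊗' (X v, x v)` that acts place by place on
simple tensors. -/
def IsGlobalAction (α : CorrespondenceFamily p' x)
    (Φ : p'.RestrictedTensor →⋆ₙₐ[ℂ] Adjointable p.RestrictedTensor x.RestrictedTensor) : Prop :=
  ∀ (a : p'.Family) (w : x.Family), Φ (p'.tmul a) (x.tmul w) = x.tmul (α.famApply a w)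

/-- Coherence: `α v (p' v) = p_{x v}` at all but finitely many places. -/
def IsCoherent (α : CorrespondenceFamily p' x) : Prop :=
  ∀ᶠ v in cofinite, α.hom v (p'.proj v) = Adjointable.rankOne (x.vec v) (x.vec v)

/-- A coherent collection is compact if every `α v` takes values in the compact operators. -/
def IsCompact (α : CorrespondenceFamily p' x) : Prop :=
  α.IsCoherent ∧ ∀ v, Set.range (α.hom v) ⊆ Adjointable.compacts (A v) (X v)

/-- A coherent collection is type I if the range of every `α v` contains the compact operators. -/
def IsTypeI (α : CorrespondenceFamily p' x) : Prop :=
  α.IsCoherent ∧ ∀ v, (Adjointable.compacts (A v) (X v) : Set _) ⊆ Set.range (α.hom v)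

end CorrespondenceFamily

/-- The tautological actions of the algebras `End⋆(X v)` on the modules `X v`. -/
noncomputable def CompatibleVectors.tautological (x : CompatibleVectors p X) :
    CorrespondenceFamily x.rankOneProjections x where
  hom v := NonUnitalStarAlgHom.id ℂ _
  hom_proj_vec := by
    filter_upwards [x.inn_vec, x.act_vec] with v h h'
    change act (x.vec v) (inn (A := A v) (x.vec v) (x.vec v)) = x.vec v
    rw [h, h']

end Correspondence

end Restricted

/-! ### Positivity in C⋆-algebras, its tests, and closed ranges of ⋆-homomorphisms. -/

section CStar

open scoped ComplexStarModule

/-! The action exists once the spatial norm of a combination of simple tensors of `A'` dominates its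
operator norm on the Hilbert space `GNSSpace` of `X`. All inner products involved are products over
the places, so a squared norm estimate becomes `0 ≤ ∑ m, d m * ∏ v, G v m`, with factors such as
`φ_v ⟨w, α_v(u_m) w'⟩`. With the other places frozen this is linear in the factors at one place, so
it can be transferred from one type of functional to another place by place (`sum_finprod_nonneg`).
The local input is complete positivity: if a linear condition holds for all `ψ(e_l⋆ u_m e_r)` with
`ψ` positive on `A'_v`, then a matrix over `A'_v` is positive, hence of the form `t⋆ t`, and the
condition passes to `φ ⟨w_l, α_v(u_m) w_r⟩` (`functional_inn_nonneg`).

As `A'_v` need not have a unit, this bounds `c` only on vectors of the form `b ξ`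
(`norm_formalAction_formalAction_le`). Letting `c⋆` act on `c ξ` and using the Cauchy-Schwarz
inequality gives the bound on all vectors (`norm_formalAction_le`).

The natural inclusion is isometric because the reverse estimate holds too. It is the same transfer,
now from the functionals `T ↦ φ ⟨w a, T (w a)⟩` on `End⋆(X_v)`, which detect positivity, to
arbitrary positive functionals (`norm_tautological_globalAction`).

Coherence says that `⊗ α_v(a_v)` is again a simple tensor of the restricted product of the algebras
`End⋆(X_v)`, so the action factors through the inclusion on simple tensors. Ranges of
⋆-homomorphisms are closed (`isClosed_range_starHom`), which gives the first assertion. The other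
two rest on `T_{⊗ξ,⊗η} = ⊗ T_{ξ_v,η_v}` (`globalAction_tmul_rankOne`): for the second, compact
factors are approximated one place at a time; for the third, the factors `T_{ξ_v,η_v}` are lifted to
`A'_v`. -/

theorem eq_zero_of_star_mul_self_eq_neg {A : Type*} [NonUnitalCStarAlgebra A] {a b : A}
    (h : star a * a = -(star b * b)) : b = 0 := by
  let _ : PartialOrder A := CStarAlgebra.spectralOrder A
  have _ : StarOrderedRing A := CStarAlgebra.spectralOrderedRing A
  have h1 : star b * b = 0 := by
    refine le_antisymm ?_ (star_mul_self_nonneg b)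
    rw [← neg_nonneg, ← h]
    exact star_mul_self_nonneg a
  exact CStarRing.star_mul_self_eq_zero_iff b |>.1 h1

theorem exists_star_mul_self_add {A : Type*} [NonUnitalCStarAlgebra A] {a b : A}
    (ha : ∃ r, a = star r * r) (hb : ∃ r, b = star r * r) : ∃ r, a + b = star r * r := by
  let _ : PartialOrder A := CStarAlgebra.spectralOrder A
  have _ : StarOrderedRing A := CStarAlgebra.spectralOrderedRing A
  rw [← CStarAlgebra.nonneg_iff_eq_star_mul_self] at *
  exact add_nonneg ha hb

theorem eq_zero_of_exists_star_mul_self {A : Type*} [NonUnitalCStarAlgebra A] {a : A}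
    (ha : ∃ r, a = star r * r) (hb : ∃ r, -a = star r * r) : a = 0 := by
  obtain ⟨r, hr⟩ := ha
  obtain ⟨s, hs⟩ := hb
  have := eq_zero_of_star_mul_self_eq_neg (a := r) (b := s) (by rw [← hr, ← hs, neg_neg])
  rw [this] at hs
  simpa using hs

/-- A family `s` of positive maps that is stable under the congruences `h ↦ c⋆ h c` and faithful on
positive elements detects positivity. -/
theorem exists_star_mul_self_of_test {C B ι : Type*} [NonUnitalCStarAlgebra C]
    [NonUnitalCStarAlgebra B] (s : ι → C →ₗ[ℂ] B) (hstar : ∀ e h, s e (star h) = star (s e h))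
    (hcongr : ∀ c e, ∃ e', ∀ h, s e (star c * h * c) = s e' h)
    (hpos : ∀ e r, ∃ b, s e (star r * r) = star b * b)
    (hfaith : ∀ r, (∀ e, s e (star r * r) = 0) → r = 0)
    {h : C} (hh : ∀ e, ∃ b, s e h = star b * b) : ∃ r, h = star r * r := by
  let _ : PartialOrder C := CStarAlgebra.spectralOrder C
  have _ : StarOrderedRing C := CStarAlgebra.spectralOrderedRing C
  -- For `c = k⁻` one has `c⋆ k c = -c³`. Every test map takes a positive value on both `c³` and `c⋆
  -- k c`, so it vanishes on `c³`, and faithfulness gives `c = 0`.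
  have key : ∀ k : C, IsSelfAdjoint k → (∀ e, ∃ b, s e k = star b * b) → 0 ≤ k := by
    intro k hk hs
    set c := k⁻ with hc
    have hc0 : 0 ≤ c := CFC.negPart_nonneg k
    have hcs : star c = c := hc0.isSelfAdjoint.star_eq
    have hkc : k * c = -(c * c) := by
      conv_lhs => rw [← CFC.posPart_sub_negPart k hk]
      rw [sub_mul, CFC.posPart_mul_negPart, zero_sub]
    obtain ⟨d, hd⟩ := CStarAlgebra.nonneg_iff_eq_star_mul_self.1
      (star_left_conjugate_nonneg hc0 c)
    have h1 : star c * k * c = -(star d * d) := by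
      rw [← hd, mul_assoc, hkc, mul_neg, mul_assoc]
    have hd0 : d = 0 := by
      refine hfaith d fun e => ?_
      refine eq_zero_of_exists_star_mul_self (hpos e d) ?_
      obtain ⟨e', he'⟩ := hcongr c e
      rw [← map_neg, ← h1, he']
      exact hs e'
    rw [hd0, mul_zero, hcs] at hd
    have hcc : c * c = 0 := by
      have : star (c * c) * (c * c) = 0 := by
        rw [star_mul, hcs, ← mul_assoc, hd, zero_mul]
      exact (CStarRing.star_mul_self_eq_zero_iff _).1 this
    have hc0 : c = 0 := (CStarRing.star_mul_self_eq_zero_iff c).1 (by rw [hcs, hcc])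
    rw [← CFC.posPart_sub_negPart k hk, ← hc, hc0, sub_zero]
    exact CFC.posPart_nonneg k
  -- The values `s e h` are self-adjoint, so the tests vanish on the imaginary part of `h`; then
  -- `key` applies to both signs of it.
  have him : ∀ e, s e (ℑ h : C) = 0 := by
    intro e
    obtain ⟨b, hb⟩ := hh e
    rw [imaginaryPart_apply_coe, ← Complex.coe_smul, map_smul, map_smul, map_sub, hstar, hb]
    simp
  have h1 : 0 ≤ (ℑ h : C) := key _ (ℑ h).2 fun e => ⟨0, by simp [him]⟩
  have h2 : 0 ≤ -(ℑ h : C) := key _ (ℑ h).2.neg fun e => ⟨0, by simp [him]⟩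
  have h3 : (ℑ h : C) = 0 := le_antisymm (neg_nonneg.1 h2) h1
  have h4 : h = (ℜ h : C) := by
    conv_lhs => rw [← realPart_add_I_smul_imaginaryPart h, h3, smul_zero, add_zero]
  rw [← CStarAlgebra.nonneg_iff_eq_star_mul_self]
  refine key h ?_ hh
  rw [h4]
  exact (ℜ h).2

/-- Positivity in `A` can be tested by conjugation with the elements of `A`. -/
theorem exists_star_mul_self_of_conj {A : Type*} [NonUnitalCStarAlgebra A] {h : A}
    (hh : ∀ a, ∃ b, star a * h * a = star b * b) : ∃ r, h = star r * r := by
  refine exists_star_mul_self_of_test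
    (fun a : A => (LinearMap.mulRight ℂ a).comp (LinearMap.mulLeft ℂ (star a))) ?_ ?_ ?_ ?_ hh
  · intro a h
    simp [mul_assoc]
  · intro c a
    exact ⟨c * a, fun h => by simp [mul_assoc]⟩
  · intro a r
    exact ⟨r * a, by simp [mul_assoc]⟩
  · intro r hr
    -- There may be no unit to conjugate with; `a = r⋆ r` serves instead, as `r r⋆ r = 0` still
    -- forces `r = 0`.
    have h1 := hr (star r * r)
    simp only [LinearMap.comp_apply, LinearMap.mulLeft_apply, LinearMap.mulRight_apply] at h1
    have h2 : r * (star r * r) = 0 := by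
      rw [← CStarRing.star_mul_self_eq_zero_iff]
      simpa [mul_assoc] using h1
    have h3 : star r * r = 0 := by
      rw [← CStarRing.star_mul_self_eq_zero_iff]
      simp [mul_assoc, h2]
    exact (CStarRing.star_mul_self_eq_zero_iff r).1 h3

/-- Positive functionals separate the elements that are not positive from the positive ones. -/
theorem exists_star_mul_self_of_functional {A : Type*} [NonUnitalCStarAlgebra A] {h : A}
    (hh : ∀ φ : A →ₗ[ℂ] ℂ, (∀ a, 0 ≤ φ (star a * a)) → 0 ≤ φ h) : ∃ r, h = star r * r := by
  let _ : PartialOrder A := CStarAlgebra.spectralOrder A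
  have _ : StarOrderedRing A := CStarAlgebra.spectralOrderedRing A
  let K : ProperCone ℝ (selfAdjoint A) :=
    { carrier := {x | 0 ≤ (x : A)}
      add_mem' := fun {x y} hx hy => add_nonneg (a := (x : A)) (b := (y : A)) hx hy
      zero_mem' := le_refl (0 : A)
      smul_mem' := fun r x hx => smul_nonneg (β := A) r.2 hx
      isClosed' := (CStarAlgebra.isClosed_nonneg (A := A)).preimage continuous_subtype_val }
  have key : ∀ k : selfAdjoint A,
      (∀ φ : A →ₗ[ℂ] ℂ, (∀ a, 0 ≤ φ (star a * a)) → 0 ≤ φ k) → 0 ≤ (k : A) := by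
    intro k hk
    by_contra hneg
    -- Hahn-Banach in the real space of self-adjoint elements: `f` is nonnegative on the closed
    -- positive cone and negative at `k`. Its complex-linear extension `φ` is a positive functional.
    obtain ⟨f, hf, hfk⟩ := K.hyperplane_separation_point (x₀ := k) hneg
    let φ : A →ₗ[ℂ] ℂ :=
      { toFun := fun x => (f (ℜ x) : ℂ) + Complex.I * f (ℑ x)
        map_add' := fun x y => by simp; ring
        map_smul' := fun c x => by
          rw [realPart_smul, imaginaryPart_smul]
          apply Complex.ext <;> simp }
    have hφ : ∀ x : selfAdjoint A, φ x = f x := by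
      intro x
      change (f (ℜ (x : A)) : ℂ) + Complex.I * f (ℑ (x : A)) = f x
      rw [x.2.imaginaryPart, show ℜ (x : A) = x from Subtype.ext x.2.coe_realPart]
      simp
    have h1 := hk φ fun a => by
      have := hφ ⟨star a * a, .star_mul_self a⟩
      rw [show φ (star a * a) = _ from this]
      exact Complex.zero_le_real.2 (hf _ (star_mul_self_nonneg a))
    rw [hφ] at h1
    exact absurd hfk (not_lt.2 (Complex.zero_le_real.1 h1))
  have him : ∀ φ : A →ₗ[ℂ] ℂ, (∀ a, 0 ≤ φ (star a * a)) → φ (ℑ h : A) = 0 := by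
    intro φ hφ
    have h1 := (IsSelfAdjoint.of_nonneg (hh φ hφ)).star_eq
    rw [imaginaryPart_apply_coe, ← Complex.coe_smul, map_smul, map_smul, map_sub,
      functional_star hφ, h1]
    simp
  have h1 : 0 ≤ (ℑ h : A) := key _ fun φ hφ => (him φ hφ).ge
  have h2 : 0 ≤ ((-ℑ h : selfAdjoint A) : A) := key _ fun φ hφ => by
    simp [him φ hφ]
  have h3 : (ℑ h : A) = 0 := le_antisymm (neg_nonneg.1 h2) h1
  have h4 : h = (ℜ h : A) := by
    conv_lhs => rw [← realPart_add_I_smul_imaginaryPart h, h3, smul_zero, add_zero]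
  rw [← CStarAlgebra.nonneg_iff_eq_star_mul_self, h4]
  exact key _ fun φ hφ => by rw [← h4]; exact hh φ hφ

/-- If every positive functional vanished at `q`, then `-q` would be positive by the functional
test, which forces `q = 0`. A functional with `φ q > 0` can be rescaled. -/
theorem exists_functional_eq_one {A : Type*} [NonUnitalCStarAlgebra A] {q : A}
    (hq : IsStarProjection q) (h0 : q ≠ 0) :
    ∃ φ : A →ₗ[ℂ] ℂ, (∀ a, 0 ≤ φ (star a * a)) ∧ φ q = 1 := by
  have hqq : star q * q = q := by rw [hq.isSelfAdjoint.star_eq, hq.isIdempotentElem.eq]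
  by_contra! hcon
  refine h0 (eq_zero_of_exists_star_mul_self ⟨q, hqq.symm⟩
    (exists_star_mul_self_of_functional fun φ hφ => ?_))
  have h1 : 0 ≤ φ q := by rw [← hqq]; exact hφ q
  rcases h1.eq_or_lt with h2 | h2
  · rw [map_neg, ← h2, neg_zero]
  · refine absurd ?_ (hcon ((φ q)⁻¹ • φ) fun a => ?_)
    · simp [h2.ne']
    · exact mul_nonneg (inv_nonneg.2 h1) (hφ a)

/-- The range of a `⋆`-homomorphism of `C⋆`-algebras is closed. -/
theorem isClosed_range_starHom {A B : Type*} [NonUnitalCStarAlgebra A] [NonUnitalCStarAlgebra B]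
    (f : A →⋆ₙₐ[ℂ] B) : IsClosed (Set.range f) := by
  have hcont : Continuous f := AddMonoidHomClass.continuous_of_bound f 1 fun a => by
    rw [one_mul]; exact NonUnitalStarAlgHom.norm_apply_le f a
  have lift : ∀ a : A, IsSelfAdjoint a → ∃ a' : A, f a' = f a ∧ ‖a'‖ ≤ ‖f a‖ := by
    intro a ha
    set r := ‖f a‖
    -- Truncation at `r = ‖f a‖` does not change `f a`, whose spectrum lies in `[-r, r]`, but it
    -- cuts the norm of the preimage down to `r`.
    set g : ℝ → ℝ := fun t => max (-r) (min t r) with hg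
    have hg0 : g 0 = 0 := by simp [hg, r]
    have hgc : Continuous g := by fun_prop
    refine ⟨cfcₙ g a, ?_, ?_⟩
    · rw [NonUnitalStarAlgHom.map_cfcₙ (S := ℂ) f g a hgc.continuousOn hg0 hcont ha (ha.map f)]
      conv_rhs => rw [← cfcₙ_id' ℝ (f a) (ha.map f)]
      refine cfcₙ_congr fun t ht => ?_
      have h1 : ‖t‖ ≤ r := by
        have := NonUnitalIsometricContinuousFunctionalCalculus.norm_quasispectrum_le (𝕜 := ℝ)
          (f a) ht (ha.map f)
        exact this
      rw [Real.norm_eq_abs, abs_le] at h1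
      simp [hg, h1.1, h1.2]
    · refine norm_cfcₙ_le fun t _ => ?_
      rw [Real.norm_eq_abs, abs_le]
      have hr : 0 ≤ r := norm_nonneg _
      exact ⟨le_max_left _ _, max_le (by linarith) (min_le_right _ _)⟩
  -- The constant 2 comes from lifting real and imaginary parts separately.
  have lift' : ∀ b ∈ Set.range f, ∃ a : A, f a = b ∧ ‖a‖ ≤ 2 * ‖b‖ := by
    rintro _ ⟨a, rfl⟩
    obtain ⟨x, hx, hxn⟩ := lift (ℜ a : A) (ℜ a).2
    obtain ⟨y, hy, hyn⟩ := lift (ℑ a : A) (ℑ a).2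
    have e1 : f (ℜ a : A) = (ℜ (f a) : B) := by
      rw [realPart_apply_coe, realPart_apply_coe, ← map_star, ← map_add]
      exact map_smul ((f : A →ₗ[ℂ] B).restrictScalars ℝ) _ _
    have e2 : f (ℑ a : A) = (ℑ (f a) : B) := by
      rw [imaginaryPart_apply_coe, imaginaryPart_apply_coe, ← map_star, ← map_sub, map_smul]
      congr 1
      exact map_smul ((f : A →ₗ[ℂ] B).restrictScalars ℝ) _ _
    refine ⟨x + Complex.I • y, ?_, ?_⟩
    · rw [map_add, map_smul, hx, hy, ← map_smul, ← map_add, realPart_add_I_smul_imaginaryPart]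
    · refine (norm_add_le _ _).trans ?_
      rw [norm_smul, Complex.norm_I, one_mul, two_mul]
      refine add_le_add (hxn.trans ?_) (hyn.trans ?_)
      · rw [e1]; exact realPart.norm_le (f a)
      · rw [e2]; exact imaginaryPart.norm_le (f a)
  let F : NormedAddGroupHom A B :=
    (f : A →+ B).mkNormedAddGroupHom 1 fun a => by
      rw [one_mul]; exact NonUnitalStarAlgHom.norm_apply_le f a
  have hs : F.SurjectiveOnWith F.range 2 := by
    intro b hb
    exact lift' b hb
  -- Preimages with controlled norm can be summed along a convergent series, so every point of the
  -- closure has a preimage.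
  have h2 := controlled_closure_of_complete two_pos one_pos hs
  refine isClosed_of_closure_subset fun b hb => ?_
  obtain ⟨a, ha, -⟩ := h2 b hb
  exact ⟨a, ha⟩

theorem exists_star_mul_self_sum {A ι : Type*} [NonUnitalCStarAlgebra A] (s : Finset ι)
    (a : ι → A) : ∃ r, ∑ i ∈ s, star (a i) * a i = star r * r := by
  classical
  induction s using Finset.induction_on with
  | empty => exact ⟨0, by simp⟩
  | insert i s hi ih =>
    rw [Finset.sum_insert hi]
    exact exists_star_mul_self_add ⟨_, rfl⟩ ih

theorem eq_zero_of_sum_star_mul_self {A ι : Type*} [NonUnitalCStarAlgebra A] {s : Finset ι}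
    {a : ι → A} (h : ∑ i ∈ s, star (a i) * a i = 0) {i : ι} (hi : i ∈ s) : a i = 0 := by
  let _ : PartialOrder A := CStarAlgebra.spectralOrder A
  have _ : StarOrderedRing A := CStarAlgebra.spectralOrderedRing A
  rw [Finset.sum_eq_zero_iff_of_nonneg fun i _ => star_mul_self_nonneg (a i)] at h
  exact (CStarRing.star_mul_self_eq_zero_iff _).1 (h i hi)

/-! ### Matrix coefficients of adjointable operators. -/

namespace Adjointable

variable {A X : Type*} [NonUnitalCStarAlgebra A] [NormedAddCommGroup X]
    [NormedSpace ℂ X] [CompleteSpace X] [HilbertModule A X]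

/-- The inclusion of the adjointable operators into the bounded operators. -/
def toCLM : Adjointable A X →ₗ[ℂ] X →L[ℂ] X where
  toFun T := T.1
  map_add' _ _ := rfl
  map_smul' _ _ := rfl

theorem toCLM_apply (T : Adjointable A X) (x : X) : toCLM T x = T x := rfl

/-- The matrix coefficient `T ↦ ⟨x, T y⟩`. -/
def matrixCoeff (x y : X) : Adjointable A X →ₗ[ℂ] A where
  toFun T := inn x (T y)
  map_add' _ _ := inn_add _ _ _
  map_smul' _ _ := inn_smul _ _ _

theorem matrixCoeff_apply (x y : X) (T : Adjointable A X) :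
    matrixCoeff x y T = inn (A := A) x (T y) := rfl

/-- Linearity over `A` is a consequence of having an adjoint: tested against `z`, both sides equal
`⟨T⋆ z, x⟩ a`. -/
theorem act_apply (T : Adjointable A X) (x : X) (a : A) : T (act x a) = act (T x) a :=
  ext_inn A fun z => by
    rw [inn_act]
    have h := fun y => inn_apply_left (star T) z y
    simp only [star_star] at h
    rw [← h, ← h, inn_act]

theorem matrixCoeff_star_mul (x y : X) (S T : Adjointable A X) :
    matrixCoeff x y (star S * T) = inn (A := A) (S x) (T y) :=
  (inn_apply_left S x (T y)).symm

end Adjointable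

/-! ### Positive matrices over a C⋆-algebra and complete positivity of representations. -/

section Matrix

open scoped Matrix

variable {B J : Type*} [NonUnitalCStarAlgebra B] [Fintype J]

/-- A matrix `h` over a `C⋆`-algebra such that `∑ (e j)⋆ h j k (e k)` is positive for all columns
`e` is of the form `r⋆ r`. -/
theorem exists_conjTranspose_mul_self {h : Matrix J J B}
    (hh : ∀ e : J → B, ∃ b, star e ⬝ᵥ h *ᵥ e = star b * b) :
    ∃ r : Matrix J J B, h = rᴴ * r := by
  classical
  let _ : PartialOrder B := CStarAlgebra.spectralOrder B
  have _ : StarOrderedRing B := CStarAlgebra.spectralOrderedRing B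
  let s : (J → B) → CStarMatrix J J B →ₗ[ℂ] B := fun e =>
    { toFun := fun h => star e ⬝ᵥ (show Matrix J J B from h) *ᵥ e
      map_add' := fun h k => by
        change star e ⬝ᵥ ((show Matrix J J B from h) + (show Matrix J J B from k)) *ᵥ e = _
        rw [Matrix.add_mulVec, dotProduct_add]
      map_smul' := fun c h => by
        change star e ⬝ᵥ (c • (show Matrix J J B from h)) *ᵥ e = _
        rw [Matrix.smul_mulVec, dotProduct_smul]
        rfl }
  have hcongr : ∀ (c h : Matrix J J B) (e : J → B),
      star e ⬝ᵥ (cᴴ * h * c) *ᵥ e = star (c *ᵥ e) ⬝ᵥ h *ᵥ (c *ᵥ e) := by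
    intro c h e
    rw [Matrix.star_mulVec, ← Matrix.dotProduct_mulVec, Matrix.mulVec_mulVec, Matrix.mulVec_mulVec,
      Matrix.mul_assoc]
  have hsq : ∀ (r : Matrix J J B) (e : J → B),
      star e ⬝ᵥ (rᴴ * r) *ᵥ e = ∑ l, star ((r *ᵥ e) l) * (r *ᵥ e) l := by
    intro r e
    rw [← Matrix.mulVec_mulVec, Matrix.dotProduct_mulVec, ← Matrix.star_mulVec]
    rfl
  refine exists_star_mul_self_of_test (C := CStarMatrix J J B) s (h := h) ?_ ?_ ?_ ?_ hh
  · intro e h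
    change star e ⬝ᵥ (show Matrix J J B from h)ᴴ *ᵥ e =
      star (star e ⬝ᵥ (show Matrix J J B from h) *ᵥ e)
    rw [← Matrix.star_dotProduct_star, Matrix.star_mulVec, star_star, Matrix.dotProduct_mulVec]
  · intro c e
    exact ⟨(show Matrix J J B from c) *ᵥ e, fun h => hcongr c h e⟩
  · intro e r
    obtain ⟨b, hb⟩ := exists_star_mul_self_sum Finset.univ ((show Matrix J J B from r) *ᵥ e)
    exact ⟨b, (hsq r e).trans hb⟩
  · intro r hr
    refine CStarMatrix.ext fun l k => ?_
    -- For this column `e`, the `l`-th entry of `r e` is `r l k * (r l k)⋆`; the factor `(r l k)⋆`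
    -- replaces a unit.
    have h1 := hr (Pi.single k (star (r l k)))
    have h2 := eq_zero_of_sum_star_mul_self ((hsq r _).symm.trans h1) (Finset.mem_univ l)
    have h3 : r l k * star (r l k) = 0 := by
      simpa [Matrix.mulVec, dotProduct, Pi.single_apply] using h2
    exact (CStarRing.mul_star_self_eq_zero_iff _).1 h3

variable {A X : Type*} [NonUnitalCStarAlgebra A] [NormedAddCommGroup X]
    [NormedSpace ℂ X] [CompleteSpace X] [HilbertModule A X]

/-- The terms `c m • u m` are collected into a matrix according to their index pairs `(l m, r m)`;
pairing this matrix entrywise with `g` recovers the sum over `m`. It is used with `g j k` equal to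
`e_j⋆ · e_k` and to `φ ⟨w_j, α(·) w_k⟩`. -/
theorem sum_sum_ite_smul [DecidableEq J] {V M : Type*} [AddCommGroup V] [Module ℂ V] [Fintype M]
    (l r : M → J) (u : M → B) (c : M → ℂ) (g : J → J → B →ₗ[ℂ] V) :
    ∑ j, ∑ k, g j k (∑ m, if l m = j ∧ r m = k then c m • u m else 0) =
      ∑ m, c m • g (l m) (r m) (u m) := by
  have h1 : ∀ j k m, g j k (if l m = j ∧ r m = k then c m • u m else 0) =
      if r m = k then (if l m = j then c m • g j k (u m) else 0) else 0 := by
    intro j k m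
    by_cases h : l m = j <;> by_cases h' : r m = k <;> simp [h, h']
  simp only [map_sum, h1]
  simp_rw [Finset.sum_comm (s := Finset.univ (α := J)) (t := Finset.univ (α := M))]
  simp

/-- The families `u ↦ φ ⟨w l, α u (w r)⟩` given by a representation `α` of `B` on a Hilbert module
satisfy every positivity condition that holds for the families `u ↦ ψ ((e l)⋆ u (e r))`. -/
theorem functional_inn_nonneg (α : B →⋆ₙₐ[ℂ] Adjointable A X) {φ : A →ₗ[ℂ] ℂ}
    (hφ : ∀ a, 0 ≤ φ (star a * a)) (w : J → X) {M : Type*} [Fintype M] (l r : M → J) (u : M → B)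
    (c : M → ℂ)
    (hc : ∀ (ψ : B →ₗ[ℂ] ℂ), (∀ b, 0 ≤ ψ (star b * b)) → ∀ e : J → B,
      0 ≤ ∑ m, c m * ψ (star (e (l m)) * u m * e (r m))) :
    0 ≤ ∑ m, c m * φ (inn (w (l m)) (α (u m) (w (r m)))) := by
  classical
  -- The hypothesis `hc` says that each `e⋆ h e` passes the functional test, so the matrix `h` of
  -- the `c m • u m` factors as `t⋆ t`.
  obtain ⟨t, ht⟩ := exists_conjTranspose_mul_self
      (h := Matrix.of fun j k => ∑ m, if l m = j ∧ r m = k then c m • u m else 0) fun e => by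
    refine exists_star_mul_self_of_functional fun ψ hψ => ?_
    have h1 := sum_sum_ite_smul l r u c
      fun j k => (LinearMap.mulRight ℂ (e k)).comp (LinearMap.mulLeft ℂ (star (e j)))
    have h2 : star e ⬝ᵥ (Matrix.of fun j k => ∑ m, if l m = j ∧ r m = k then c m • u m else 0) *ᵥ e =
        ∑ m, c m • (star (e (l m)) * u m * e (r m)) := by
      refine Eq.trans ?_ h1
      refine Finset.sum_congr rfl fun j _ => ?_
      rw [Matrix.mulVec, dotProduct, Finset.mul_sum]
      refine Finset.sum_congr rfl fun k _ => ?_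
      rw [LinearMap.comp_apply, LinearMap.mulLeft_apply, LinearMap.mulRight_apply, mul_assoc]
      rfl
    rw [h2, map_sum]
    simpa using hc ψ hψ e
  have h1 := sum_sum_ite_smul l r u c fun j k =>
    (φ.comp (Adjointable.matrixCoeff (w j) (w k))).comp (α : B →ₗ[ℂ] Adjointable A X)
  refine le_of_le_of_eq ?_ h1
  have h3 : ∀ j k, ((φ.comp (Adjointable.matrixCoeff (w j) (w k))).comp
        (α : B →ₗ[ℂ] Adjointable A X)) (∑ m, if l m = j ∧ r m = k then c m • u m else 0) =
      ∑ i, φ (inn (α (t i j) (w j)) (α (t i k) (w k))) := by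
    intro j k
    have h4 := congrFun (congrFun ht j) k
    rw [Matrix.of_apply] at h4
    rw [h4, Matrix.mul_apply, map_sum]
    refine Finset.sum_congr rfl fun i _ => ?_
    change φ (Adjointable.matrixCoeff (w j) (w k) (α (star (t i j) * t i k))) = _
    rw [map_mul, map_star, Adjointable.matrixCoeff_star_mul]
  simp_rw [h3]
  -- With `y_i = ∑ j, α (t i j) (w j)`, the whole expression is `∑ i, φ ⟨y_i, y_i⟩`.
  have h4 : ∑ j, ∑ k, ∑ i, φ (inn (α (t i j) (w j)) (α (t i k) (w k))) =
      ∑ i, φ (inn (∑ j, α (t i j) (w j)) (∑ k, α (t i k) (w k))) := by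
    simp_rw [sum_inn, inn_sum, map_sum]
    rw [Finset.sum_congr rfl fun j _ => Finset.sum_comm, Finset.sum_comm]
  rw [h4]
  refine Finset.sum_nonneg fun i _ => ?_
  obtain ⟨a, ha⟩ := inn_self_pos (A := A) (∑ j, α (t i j) (w j))
  rw [ha]
  exact hφ a

end Matrix

/-! ### Tests for positivity of adjointable operators. -/

section AdjointableFunctional

variable {A X : Type*} [NonUnitalCStarAlgebra A] [NormedAddCommGroup X]
    [NormedSpace ℂ X] [CompleteSpace X] [HilbertModule A X]

/-- The maps `T ↦ ⟨w, T w⟩` are a test family: `c⋆ T c` tested at `w` is `T` tested at `c w`, and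
`⟨r w, r w⟩ = 0` for all `w` means `r = 0`. -/
theorem Adjointable.exists_star_mul_self {h : Adjointable A X}
    (hh : ∀ w : X, ∃ b : A, inn w (h w) = star b * b) : ∃ r, h = star r * r := by
  refine exists_star_mul_self_of_test (fun w : X =>
    matrixCoeff w w) ?_ ?_ ?_ ?_ hh
  · intro w T
    change inn w (star T w) = star (inn w (T w))
    rw [star_inn, Adjointable.inn_apply_left]
  · intro c w
    exact ⟨c w, fun h => (Adjointable.inn_apply_left c w (h (c w))).symm⟩
  · intro w r
    obtain ⟨a, ha⟩ := inn_self_pos (A := A) (r w)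
    exact ⟨a, (Adjointable.inn_apply_left r w (r w)).symm.trans ha⟩
  · intro r hr
    refine Subtype.ext (ContinuousLinearMap.ext fun w => ?_)
    exact eq_zero_of_inn A ((Adjointable.inn_apply_left r w (r w)).trans (hr w))

/-- Positivity in `End⋆(X)` can be tested on the functionals `T ↦ φ ⟨w a, T (w a)⟩`. -/
theorem functional_adjointable_nonneg {ψ : Adjointable A X →ₗ[ℂ] ℂ}
    (hψ : ∀ a, 0 ≤ ψ (star a * a)) {M : Type*} [Fintype M] (u : M → Adjointable A X) (c : M → ℂ)
    (hc : ∀ φ : A →ₗ[ℂ] ℂ, (∀ a, 0 ≤ φ (star a * a)) → ∀ (w : X) (a : A),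
      0 ≤ ∑ m, c m * φ (inn (act w a) (u m (act w a)))) :
    0 ≤ ∑ m, c m * ψ (u m) := by
  obtain ⟨r, hr⟩ := Adjointable.exists_star_mul_self (h := ∑ m, c m • u m) fun w => by
    -- The conjugate `a⋆ ⟨w, h w⟩ a` is `⟨w a, h (w a)⟩`, so vectors of the form `w a` suffice as
    -- tests. Only these arise when a simple tensor of `X` is applied to a generating vector of
    -- `GNSSpace`.
    refine exists_star_mul_self_of_conj fun a => exists_star_mul_self_of_functional fun φ hφ => ?_
    have h1 : star a * inn w ((∑ m, c m • u m : Adjointable A X) w) * a =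
        ∑ m, c m • inn (act w a) (u m (act w a)) := by
      rw [← Adjointable.matrixCoeff_apply, map_sum, Finset.mul_sum, Finset.sum_mul]
      refine Finset.sum_congr rfl fun m _ => ?_
      rw [map_smul, mul_smul_comm, smul_mul_assoc, Adjointable.matrixCoeff_apply, mul_assoc,
        ← inn_act, ← act_inn, Adjointable.act_apply]
    rw [h1, map_sum]
    simpa using hc φ hφ w a
  have h2 : ∑ m, c m * ψ (u m) = ψ (∑ m, c m • u m) := by simp
  rw [h2, hr]
  exact hψ r

end AdjointableFunctional

end CStar

/-! ### Transfer of positivity conditions one place at a time. -/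

section Transfer

open Classical in
theorem finprod_eq_mul_finprod_ite {I R : Type*} [CommMonoid R] {f : I → R}
    (hf : ∀ᶠ v in cofinite, f v = 1) (w : I) :
    ∏ᶠ v, f v = f w * ∏ᶠ v, if v = w then 1 else f v := by
  rw [eventually_cofinite] at hf
  have h1 : ∏ᶠ v, (if v = w then f v else 1) = f w := by
    rw [finprod_eq_single _ w fun v hv => if_neg hv, if_pos rfl]
  rw [← h1, ← finprod_mul_distrib]
  · refine finprod_congr fun v => ?_
    split_ifs <;> simp
  · refine (Set.finite_singleton w).subset fun v hv => ?_
    by_contra hne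
    exact hv (if_neg hne)
  · refine hf.subset fun v hv hfv => hv ?_
    simp [hfv]

/-- A positivity condition on sums of products, `0 ≤ ∑ m, d m ∏ v, F v m`, extends from the families
`F v (t v)` to the families `G v` if, at each place, every linear positivity condition does. -/
theorem sum_finprod_nonneg {I M : Type*} [Fintype M] {D : I → Type*} (F : ∀ v, D v → M → ℂ)
    {q : ∀ v, D v} (hq : ∀ᶠ v in cofinite, ∀ m, F v (q v) m = 1) {G : I → M → ℂ}
    (hG : ∀ᶠ v in cofinite, ∀ m, G v m = 1)
    (hrep : ∀ v (c : M → ℂ), (∀ t, 0 ≤ ∑ m, c m * F v t m) → 0 ≤ ∑ m, c m * G v m) (d : M → ℂ)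
    (H : ∀ t : RestrictedFamily q, 0 ≤ ∑ m, d m * ∏ᶠ v, F v (t v) m) :
    0 ≤ ∑ m, d m * ∏ᶠ v, G v m := by
  classical
  -- Induction on the set of places where `F` has been replaced by `G`, for all `t` at once. At a
  -- new place `w` the product of the other factors is absorbed into the coefficients; `hrep` then
  -- asks for the condition at every `s : D w`, which is the induction hypothesis for `t` with `s`
  -- put at `w`.
  have claim : ∀ (T : Finset I) (t : RestrictedFamily q),
      0 ≤ ∑ m, d m * ∏ᶠ v, if v ∈ T then G v m else F v (t v) m := by
    intro T
    induction T using Finset.induction_on with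
    | empty => intro t; simpa using H t
    | insert w T hw ih =>
      intro t
      have hfin : ∀ (t : RestrictedFamily q) (T : Finset I) (m : M),
          ∀ᶠ v in cofinite, (if v ∈ T then G v m else F v (t v) m) = 1 := by
        intro t T m
        filter_upwards [hq, hG, t.2] with v h1 h2 h3
        rw [h3, h1, h2, ite_self]
      have e1 : ∀ m, ∏ᶠ v, (if v ∈ insert w T then G v m else F v (t v) m) =
          G w m * ∏ᶠ v, if v = w then 1 else if v ∈ T then G v m else F v (t v) m := by
        intro m
        rw [finprod_eq_mul_finprod_ite (hfin t (insert w T) m) w, if_pos (Finset.mem_insert_self _ _)]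
        congr 1
        refine finprod_congr fun v => ?_
        by_cases hv : v = w <;> simp [hv]
      simp_rw [e1, mul_left_comm (d _), mul_comm (G w _)]
      refine hrep w _ fun s => ?_
      have hs : ∀ᶠ v in cofinite, Function.update t.1 w s v = q v := by
        filter_upwards [t.2, (Set.finite_singleton w).compl_mem_cofinite] with v h1 h2
        rw [Function.update_of_ne h2, h1]
      have h1 := ih ⟨Function.update t.1 w s, hs⟩
      refine h1.trans_eq (Finset.sum_congr rfl fun m _ => ?_)
      rw [finprod_eq_mul_finprod_ite (hfin ⟨Function.update t.1 w s, hs⟩ T m) w, if_neg hw]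
      simp only [Function.update_self]
      rw [mul_left_comm, mul_comm]
      congr 2
      refine finprod_congr fun v => ?_
      by_cases hv : v = w <;> simp [hv]
  have hfin := hq.and hG
  rw [eventually_cofinite] at hfin
  -- With `t = q`, all factors outside this finite set are 1 for both families, so nothing remains
  -- to be replaced.
  have h1 := claim hfin.toFinset ⟨q, Eventually.of_forall fun _ => rfl⟩
  refine h1.trans_eq (Finset.sum_congr rfl fun m _ => ?_)
  congr 1
  refine finprod_congr fun v => ?_
  split_ifs with hv
  · rfl
  · rw [Set.Finite.mem_toFinset, Set.mem_ofPred_eq, not_not] at hv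
    rw [hv.1, hv.2]

end Transfer

/-! ### Norm estimates as positivity conditions on inner products. -/

section InnerExpansion

open scoped InnerProductSpace

variable {H : Type*} [NormedAddCommGroup H] [InnerProductSpace ℂ H]

/-- The coefficients of the inner products in `N² ‖∑ γ j • g j‖² - ‖∑ γ' i • g' i‖²`. -/
def normGapCoeff {J J' : Type*} (N : ℝ) (γ : J → ℂ) (γ' : J' → ℂ) : (J × J) ⊕ (J' × J') → ℂ :=
  Sum.elim (fun j => (N : ℂ) ^ 2 * (star (γ j.1) * γ j.2)) (fun i => -(star (γ' i.1) * γ' i.2))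

theorem inner_sum_smul_self {J : Type*} [Fintype J] (γ : J → ℂ) (g : J → H) :
    ((‖∑ j, γ j • g j‖ ^ 2 : ℝ) : ℂ) = ∑ j : J × J, star (γ j.1) * γ j.2 * ⟪g j.1, g j.2⟫_ℂ := by
  push_cast
  have := inner_self_eq_norm_sq_to_K (𝕜 := ℂ) (∑ j, γ j • g j)
  rw [show ((‖∑ j, γ j • g j‖ : ℂ)) ^ 2 = _ from this.symm, sum_inner, Fintype.sum_prod_type]
  refine Finset.sum_congr rfl fun i _ => ?_
  rw [inner_sum]
  refine Finset.sum_congr rfl fun j _ => ?_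
  rw [inner_smul_left, inner_smul_right, mul_assoc]
  rfl

/-- Squaring turns a norm estimate into a condition that is linear in the inner products, with
coefficients independent of the vectors. This is the shape that `sum_finprod_nonneg` can move
between families of functionals. -/
theorem norm_sum_le_iff {J J' : Type*} [Fintype J] [Fintype J'] {N : ℝ} (hN : 0 ≤ N) (γ : J → ℂ)
    (g : J → H) (γ' : J' → ℂ) (g' : J' → H) :
    ‖∑ i, γ' i • g' i‖ ≤ N * ‖∑ j, γ j • g j‖ ↔
      0 ≤ ∑ m, normGapCoeff N γ γ' m *
        Sum.elim (fun j : J × J => ⟪g j.1, g j.2⟫_ℂ) (fun i : J' × J' => ⟪g' i.1, g' i.2⟫_ℂ) m := by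
  have h1 : ∑ m, normGapCoeff N γ γ' m *
        Sum.elim (fun j : J × J => ⟪g j.1, g j.2⟫_ℂ) (fun i : J' × J' => ⟪g' i.1, g' i.2⟫_ℂ) m =
      (((N * ‖∑ j, γ j • g j‖) ^ 2 - ‖∑ i, γ' i • g' i‖ ^ 2 : ℝ) : ℂ) := by
    rw [mul_pow, Complex.ofReal_sub, Complex.ofReal_mul, inner_sum_smul_self, inner_sum_smul_self,
      Fintype.sum_sum_type, Finset.mul_sum, sub_eq_add_neg, ← Finset.sum_neg_distrib]
    simp only [normGapCoeff, Sum.elim_inl, Sum.elim_inr]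
    push_cast
    simp only [mul_assoc, neg_mul]
  rw [h1, Complex.zero_le_real, sub_nonneg]
  exact (sq_le_sq₀ (norm_nonneg _) (by positivity)).symm

theorem Finsupp.exists_eq_sum_smul_single {β : Type*} (f : β →₀ ℂ) :
    ∃ (n : ℕ) (γ : Fin n → ℂ) (w : Fin n → β), f = ∑ i, γ i • Finsupp.single (w i) 1 := by
  induction f using Finsupp.induction_linear with
  | zero => exact ⟨0, Fin.elim0, Fin.elim0, by simp⟩
  | add f g hf hg =>
    obtain ⟨n, γ, w, rfl⟩ := hf
    obtain ⟨m, γ', w', rfl⟩ := hg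
    refine ⟨n + m, Fin.append γ γ', Fin.append w w', ?_⟩
    simp [Fin.sum_univ_add]
  | single a b => exact ⟨1, fun _ => b, fun _ => a, by simp⟩

theorem norm_sq_sum_of_inner_eq_zero {ι : Type*} (s : Finset ι) (y : ι → H)
    (h : ∀ i ∈ s, ∀ j ∈ s, i ≠ j → ⟪y i, y j⟫_ℂ = 0) :
    ‖∑ i ∈ s, y i‖ ^ 2 = ∑ i ∈ s, ‖y i‖ ^ 2 := by
  rw [← inner_self_eq_norm_sq (𝕜 := ℂ), sum_inner, map_sum]
  refine Finset.sum_congr rfl fun i hi => ?_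
  rw [inner_sum, Finset.sum_eq_single i, inner_self_eq_norm_sq]
  · exact fun j hj hji => h i hi j hj hji.symm
  · exact fun hi' => absurd hi hi'

/-- A norm estimate for linear maps on `ℂ[P × W]` that preserve an orthogonal decomposition indexed
by `P` can be checked on the summands. -/
theorem norm_le_of_blocks {P W H' : Type*} [NormedAddCommGroup H'] [InnerProductSpace ℂ H']
    (T₁ : (P × W →₀ ℂ) →ₗ[ℂ] H) (T₂ : (P × W →₀ ℂ) →ₗ[ℂ] H') {N : ℝ} (hN : 0 ≤ N)
    (h₁ : ∀ φ φ' w w', φ ≠ φ' →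
      ⟪T₁ (Finsupp.single (φ, w) 1), T₁ (Finsupp.single (φ', w') 1)⟫_ℂ = 0)
    (h₂ : ∀ φ φ' w w', φ ≠ φ' →
      ⟪T₂ (Finsupp.single (φ, w) 1), T₂ (Finsupp.single (φ', w') 1)⟫_ℂ = 0)
    (h : ∀ φ (n : ℕ) (γ : Fin n → ℂ) (w : Fin n → W),
      ‖T₁ (∑ i, γ i • Finsupp.single (φ, w i) 1)‖ ≤
        N * ‖T₂ (∑ i, γ i • Finsupp.single (φ, w i) 1)‖) (ξ : P × W →₀ ℂ) :
    ‖T₁ ξ‖ ≤ N * ‖T₂ ξ‖ := by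
  let incl : P → (W →₀ ℂ) →ₗ[ℂ] (P × W →₀ ℂ) := fun φ => Finsupp.lmapDomain ℂ ℂ (fun w => (φ, w))
  have hincl : ∀ φ w, incl φ (Finsupp.single w 1) = Finsupp.single (φ, w) 1 := fun φ w =>
    Finsupp.mapDomain_single
  -- The terms of `ξ` are sorted by their component in `P`. Both images then split orthogonally, and
  -- the squared estimates of the blocks add up by Pythagoras.
  obtain ⟨f, hf⟩ : ∃ f : P →₀ (W →₀ ℂ), ξ = f.sum fun φ η => incl φ η := by
    induction ξ using Finsupp.induction_linear with
    | zero => exact ⟨0, by simp⟩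
    | add ξ η hξ hη =>
      obtain ⟨f, rfl⟩ := hξ
      obtain ⟨g, rfl⟩ := hη
      exact ⟨f + g, (Finsupp.sum_add_index' (h := fun φ η => incl φ η) (by simp) (by simp)).symm⟩
    | single i c =>
      refine ⟨Finsupp.single i.1 (Finsupp.single i.2 c), ?_⟩
      rw [Finsupp.sum_single_index (by simp)]
      exact (Finsupp.mapDomain_single (f := fun w => (i.1, w)) (a := i.2) (b := c)).symm
  have hsum : ∀ φ (η : W →₀ ℂ), ∃ (n : ℕ) (γ : Fin n → ℂ) (w : Fin n → W),
      incl φ η = ∑ i, γ i • Finsupp.single (φ, w i) 1 := by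
    intro φ η
    obtain ⟨n, γ, w, rfl⟩ := η.exists_eq_sum_smul_single
    exact ⟨n, γ, w, by simp [hincl, -Finsupp.smul_single]⟩
  have e₁ : ‖T₁ ξ‖ ^ 2 = ∑ φ ∈ f.support, ‖T₁ (incl φ (f φ))‖ ^ 2 := by
    rw [hf, Finsupp.sum, map_sum]
    refine norm_sq_sum_of_inner_eq_zero _ _ fun φ _ φ' _ hne => ?_
    obtain ⟨n, γ, w, e⟩ := hsum φ (f φ)
    obtain ⟨n', γ', w', e'⟩ := hsum φ' (f φ')
    simp [e, e', -Finsupp.smul_single,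
      h₁ _ _ _ _ hne]
  have e₂ : ‖T₂ ξ‖ ^ 2 = ∑ φ ∈ f.support, ‖T₂ (incl φ (f φ))‖ ^ 2 := by
    rw [hf, Finsupp.sum, map_sum]
    refine norm_sq_sum_of_inner_eq_zero _ _ fun φ _ φ' _ hne => ?_
    obtain ⟨n, γ, w, e⟩ := hsum φ (f φ)
    obtain ⟨n', γ', w', e'⟩ := hsum φ' (f φ')
    simp [e, e', -Finsupp.smul_single,
      h₂ _ _ _ _ hne]
  refine le_of_sq_le_sq ?_ (by positivity)
  rw [mul_pow, e₁, e₂, Finset.mul_sum]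
  refine Finset.sum_le_sum fun φ _ => ?_
  obtain ⟨n, γ, w, e⟩ := hsum φ (f φ)
  rw [e, ← mul_pow]
  exact pow_le_pow_left₀ (norm_nonneg _) (h φ n γ w) 2

end InnerExpansion

/-! ### Comparison of the spatial norm of `A'` with norms in the module. -/

section Restricted

variable {I : Type*} {A : I → Type*} [∀ v, NonUnitalCStarAlgebra (A v)]

open scoped InnerProductSpace

/-- This provides base points for the transfer: test data for which almost all factors equal 1.
Nonvanishing of almost all `p v` is essential here; at the exceptional places the zero functional is
good enough. -/
theorem ProjectionFamily.nonempty_productFunctional (p : ProjectionFamily A) :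
    Nonempty (ProductFunctional p) := by
  have h1 : ∀ v, ∃ φ : A v →ₗ[ℂ] ℂ, (∀ a, 0 ≤ φ (star a * a)) ∧
      (IsStarProjection (p.proj v) → p.proj v ≠ 0 → φ (p.proj v) = 1) := by
    intro v
    by_cases h : IsStarProjection (p.proj v) ∧ p.proj v ≠ 0
    · obtain ⟨φ, h1, h2⟩ := exists_functional_eq_one h.1 h.2
      exact ⟨φ, h1, fun _ _ => h2⟩
    · exact ⟨0, by simp, fun h1 h2 => absurd ⟨h1, h2⟩ h⟩
  choose φ h2 h3 using h1
  refine ⟨⟨φ, h2, ?_⟩⟩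
  filter_upwards [p.isStarProjection, p.ne_zero] with v h4 h5
  exact h3 v h4 h5

namespace CompatibleVectors

variable {p : ProjectionFamily A} {X : I → Type*}
    [∀ v, NormedAddCommGroup (X v)] [∀ v, NormedSpace ℂ (X v)] [∀ v, CompleteSpace (X v)]
    [∀ v, HilbertModule (A v) (X v)] (x : CompatibleVectors p X)

theorem inner_gnsVec (φ : ProductFunctional p) (w z : x.Family) :
    ⟪x.gnsVec φ w, x.gnsVec φ z⟫_ℂ = ∏ᶠ v, φ.toFun v (inn (A := A v) (w v) (z v)) := by
  rw [KernelSpace.inner_δ, kernel, Matrix.of_apply, if_pos rfl]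

theorem inner_gnsVec_of_ne {φ ψ : ProductFunctional p} (h : φ ≠ ψ) (w z : x.Family) :
    ⟪x.gnsVec φ w, x.gnsVec ψ z⟫_ℂ = 0 := by
  rw [KernelSpace.inner_δ, kernel, Matrix.of_apply, if_neg h]

end CompatibleVectors

variable {A' : I → Type*} [∀ v, NonUnitalCStarAlgebra (A' v)]
    {p' : ProjectionFamily A'} {p : ProjectionFamily A} {X : I → Type*}
    [∀ v, NormedAddCommGroup (X v)] [∀ v, NormedSpace ℂ (X v)] [∀ v, CompleteSpace (X v)]
    [∀ v, HilbertModule (A v) (X v)] {x : CompatibleVectors p X}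

namespace CorrespondenceFamily

variable (α : CorrespondenceFamily p' x)

/-- The global form of `functional_inn_nonneg`. The data tested at a place are a positive functional
together with a column `e`, and the base point is `(ψ₀, p')`. A restricted family of such data is a
product functional with a `J`-tuple of simple tensors. -/
theorem sum_functional_nonneg {J M : Type*} [Fintype J] [Fintype M] (φ : ProductFunctional p)
    (w : J → x.Family) (l r : M → J) (u : M → p'.Family) (d : M → ℂ)
    (H : ∀ (ψ : ProductFunctional p') (e : J → p'.Family),
      0 ≤ ∑ m, d m * ∏ᶠ v, ψ.toFun v (star (e (l m) v) * u m v * e (r m) v)) :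
    0 ≤ ∑ m, d m * ∏ᶠ v, φ.toFun v (inn (w (l m) v) (α.hom v (u m v) (w (r m) v))) := by
  obtain ⟨ψ₀⟩ := p'.nonempty_productFunctional
  have hu : ∀ᶠ v in cofinite, ∀ m, u m v = p'.proj v := eventually_all.2 fun m => (u m).2
  have hw : ∀ᶠ v in cofinite, ∀ j, w j v = x.vec v := eventually_all.2 fun j => (w j).2
  refine sum_finprod_nonneg
    (D := fun v => {ψ : A' v →ₗ[ℂ] ℂ // ∀ b, 0 ≤ ψ (star b * b)} × (J → A' v))
    (fun v t m => t.1.1 (star (t.2 (l m)) * u m v * t.2 (r m)))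
    (q := fun v => (⟨ψ₀.toFun v, ψ₀.nonneg v⟩, fun _ => p'.proj v)) ?_ ?_ ?_ d ?_
  · filter_upwards [hu, ψ₀.normalized, p'.isStarProjection] with v h1 h2 h3 m
    rw [h1, h3.isSelfAdjoint.star_eq, h3.isIdempotentElem.eq, h3.isIdempotentElem.eq, h2]
  · filter_upwards [hu, hw, φ.normalized, α.hom_proj_vec, x.inn_vec] with v h1 h2 h3 h4 h5 m
    rw [h1, h2, h2, h4, h5, h3]
  · intro v c hc
    exact functional_inn_nonneg (α.hom v) (φ.nonneg v) (fun j => w j v) l r (fun m => u m v) c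
      fun ψ hψ e => hc (⟨ψ, hψ⟩, e)
  · intro t
    refine H ⟨fun v => (t v).1.1, fun v => (t v).1.2, ?_⟩ fun j => ⟨fun v => (t v).2 j, ?_⟩
    · filter_upwards [t.2, ψ₀.normalized] with v h1 h2
      rw [h1, h2]
    · filter_upwards [t.2] with v h1
      rw [h1]

/-- Since every vector has passed through `α`, each inner product `⟨α(b) w, α(b') w'⟩` equals `⟨w,
α(b⋆ b') w'⟩` and is covered by the transfer. The map `π` records which of the vectors `w j` each
term of the left side starts from. -/
theorem norm_sum_gnsVec_le {J J' : Type*} [Fintype J] [Fintype J'] (φ : ProductFunctional p)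
    (w : J → x.Family) (π : J' → J) (b : J → p'.Family) (b' : J' → p'.Family) (γ : J → ℂ)
    (γ' : J' → ℂ) {N : ℝ} (hN : 0 ≤ N)
    (H : ∀ (ψ : ProductFunctional p') (e : J → p'.Family),
      ‖∑ i, γ' i • p'.toVectors.gnsVec ψ (p'.toVectors.famAct (b' i) (e (π i)))‖ ≤
        N * ‖∑ j, γ j • p'.toVectors.gnsVec ψ (p'.toVectors.famAct (b j) (e j))‖) :
    ‖∑ i, γ' i • x.gnsVec φ (α.famApply (b' i) (w (π i)))‖ ≤
      N * ‖∑ j, γ j • x.gnsVec φ (α.famApply (b j) (w j))‖ := by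
  rw [norm_sum_le_iff hN]
  have key := α.sum_functional_nonneg (J := J) φ w
    (Sum.elim (fun j : J × J => j.1) (fun i : J' × J' => π i.1))
    (Sum.elim (fun j : J × J => j.2) (fun i : J' × J' => π i.2))
    (Sum.elim (fun j => p'.toVectors.famInn (b j.1) (b j.2))
      (fun i => p'.toVectors.famInn (b' i.1) (b' i.2))) (normGapCoeff N γ γ') fun ψ e => by
    have h1 := (norm_sum_le_iff hN _ _ _ _).1 (H ψ e)
    refine h1.trans_eq (Finset.sum_congr rfl fun m _ => ?_)
    congr 1
    rcases m with m | m <;>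
    · simp only [Sum.elim_inl, Sum.elim_inr]
      rw [CompatibleVectors.inner_gnsVec]
      refine finprod_congr fun v => congrArg (ψ.toFun v) ?_
      change star (_ * _) * (_ * _) = star _ * (star _ * _) * _
      simp only [star_mul, mul_assoc]
  refine key.trans_eq (Finset.sum_congr rfl fun m _ => ?_)
  congr 1
  rcases m with m | m <;>
  · simp only [Sum.elim_inl, Sum.elim_inr]
    rw [CompatibleVectors.inner_gnsVec]
    refine finprod_congr fun v => congrArg (φ.toFun v) ?_
    change Adjointable.matrixCoeff _ _ (α.hom v (star _ * _)) = _
    rw [map_mul, map_star, Adjointable.matrixCoeff_star_mul]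
    rfl

end CorrespondenceFamily

end Restricted

/-! ### Formal combinations of simple tensors and their bounded action on `GNSSpace`. -/

section Restricted

variable {I : Type*} {A : I → Type*} [∀ v, NonUnitalCStarAlgebra (A v)]

open scoped InnerProductSpace

namespace ProjectionFamily

variable (p : ProjectionFamily A)

theorem tmul_mul_tmul (a b : p.Family) :
    p.tmul a * p.tmul b = p.tmul (p.toVectors.famAct a b) :=
  Subtype.ext (p.toVectors.tensorOp_comp a b)

theorem star_tmul (a : p.Family) : star (p.tmul a) = p.tmul (p.famStar a) :=
  Subtype.ext (p.star_tensorOp a)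

/-- Formal combinations of simple tensors, as elements of the restricted tensor product. -/
noncomputable def ofFormal : (p.Family →₀ ℂ) →ₗ[ℂ] p.RestrictedTensor :=
  Finsupp.linearCombination ℂ p.tmul

theorem ofFormal_single (a : p.Family) : p.ofFormal (Finsupp.single a 1) = p.tmul a := by
  simp [ofFormal]

/-- The inclusion of the restricted tensor product into the operators on `GNSSpace`. -/
noncomputable def toOp : p.RestrictedTensor →ₗᵢ[ℂ]
    (p.toVectors.GNSSpace →L[ℂ] p.toVectors.GNSSpace) where
  toFun T := T.1
  map_add' _ _ := rfl
  map_smul' _ _ := rfl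
  norm_map' _ := rfl

theorem toOp_tmul (a : p.Family) : p.toOp (p.tmul a) = p.toVectors.tensorOp a := rfl

theorem toOp_ofFormal (c : p.Family →₀ ℂ) :
    p.toOp (p.ofFormal c) = Finsupp.linearCombination ℂ p.toVectors.tensorOp c := by
  induction c using Finsupp.induction_linear with
  | zero => simp
  | add f g hf hg => rw [map_add, map_add, map_add, hf, hg]
  | single a c =>
    rw [ofFormal, Finsupp.linearCombination_single, Finsupp.linearCombination_single, map_smul,
      toOp_tmul]

theorem norm_ofFormal (c : p.Family →₀ ℂ) :
    ‖p.ofFormal c‖ = ‖Finsupp.linearCombination ℂ p.toVectors.tensorOp c‖ := by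
  rw [← p.toOp_ofFormal c, LinearIsometry.norm_map]

/-- `RestrictedTensor` is a closure inside the operators, so density is pulled back along the
isometry `toOp`. -/
theorem denseRange_ofFormal : DenseRange p.ofFormal := by
  intro T
  rw [p.toOp.isometry.isUniformInducing.isInducing.closure_eq_preimage_closure_image,
    Set.mem_preimage]
  have h : p.toOp '' Set.range p.ofFormal =
      (Submodule.span ℂ (Set.range p.toVectors.tensorOp) : Set _) := by
    rw [← Finsupp.range_linearCombination, ← Set.range_comp]
    exact congrArg Set.range (funext p.toOp_ofFormal)
  rw [h]
  exact T.2

end ProjectionFamily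

namespace CompatibleVectors

variable {p : ProjectionFamily A} {X : I → Type*}
    [∀ v, NormedAddCommGroup (X v)] [∀ v, NormedSpace ℂ (X v)] [∀ v, CompleteSpace (X v)]
    [∀ v, HilbertModule (A v) (X v)] (x : CompatibleVectors p X)

/-- Formal combinations of simple tensors, as vectors of the Hilbert space `GNSSpace`. -/
noncomputable def formalVec : (ProductFunctional p × x.Family →₀ ℂ) →ₗ[ℂ] x.GNSSpace :=
  Finsupp.linearCombination ℂ fun i => x.gnsVec i.1 i.2

theorem formalVec_single (φ : ProductFunctional p) (w : x.Family) :
    x.formalVec (Finsupp.single (φ, w) 1) = x.gnsVec φ w := by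
  simp [formalVec]

theorem denseRange_formalVec : DenseRange x.formalVec := by
  have h := KernelSpace.dense_span_δ (hk := x.kernel_posSemidef)
  rw [← Finsupp.range_linearCombination] at h
  exact h

end CompatibleVectors

variable {A' : I → Type*} [∀ v, NonUnitalCStarAlgebra (A' v)]
    {p' : ProjectionFamily A'} {p : ProjectionFamily A} {X : I → Type*}
    [∀ v, NormedAddCommGroup (X v)] [∀ v, NormedSpace ℂ (X v)] [∀ v, CompleteSpace (X v)]
    [∀ v, HilbertModule (A v) (X v)] {x : CompatibleVectors p X}

namespace CorrespondenceFamily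

variable (α : CorrespondenceFamily p' x)

theorem famApply_famAct (a b : p'.Family) (w : x.Family) :
    α.famApply (p'.toVectors.famAct a b) w = α.famApply a (α.famApply b w) :=
  RestrictedFamily.ext (funext fun v => by
    change α.hom v (a v * b v) (w v) = α.hom v (a v) (α.hom v (b v) (w v))
    rw [map_mul]
    rfl)

theorem famApply_famAct_right (a : p'.Family) (w : x.Family) (b : p.toVectors.Family) :
    α.famApply a (x.famAct w b) = x.famAct (α.famApply a w) b :=
  RestrictedFamily.ext (funext fun v => Adjointable.act_apply (α.hom v (a v)) (w v) (b v))

/-- The operator `∑ c a • a` on formal combinations of simple tensors. -/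
noncomputable def formalAction : (p'.Family →₀ ℂ) →ₗ[ℂ]
    (ProductFunctional p × x.Family →₀ ℂ) →ₗ[ℂ] (ProductFunctional p × x.Family →₀ ℂ) :=
  Finsupp.linearCombination ℂ fun a => Finsupp.lmapDomain ℂ ℂ fun i => (i.1, α.famApply a i.2)

theorem formalAction_single (a : p'.Family) (φ : ProductFunctional p) (w : x.Family) :
    α.formalAction (Finsupp.single a 1) (Finsupp.single (φ, w) 1) =
      Finsupp.single (φ, α.famApply a w) 1 := by
  rw [formalAction, Finsupp.linearCombination_single, one_smul]
  exact Finsupp.mapDomain_single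

/-- After transfer to `A'`, the estimate is the operator norm bound for `∑ i, c i • tensorOp (a i)`,
applied to the combination of the vectors `⊗ b e`. -/
theorem norm_sum_smul_gnsVec_le {k l n : ℕ} (c : Fin k → ℂ) (a : Fin k → p'.Family) (d : Fin l → ℂ)
    (b : Fin l → p'.Family) (φ : ProductFunctional p) (γ : Fin n → ℂ) (w : Fin n → x.Family) :
    ‖∑ i : (Fin n × Fin l) × Fin k, (γ i.1.1 * d i.1.2 * c i.2) •
        x.gnsVec φ (α.famApply (p'.toVectors.famAct (a i.2) (b i.1.2)) (w i.1.1))‖ ≤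
      ‖∑ i, c i • p'.toVectors.tensorOp (a i)‖ *
        ‖∑ j : Fin n × Fin l, (γ j.1 * d j.2) • x.gnsVec φ (α.famApply (b j.2) (w j.1))‖ := by
  refine α.norm_sum_gnsVec_le φ (fun j : Fin n × Fin l => w j.1)
    (fun i : (Fin n × Fin l) × Fin k => i.1) (fun j => b j.2)
    (fun i => p'.toVectors.famAct (a i.2) (b i.1.2)) (fun j => γ j.1 * d j.2)
    (fun i => γ i.1.1 * d i.1.2 * c i.2) (norm_nonneg _) fun ψ e => ?_
  refine le_of_eq_of_le (congrArg _ ?_) ((∑ i, c i • p'.toVectors.tensorOp (a i)).le_opNorm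
    (∑ j : Fin n × Fin l, (γ j.1 * d j.2) •
      p'.toVectors.gnsVec ψ (p'.toVectors.famAct (b j.2) (e j))))
  rw [map_sum, Fintype.sum_prod_type]
  refine Finset.sum_congr rfl fun j _ => ?_
  rw [map_smul, _root_.sum_apply, Finset.smul_sum]
  refine Finset.sum_congr rfl fun i _ => ?_
  rw [_root_.smul_apply, CompatibleVectors.tensorOp_gnsVec, smul_smul]
  congr 2
  exact RestrictedFamily.ext (funext fun v => mul_assoc _ _ _)

theorem formalAction_sum_single {k : ℕ} (c : Fin k → ℂ) (a : Fin k → p'.Family)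
    (φ : ProductFunctional p) (w : x.Family) :
    α.formalAction (∑ i, c i • Finsupp.single (a i) 1) (Finsupp.single (φ, w) 1) =
      ∑ i, c i • Finsupp.single (φ, α.famApply (a i) w) 1 := by
  simp only [map_sum, map_smul, LinearMap.sum_apply, LinearMap.smul_apply, formalAction_single]

theorem inner_formalVec_of_ne {φ ψ : ProductFunctional p} (hne : φ ≠ ψ) {k l : ℕ} (c : Fin k → ℂ)
    (w : Fin k → x.Family) (d : Fin l → ℂ) (z : Fin l → x.Family) :
    ⟪x.formalVec (∑ i, c i • Finsupp.single (φ, w i) 1),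
      x.formalVec (∑ i, d i • Finsupp.single (ψ, z i) 1)⟫_ℂ = 0 := by
  rw [map_sum, map_sum, sum_inner]
  refine Finset.sum_eq_zero fun i _ => ?_
  rw [inner_sum]
  refine Finset.sum_eq_zero fun j _ => ?_
  rw [map_smul, map_smul, inner_smul_left, inner_smul_right, x.formalVec_single,
    x.formalVec_single, x.inner_gnsVec_of_ne hne, mul_zero, mul_zero]

theorem formalAction_sum_sum {k n : ℕ} (c : Fin k → ℂ) (a : Fin k → p'.Family)
    (φ : ProductFunctional p) (γ : Fin n → ℂ) (w : Fin n → x.Family) :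
    α.formalAction (∑ i, c i • Finsupp.single (a i) 1) (∑ i, γ i • Finsupp.single (φ, w i) 1) =
      ∑ j, ∑ i, (γ j * c i) • Finsupp.single (φ, α.famApply (a i) (w j)) 1 := by
  rw [map_sum]
  refine Finset.sum_congr rfl fun j _ => ?_
  rw [map_smul, formalAction_sum_single, Finset.smul_sum]
  exact Finset.sum_congr rfl fun i _ => smul_smul _ _ _

theorem norm_formalAction_formalAction_block_le {k l n : ℕ} (c : Fin k → ℂ) (a : Fin k → p'.Family)
    (d : Fin l → ℂ) (b : Fin l → p'.Family) (φ : ProductFunctional p) (γ : Fin n → ℂ)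
    (w : Fin n → x.Family) :
    ‖x.formalVec (α.formalAction (∑ i, c i • Finsupp.single (a i) 1)
      (α.formalAction (∑ i, d i • Finsupp.single (b i) 1)
        (∑ i, γ i • Finsupp.single (φ, w i) 1)))‖ ≤
      ‖∑ i, c i • p'.toVectors.tensorOp (a i)‖ *
        ‖x.formalVec (α.formalAction (∑ i, d i • Finsupp.single (b i) 1)
          (∑ i, γ i • Finsupp.single (φ, w i) 1))‖ := by
  have key := α.norm_sum_smul_gnsVec_le c a d b φ γ w
  have e1 : x.formalVec (α.formalAction (∑ i, d i • Finsupp.single (b i) 1)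
      (∑ i, γ i • Finsupp.single (φ, w i) 1)) =
      ∑ j : Fin n × Fin l, (γ j.1 * d j.2) • x.gnsVec φ (α.famApply (b j.2) (w j.1)) := by
    rw [formalAction_sum_sum, Fintype.sum_prod_type, map_sum]
    refine Finset.sum_congr rfl fun i _ => ?_
    rw [map_sum]
    refine Finset.sum_congr rfl fun j _ => ?_
    rw [map_smul, x.formalVec_single]
  have e2 : x.formalVec (α.formalAction (∑ i, c i • Finsupp.single (a i) 1)
      (α.formalAction (∑ i, d i • Finsupp.single (b i) 1)
      (∑ i, γ i • Finsupp.single (φ, w i) 1))) =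
      ∑ i : (Fin n × Fin l) × Fin k, (γ i.1.1 * d i.1.2 * c i.2) •
        x.gnsVec φ (α.famApply (p'.toVectors.famAct (a i.2) (b i.1.2)) (w i.1.1)) := by
    rw [formalAction_sum_sum, Fintype.sum_prod_type, Fintype.sum_prod_type, map_sum, map_sum]
    refine Finset.sum_congr rfl fun i _ => ?_
    rw [map_sum, map_sum]
    refine Finset.sum_congr rfl fun j _ => ?_
    rw [map_smul, map_smul, formalAction_sum_single, map_sum, Finset.smul_sum]
    refine Finset.sum_congr rfl fun h _ => ?_
    rw [map_smul, x.formalVec_single, smul_smul, famApply_famAct]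
  rw [e1, e2]
  exact key

theorem norm_formalAction_formalAction_le_of_blocks {k l : ℕ} (c : Fin k → ℂ)
    (a : Fin k → p'.Family) (d : Fin l → ℂ) (b : Fin l → p'.Family) {N : ℝ} (hN : 0 ≤ N)
    (h : ∀ φ (n : ℕ) (γ : Fin n → ℂ) (w : Fin n → x.Family),
      ‖x.formalVec (α.formalAction (∑ i, c i • Finsupp.single (a i) 1)
        (α.formalAction (∑ i, d i • Finsupp.single (b i) 1)
          (∑ i, γ i • Finsupp.single (φ, w i) 1)))‖ ≤
      N * ‖x.formalVec (α.formalAction (∑ i, d i • Finsupp.single (b i) 1)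
          (∑ i, γ i • Finsupp.single (φ, w i) 1))‖)
    (ξ : ProductFunctional p × x.Family →₀ ℂ) :
    ‖x.formalVec (α.formalAction (∑ i, c i • Finsupp.single (a i) 1)
      (α.formalAction (∑ i, d i • Finsupp.single (b i) 1) ξ))‖ ≤
      N * ‖x.formalVec (α.formalAction (∑ i, d i • Finsupp.single (b i) 1) ξ)‖ := by
  have key := norm_le_of_blocks
    (x.formalVec ∘ₗ α.formalAction (∑ i, c i • Finsupp.single (a i) 1) ∘ₗ
      α.formalAction (∑ i, d i • Finsupp.single (b i) 1))
    (x.formalVec ∘ₗ α.formalAction (∑ i, d i • Finsupp.single (b i) 1)) hN ?_ ?_ ?_ ξ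
  · rw [LinearMap.comp_apply, LinearMap.comp_apply, LinearMap.comp_apply] at key
    exact key
  · intro φ φ' w w' hne
    simp only [LinearMap.comp_apply, formalAction_sum_single, formalAction_sum_sum]
    simp only [map_sum, map_smul, x.formalVec_single, sum_inner, inner_sum, inner_smul_left,
      inner_smul_right, x.inner_gnsVec_of_ne hne, mul_zero, Finset.sum_const_zero]
  · intro φ φ' w w' hne
    simp only [LinearMap.comp_apply, formalAction_sum_single]
    exact inner_formalVec_of_ne hne _ _ _ _
  · intro φ n γ w
    rw [LinearMap.comp_apply, LinearMap.comp_apply, LinearMap.comp_apply]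
    exact h φ n γ w

theorem norm_formalAction_formalAction_sum_le {k l : ℕ} (c : Fin k → ℂ) (a : Fin k → p'.Family)
    (d : Fin l → ℂ) (b : Fin l → p'.Family) (ξ : ProductFunctional p × x.Family →₀ ℂ) :
    ‖x.formalVec (α.formalAction (∑ i, c i • Finsupp.single (a i) 1)
      (α.formalAction (∑ i, d i • Finsupp.single (b i) 1) ξ))‖ ≤
      ‖∑ i, c i • p'.toVectors.tensorOp (a i)‖ *
        ‖x.formalVec (α.formalAction (∑ i, d i • Finsupp.single (b i) 1) ξ)‖ :=
  α.norm_formalAction_formalAction_le_of_blocks c a d b (norm_nonneg _)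
    (fun φ _ γ w => α.norm_formalAction_formalAction_block_le c a d b φ γ w) ξ

/-- The inner factor `b` makes every inner product a matrix coefficient of `α`. The norm of a bare
`ξ` is not of this form, because `A'_v` may lack a unit and may act degenerately. -/
theorem norm_formalAction_formalAction_le (b c : p'.Family →₀ ℂ)
    (ξ : ProductFunctional p × x.Family →₀ ℂ) :
    ‖x.formalVec (α.formalAction c (α.formalAction b ξ))‖ ≤
      ‖p'.ofFormal c‖ * ‖x.formalVec (α.formalAction b ξ)‖ := by
  obtain ⟨k, c', a, hc⟩ := c.exists_eq_sum_smul_single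
  obtain ⟨l, d, b', hb⟩ := b.exists_eq_sum_smul_single
  have h1 : ‖p'.ofFormal c‖ = ‖∑ i, c' i • p'.toVectors.tensorOp (a i)‖ := by
    rw [p'.norm_ofFormal, hc]
    simp only [map_sum, map_smul, Finsupp.linearCombination_single, one_smul]
  rw [h1, hc, hb]
  exact α.norm_formalAction_formalAction_sum_le c' a d b' ξ

theorem inner_formalAction (a : p'.Family) (ξ η : ProductFunctional p × x.Family →₀ ℂ) :
    ⟪x.formalVec (α.formalAction (Finsupp.single a 1) ξ), x.formalVec η⟫_ℂ =
      ⟪x.formalVec ξ, x.formalVec (α.formalAction (Finsupp.single (p'.famStar a) 1) η)⟫_ℂ := by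
  obtain ⟨k, b, w, rfl⟩ := ξ.exists_eq_sum_smul_single
  obtain ⟨l, c, z, rfl⟩ := η.exists_eq_sum_smul_single
  simp only [map_sum, map_smul, sum_inner, inner_sum, inner_smul_left, inner_smul_right]
  refine Finset.sum_congr rfl fun j _ => congrArg _ (Finset.sum_congr rfl fun i _ => ?_)
  congr 1
  rw [formalAction_single, formalAction_single, CompatibleVectors.formalVec_single,
    CompatibleVectors.formalVec_single, CompatibleVectors.formalVec_single,
    CompatibleVectors.formalVec_single]
  by_cases h : (w i).1 = (z j).1
  · rw [h, CompatibleVectors.inner_gnsVec, CompatibleVectors.inner_gnsVec]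
    refine finprod_congr fun v => congrArg _ ?_
    change inn (α.hom v (a v) _) _ = inn _ (α.hom v (star (a v)) _)
    rw [map_star, Adjointable.inn_apply_left]
  · rw [x.inner_gnsVec_of_ne h, x.inner_gnsVec_of_ne h]

/-- The auxiliary factor is removed by taking it to be `c` itself: `‖c ξ‖² = ⟨ξ, c⋆ c ξ⟩ ≤ ‖ξ‖ ‖c⋆
(c ξ)‖`, and the last norm is at most `‖c‖ ‖c ξ‖`. -/
theorem norm_formalAction_le (c : p'.Family →₀ ℂ) (ξ : ProductFunctional p × x.Family →₀ ℂ) :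
    ‖x.formalVec (α.formalAction c ξ)‖ ≤ ‖p'.ofFormal c‖ * ‖x.formalVec ξ‖ := by
  -- `c'` is the formal adjoint of `c`.
  obtain ⟨c', h1, h2⟩ : ∃ c', p'.ofFormal c' = star (p'.ofFormal c) ∧ ∀ ξ η,
      ⟪x.formalVec (α.formalAction c ξ), x.formalVec η⟫_ℂ =
        ⟪x.formalVec ξ, x.formalVec (α.formalAction c' η)⟫_ℂ := by
    obtain ⟨k, c, a, rfl⟩ := c.exists_eq_sum_smul_single
    refine ⟨∑ i, star (c i) • Finsupp.single (p'.famStar (a i)) 1, ?_, fun ξ η => ?_⟩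
    · simp only [map_sum, map_smul, star_sum, star_smul, ProjectionFamily.ofFormal_single,
        ProjectionFamily.star_tmul]
      exact Finset.sum_congr rfl fun i _ => congrArg _ (p'.ofFormal_single _)
    · simp only [map_sum, map_smul, LinearMap.sum_apply, LinearMap.smul_apply, sum_inner, inner_sum,
        inner_smul_left, inner_smul_right, inner_formalAction]
      rfl
  have h3 : ‖x.formalVec (α.formalAction c ξ)‖ ^ 2 ≤
      ‖x.formalVec ξ‖ * (‖p'.ofFormal c‖ * ‖x.formalVec (α.formalAction c ξ)‖) := by
    rw [← inner_self_eq_norm_sq (𝕜 := ℂ), h2]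
    refine (RCLike.re_le_norm _).trans ((norm_inner_le_norm _ _).trans ?_)
    gcongr
    rw [← norm_star (p'.ofFormal c), ← h1]
    exact α.norm_formalAction_formalAction_le c c' ξ
  rcases (norm_nonneg (x.formalVec (α.formalAction c ξ))).eq_or_lt with h | h
  · rw [← h]; positivity
  · nlinarith

/-- The operator `∑ c a • a` on `GNSSpace`. -/
noncomputable def gnsAction (c : p'.Family →₀ ℂ) : x.GNSSpace →L[ℂ] x.GNSSpace :=
  (x.formalVec ∘ₗ α.formalAction c).extendOfNorm x.formalVec

theorem gnsAction_formalVec (c : p'.Family →₀ ℂ) (ξ : ProductFunctional p × x.Family →₀ ℂ) :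
    α.gnsAction c (x.formalVec ξ) = x.formalVec (α.formalAction c ξ) :=
  LinearMap.extendOfNorm_eq x.denseRange_formalVec ⟨_, α.norm_formalAction_le c⟩ ξ

theorem norm_gnsAction_le (c : p'.Family →₀ ℂ) : ‖α.gnsAction c‖ ≤ ‖p'.ofFormal c‖ :=
  LinearMap.opNorm_extendOfNorm_le x.denseRange_formalVec (norm_nonneg _)
    (α.norm_formalAction_le c)

/-- The simple tensor `⊗ a v`, as an operator on `GNSSpace`. -/
noncomputable def gnsOp (a : p'.Family) : x.GNSSpace →L[ℂ] x.GNSSpace :=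
  α.gnsAction (Finsupp.single a 1)

theorem gnsOp_gnsVec (a : p'.Family) (φ : ProductFunctional p) (w : x.Family) :
    α.gnsOp a (x.gnsVec φ w) = x.gnsVec φ (α.famApply a w) := by
  rw [gnsOp, ← x.formalVec_single, gnsAction_formalVec, formalAction_single, x.formalVec_single]

theorem gnsAction_eq_linearCombination (c : p'.Family →₀ ℂ) :
    α.gnsAction c = Finsupp.linearCombination ℂ α.gnsOp c := by
  refine KernelSpace.ext_δ fun ⟨φ, w⟩ => ?_
  obtain ⟨k, c, a, rfl⟩ := c.exists_eq_sum_smul_single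
  change α.gnsAction _ (x.gnsVec φ w) = Finsupp.linearCombination ℂ α.gnsOp _ (x.gnsVec φ w)
  simp only [map_sum, map_smul, Finsupp.linearCombination_single, one_smul,
    _root_.sum_apply, _root_.smul_apply, gnsOp_gnsVec]
  rw [← x.formalVec_single, gnsAction_formalVec]
  simp only [map_sum, map_smul, LinearMap.sum_apply, LinearMap.smul_apply, formalAction_single,
    x.formalVec_single]

theorem adjoint_gnsOp (a : p'.Family) : (α.gnsOp a).adjoint = α.gnsOp (p'.famStar a) := by
  refine KernelSpace.ext_δ fun ⟨φ, w⟩ => KernelSpace.ext_inner_δ fun ⟨ψ, z⟩ => ?_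
  change ⟪x.gnsVec ψ z, (α.gnsOp a).adjoint (x.gnsVec φ w)⟫_ℂ =
    ⟪x.gnsVec ψ z, α.gnsOp (p'.famStar a) (x.gnsVec φ w)⟫_ℂ
  rw [ContinuousLinearMap.adjoint_inner_right, ← x.formalVec_single, ← x.formalVec_single, gnsOp,
    gnsOp, gnsAction_formalVec, gnsAction_formalVec, inner_formalAction]

theorem gnsOp_comp_tensorOp (a : p'.Family) (w : x.Family) :
    α.gnsOp a ∘L x.tensorOp w = x.tensorOp (α.famApply a w) := by
  refine KernelSpace.ext_δ fun ⟨φ, b⟩ => ?_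
  rw [ContinuousLinearMap.comp_apply, CompatibleVectors.tensorOp_gnsVec,
    CompatibleVectors.tensorOp_gnsVec, gnsOp_gnsVec, famApply_famAct_right]

theorem gnsOp_comp_mem (a : p'.Family) {S : p.toVectors.GNSSpace →L[ℂ] x.GNSSpace}
    (hS : S ∈ x.restrictedSubmodule) : α.gnsOp a ∘L S ∈ x.restrictedSubmodule := by
  refine map_mem_closure (f := fun S : p.toVectors.GNSSpace →L[ℂ] x.GNSSpace => α.gnsOp a ∘L S)
    (by fun_prop) hS ?_
  intro S hS
  change S ∈ Submodule.span ℂ _ at hS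
  change α.gnsOp a ∘L S ∈ Submodule.span ℂ _
  induction hS using Submodule.span_induction with
  | mem S hS =>
    obtain ⟨w, rfl⟩ := hS
    exact Submodule.subset_span ⟨_, (α.gnsOp_comp_tensorOp a w).symm⟩
  | zero => rw [ContinuousLinearMap.comp_zero]; exact Submodule.zero_mem _
  | add S T _ _ hS hT => rw [ContinuousLinearMap.comp_add]; exact Submodule.add_mem _ hS hT
  | smul c T _ hT => rw [ContinuousLinearMap.comp_smul]; exact Submodule.smul_mem _ c hT

/-- The simple tensor `⊗ a v`, as an adjointable operator on the restricted tensor product. -/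
noncomputable def tensorAction (a : p'.Family) :
    Adjointable p.RestrictedTensor x.RestrictedTensor :=
  let op (a : p'.Family) : x.RestrictedTensor →L[ℂ] x.RestrictedTensor :=
    LinearMap.mkContinuous
      { toFun := fun S => ⟨α.gnsOp a ∘L S.1, α.gnsOp_comp_mem a S.2⟩
        map_add' := fun S T => Subtype.ext (ContinuousLinearMap.comp_add _ _ _)
        map_smul' := fun c S => Subtype.ext (ContinuousLinearMap.comp_smul _ _ _) } ‖α.gnsOp a‖
      fun S => ContinuousLinearMap.opNorm_comp_le _ _
  ⟨op a, op (p'.famStar a), fun S T => Subtype.ext (by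
    change (α.gnsOp a ∘L S.1).adjoint ∘L T.1 = S.1.adjoint ∘L (α.gnsOp (p'.famStar a) ∘L T.1)
    rw [ContinuousLinearMap.adjoint_comp, adjoint_gnsOp, ContinuousLinearMap.comp_assoc])⟩

theorem tensorAction_tmul (a : p'.Family) (w : x.Family) :
    α.tensorAction a (x.tmul w) = x.tmul (α.famApply a w) :=
  Subtype.ext (α.gnsOp_comp_tensorOp a w)

end CorrespondenceFamily

end Restricted

/-! ### Existence and uniqueness of the global action. -/

section Restricted

variable {I : Type*} {A : I → Type*} [∀ v, NonUnitalCStarAlgebra (A v)]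

theorem ProjectionFamily.ext_tmul (p : ProjectionFamily A) {E : Type*} [NormedAddCommGroup E]
    [NormedSpace ℂ E] {S T : p.RestrictedTensor →L[ℂ] E}
    (h : ∀ a, S (p.tmul a) = T (p.tmul a)) : S = T := by
  refine ContinuousLinearMap.ext fun y => ?_
  refine p.denseRange_ofFormal.induction_on y (isClosed_eq S.continuous T.continuous) fun c => ?_
  obtain ⟨k, c, a, rfl⟩ := c.exists_eq_sum_smul_single
  simp only [map_sum, map_smul, p.ofFormal_single, h]

/-- A closed subspace that contains the images of the simple tensors contains the range. -/
theorem ProjectionFamily.mem_of_tmul_mem (p : ProjectionFamily A) {E : Type*} [NormedAddCommGroup E]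
    [NormedSpace ℂ E] (S : p.RestrictedTensor →L[ℂ] E) {K : Submodule ℂ E}
    (hK : IsClosed (K : Set E)) (h : ∀ a, S (p.tmul a) ∈ K) (y : p.RestrictedTensor) : S y ∈ K := by
  refine p.denseRange_ofFormal.induction_on (p := fun y => S y ∈ K) y
    (hK.preimage S.continuous) fun c => ?_
  obtain ⟨k, c, a, rfl⟩ := c.exists_eq_sum_smul_single
  simp only [map_sum, map_smul, p.ofFormal_single]
  exact K.sum_mem fun i _ => K.smul_mem _ (h _)

namespace CompatibleVectors

variable {p : ProjectionFamily A} {X : I → Type*}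
    [∀ v, NormedAddCommGroup (X v)] [∀ v, NormedSpace ℂ (X v)] [∀ v, CompleteSpace (X v)]
    [∀ v, HilbertModule (A v) (X v)] (x : CompatibleVectors p X)

/-- The inclusion of the restricted tensor product into the operators between the Hilbert spaces
`GNSSpace`. -/
noncomputable def toOp : x.RestrictedTensor →ₗᵢ[ℂ] (p.toVectors.GNSSpace →L[ℂ] x.GNSSpace) where
  toFun T := T.1
  map_add' _ _ := rfl
  map_smul' _ _ := rfl
  norm_map' _ := rfl

theorem dense_span_tmul :
    Dense (Submodule.span ℂ (Set.range x.tmul) : Set x.RestrictedTensor) := by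
  intro T
  rw [x.toOp.isometry.isUniformInducing.isInducing.closure_eq_preimage_closure_image,
    Set.mem_preimage]
  have h : x.toOp '' (Submodule.span ℂ (Set.range x.tmul) : Set x.RestrictedTensor) =
      (Submodule.span ℂ (Set.range x.tensorOp) : Set _) := by
    have h1 := Submodule.map_span x.toOp.toLinearMap (Set.range x.tmul)
    rw [← Set.range_comp] at h1
    exact congrArg SetLike.coe h1
  rw [h]
  exact T.2

theorem ext_tmul {S T : Adjointable p.RestrictedTensor x.RestrictedTensor}
    (h : ∀ w, S (x.tmul w) = T (x.tmul w)) : S = T := by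
  refine Subtype.ext (ContinuousLinearMap.ext_on x.dense_span_tmul ?_)
  rintro _ ⟨w, rfl⟩
  exact h w

end CompatibleVectors

variable {A' : I → Type*} [∀ v, NonUnitalCStarAlgebra (A' v)]
    {p' : ProjectionFamily A'} {p : ProjectionFamily A} {X : I → Type*}
    [∀ v, NormedAddCommGroup (X v)] [∀ v, NormedSpace ℂ (X v)] [∀ v, CompleteSpace (X v)]
    [∀ v, HilbertModule (A v) (X v)] {x : CompatibleVectors p X}

namespace CorrespondenceFamily

variable (α : CorrespondenceFamily p' x)

theorem tensorAction_mul (a b : p'.Family) :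
    α.tensorAction (p'.toVectors.famAct a b) = α.tensorAction a * α.tensorAction b := by
  refine x.ext_tmul fun w => ?_
  change _ = α.tensorAction a (α.tensorAction b (x.tmul w))
  rw [tensorAction_tmul, tensorAction_tmul, tensorAction_tmul, famApply_famAct]

theorem star_tensorAction (a : p'.Family) :
    star (α.tensorAction a) = α.tensorAction (p'.famStar a) := by
  refine Adjointable.star_eq fun S T => Subtype.ext ?_
  change (α.gnsOp a ∘L S.1).adjoint ∘L T.1 = S.1.adjoint ∘L (α.gnsOp (p'.famStar a) ∘L T.1)
  rw [ContinuousLinearMap.adjoint_comp, adjoint_gnsOp, ContinuousLinearMap.comp_assoc]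

theorem linearCombination_tensorAction_apply (c : p'.Family →₀ ℂ) (S : x.RestrictedTensor) :
    (Finsupp.linearCombination ℂ α.tensorAction c S).1 = α.gnsAction c ∘L S.1 := by
  rw [gnsAction_eq_linearCombination]
  induction c using Finsupp.induction_linear with
  | zero => rw [map_zero, map_zero, ContinuousLinearMap.zero_comp]; rfl
  | add f g hf hg =>
    rw [map_add, map_add, ContinuousLinearMap.add_comp, ← hf, ← hg]; rfl
  | single a c =>
    rw [Finsupp.linearCombination_single, Finsupp.linearCombination_single,
      ContinuousLinearMap.smul_comp]
    rfl

/-- On the module, which consists of operators into `GNSSpace`, the action is left composition with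
`gnsAction c`, so the bound for that operator carries over. -/
theorem norm_linearCombination_tensorAction_le (c : p'.Family →₀ ℂ) :
    ‖Finsupp.linearCombination ℂ α.tensorAction c‖ ≤ 1 * ‖p'.ofFormal c‖ := by
  rw [one_mul]
  refine ContinuousLinearMap.opNorm_le_bound _ (norm_nonneg _) fun S => ?_
  change ‖(Finsupp.linearCombination ℂ α.tensorAction c S).1‖ ≤ _ * ‖S.1‖
  rw [linearCombination_tensorAction_apply]
  refine (ContinuousLinearMap.opNorm_comp_le _ _).trans ?_
  gcongr
  exact α.norm_gnsAction_le c

/-- The action of the restricted tensor product, as a continuous linear map. -/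
noncomputable def globalActionCLM :
    p'.RestrictedTensor →L[ℂ] Adjointable p.RestrictedTensor x.RestrictedTensor :=
  (Finsupp.linearCombination ℂ α.tensorAction).extendOfNorm p'.ofFormal

theorem globalActionCLM_ofFormal (c : p'.Family →₀ ℂ) :
    α.globalActionCLM (p'.ofFormal c) = Finsupp.linearCombination ℂ α.tensorAction c :=
  LinearMap.extendOfNorm_eq p'.denseRange_ofFormal
    ⟨1, α.norm_linearCombination_tensorAction_le⟩ c

theorem globalActionCLM_tmul (a : p'.Family) :
    α.globalActionCLM (p'.tmul a) = α.tensorAction a := by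
  rw [← p'.ofFormal_single, globalActionCLM_ofFormal, Finsupp.linearCombination_single, one_smul]

/-- The action of the restricted tensor product `⊗' A' v` on `⊗' X v`. -/
noncomputable def globalAction :
    p'.RestrictedTensor →⋆ₙₐ[ℂ] Adjointable p.RestrictedTensor x.RestrictedTensor where
  toFun := α.globalActionCLM
  map_smul' := map_smul α.globalActionCLM
  map_zero' := map_zero _
  map_add' := map_add _
  map_mul' := by
    intro S T
    refine p'.denseRange_ofFormal.induction_on₂
      (p := fun S T => α.globalActionCLM (S * T) = α.globalActionCLM S * α.globalActionCLM T)
      (isClosed_eq (by fun_prop) (by fun_prop)) (fun c d => ?_) S T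
    obtain ⟨k, c, a, rfl⟩ := c.exists_eq_sum_smul_single
    obtain ⟨l, d, b, rfl⟩ := d.exists_eq_sum_smul_single
    simp only [map_sum, map_smul, p'.ofFormal_single, Finset.sum_mul_sum, smul_mul_smul_comm,
      p'.tmul_mul_tmul, globalActionCLM_tmul, tensorAction_mul]
  map_star' := by
    intro S
    refine p'.denseRange_ofFormal.induction_on
      (p := fun S => α.globalActionCLM (star S) = star (α.globalActionCLM S)) S
      (isClosed_eq (by fun_prop) (by fun_prop)) fun c => ?_
    obtain ⟨k, c, a, rfl⟩ := c.exists_eq_sum_smul_single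
    simp only [map_sum, map_smul, p'.ofFormal_single, star_sum, star_smul, p'.star_tmul,
      globalActionCLM_tmul, star_tensorAction]

theorem globalAction_tmul (a : p'.Family) : α.globalAction (p'.tmul a) = α.tensorAction a :=
  α.globalActionCLM_tmul a

theorem globalAction_ofFormal (c : p'.Family →₀ ℂ) :
    α.globalAction (p'.ofFormal c) = Finsupp.linearCombination ℂ α.tensorAction c :=
  α.globalActionCLM_ofFormal c

theorem isGlobalAction_globalAction : α.IsGlobalAction α.globalAction := by
  intro a w
  rw [globalAction_tmul, tensorAction_tmul]

/-- A ⋆-homomorphism between C⋆-algebras is contractive, so its values on simple tensors determine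
it; and an adjointable operator is determined by its values on the simple tensors of `X`. -/
theorem IsGlobalAction.eq_globalAction {α : CorrespondenceFamily p' x}
    {Ψ : p'.RestrictedTensor →⋆ₙₐ[ℂ] Adjointable p.RestrictedTensor x.RestrictedTensor}
    (h : α.IsGlobalAction Ψ) : Ψ = α.globalAction := by
  have hcont : Continuous Ψ := AddMonoidHomClass.continuous_of_bound Ψ 1 fun a => by
    rw [one_mul]; exact NonUnitalStarAlgHom.norm_apply_le Ψ a
  have h1 : (⟨(Ψ : p'.RestrictedTensor →ₗ[ℂ] _), hcont⟩ : p'.RestrictedTensor →L[ℂ]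
      Adjointable p.RestrictedTensor x.RestrictedTensor) = α.globalActionCLM := by
    refine p'.ext_tmul fun a => x.ext_tmul fun w => ?_
    rw [globalActionCLM_tmul, tensorAction_tmul]
    exact h a w
  exact NonUnitalStarAlgHom.ext fun a => DFunLike.congr_fun h1 a

end CorrespondenceFamily

end Restricted

/-! ### The natural inclusion of the restricted product of the algebras `End⋆(X v)` is isometric. -/

section Restricted

variable {I : Type*} {A : I → Type*} [∀ v, NonUnitalCStarAlgebra (A v)]
    {p : ProjectionFamily A} {X : I → Type*}
    [∀ v, NormedAddCommGroup (X v)] [∀ v, NormedSpace ℂ (X v)] [∀ v, CompleteSpace (X v)]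
    [∀ v, HilbertModule (A v) (X v)]

open scoped InnerProductSpace

namespace CompatibleVectors

variable (x : CompatibleVectors p X)

theorem inner_toOp_inn (y z : x.RestrictedTensor) (ζ ζ' : p.toVectors.GNSSpace) :
    ⟪ζ, p.toOp (inn y z) ζ'⟫_ℂ = ⟪x.toOp y ζ, x.toOp z ζ'⟫_ℂ :=
  ContinuousLinearMap.adjoint_inner_right (x.toOp y) ζ (x.toOp z ζ')

/-- A version of `‖T y‖ ≤ ‖T‖ ‖y‖` at each vector `ζ`. Writing `‖T‖² - T⋆ T = r⋆ r` gives `‖T‖² ⟨y,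
y⟩ = ⟨T y, T y⟩ + ⟨r y, r y⟩`, which is then evaluated at `ζ`. -/
theorem norm_toOp_apply_le (T : Adjointable p.RestrictedTensor x.RestrictedTensor)
    (y : x.RestrictedTensor) (ζ : p.toVectors.GNSSpace) :
    ‖x.toOp (T y) ζ‖ ≤ ‖T‖ * ‖x.toOp y ζ‖ := by
  obtain ⟨r, hr⟩ : ∃ r, (((‖T‖ ^ 2 : ℝ) : ℂ) • 1 - star T * T :
      Adjointable p.RestrictedTensor x.RestrictedTensor) = star r * r := by
    let _ : PartialOrder (Adjointable p.RestrictedTensor x.RestrictedTensor) :=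
      CStarAlgebra.spectralOrder _
    have _ : StarOrderedRing (Adjointable p.RestrictedTensor x.RestrictedTensor) :=
      CStarAlgebra.spectralOrderedRing _
    rw [← CStarAlgebra.nonneg_iff_eq_star_mul_self, sub_nonneg]
    have h := CStarAlgebra.star_mul_le_algebraMap_norm_sq (a := T)
    rwa [Algebra.algebraMap_eq_smul_one, ← Complex.coe_smul] at h
  have h1 : ((‖T‖ ^ 2 : ℝ) : ℂ) • inn (A := p.RestrictedTensor) y y =
      inn (T y) (T y) + inn (r y) (r y) := by
    rw [← Adjointable.matrixCoeff_star_mul, ← Adjointable.matrixCoeff_star_mul, ← hr, map_sub,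
      map_smul, add_sub_cancel]
    rfl
  have h2 := congrArg (fun S => ⟪ζ, p.toOp S ζ⟫_ℂ) h1
  simp only [map_add, map_smul, _root_.add_apply, _root_.smul_apply, inner_add_right,
    inner_smul_right, inner_toOp_inn, inner_self_eq_norm_sq_to_K] at h2
  have h3 : ‖T‖ ^ 2 * ‖x.toOp y ζ‖ ^ 2 = ‖x.toOp (T y) ζ‖ ^ 2 + ‖x.toOp (r y) ζ‖ ^ 2 := by
    refine Complex.ofReal_injective ?_
    push_cast
    push_cast at h2
    exact h2
  refine le_of_sq_le_sq ?_ (by positivity)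
  rw [mul_pow, h3]
  exact le_add_of_nonneg_right (by positivity)

/-- The global form of `functional_adjointable_nonneg`. The base point `(φ₀, x, p)` is admissible
because almost everywhere `x_v p_v = x_v` and `p_{x_v}` fixes `x_v`, so that the factor is `φ₀(p_v)
= 1`. -/
theorem sum_functional_rankOne_nonneg {M : Type*} [Fintype M]
    (ψ : ProductFunctional x.rankOneProjections) (u : M → x.rankOneProjections.Family) (d : M → ℂ)
    (H : ∀ (φ : ProductFunctional p) (w : x.Family) (a : p.Family), 0 ≤ ∑ m, d m *
      ∏ᶠ v, φ.toFun v (inn (act (w v) (a v)) (u m v (act (w v) (a v))))) :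
    0 ≤ ∑ m, d m * ∏ᶠ v, ψ.toFun v (u m v) := by
  obtain ⟨φ₀⟩ := p.nonempty_productFunctional
  have hu : ∀ᶠ v in cofinite, ∀ m, u m v = Adjointable.rankOne (x.vec v) (x.vec v) :=
    eventually_all.2 fun m => (u m).2
  refine sum_finprod_nonneg
    (D := fun v => {φ : A v →ₗ[ℂ] ℂ // ∀ b, 0 ≤ φ (star b * b)} × X v × A v)
    (fun v t m => t.1.1 (inn (act t.2.1 t.2.2) (u m v (act t.2.1 t.2.2))))
    (q := fun v => (⟨φ₀.toFun v, φ₀.nonneg v⟩, x.vec v, p.proj v)) ?_ ?_ ?_ d ?_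
  · filter_upwards [hu, φ₀.normalized, x.act_vec, x.inn_vec] with v h1 h2 h3 h4 m
    rw [h1, h3, Adjointable.rankOne_apply, h4, h3, h4, h2]
  · filter_upwards [hu, ψ.normalized] with v h1 h2 m
    rw [h1]
    exact h2
  · intro v c hc
    exact functional_adjointable_nonneg (ψ.nonneg v) (fun m => u m v) c
      fun φ hφ w a => hc (⟨φ, hφ⟩, w, a)
  · intro t
    refine H ⟨fun v => (t v).1.1, fun v => (t v).1.2, ?_⟩ ⟨fun v => (t v).2.1, ?_⟩
      ⟨fun v => (t v).2.2, ?_⟩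
    · filter_upwards [t.2, φ₀.normalized] with v h1 h2
      rw [h1, h2]
    · filter_upwards [t.2] with v h1
      rw [h1]
    · filter_upwards [t.2] with v h1
      rw [h1]

/-- An estimate in the representation of an arbitrary product functional `ψ` is reduced to the
vectors `b (w a)`, on which the algebras `End⋆(X v)` act through the module. -/
theorem norm_sum_gnsVec_rankOne_le {J J' : Type*} [Fintype J] [Fintype J']
    (ψ : ProductFunctional x.rankOneProjections) (b : J → x.rankOneProjections.Family)
    (b' : J' → x.rankOneProjections.Family) (γ : J → ℂ) (γ' : J' → ℂ) {N : ℝ} (hN : 0 ≤ N)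
    (H : ∀ (φ : ProductFunctional p) (w : x.Family) (a : p.Family),
      ‖∑ i, γ' i • x.gnsVec φ (x.tautological.famApply (b' i) (x.famAct w a))‖ ≤
        N * ‖∑ j, γ j • x.gnsVec φ (x.tautological.famApply (b j) (x.famAct w a))‖) :
    ‖∑ i, γ' i • x.rankOneProjections.toVectors.gnsVec ψ (b' i)‖ ≤
      N * ‖∑ j, γ j • x.rankOneProjections.toVectors.gnsVec ψ (b j)‖ := by
  rw [norm_sum_le_iff hN]
  have key := x.sum_functional_rankOne_nonneg ψ
    (Sum.elim (fun j : J × J => x.rankOneProjections.toVectors.famInn (b j.1) (b j.2))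
      (fun i : J' × J' => x.rankOneProjections.toVectors.famInn (b' i.1) (b' i.2)))
    (normGapCoeff N γ γ') fun φ w a => by
    refine ((norm_sum_le_iff hN _ _ _ _).1 (H φ w a)).trans_eq (Finset.sum_congr rfl fun m _ => ?_)
    congr 1
    rcases m with m | m <;>
    · simp only [Sum.elim_inl, Sum.elim_inr]
      rw [CompatibleVectors.inner_gnsVec]
      refine finprod_congr fun v => congrArg (φ.toFun v) ?_
      exact (Adjointable.matrixCoeff_star_mul _ _ _ _).symm
  refine key.trans_eq (Finset.sum_congr rfl fun m _ => ?_)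
  congr 1
  rcases m with m | m <;>
  · simp only [Sum.elim_inl, Sum.elim_inr]
    rw [CompatibleVectors.inner_gnsVec]
    rfl

/-- The estimate of `norm_toOp_apply_le` for combinations of simple tensors. -/
theorem norm_sum_gnsVec_tautological_le {k n : ℕ} (c : Fin k → ℂ)
    (T : Fin k → x.rankOneProjections.Family) (γ : Fin n → ℂ) (b : Fin n → x.rankOneProjections.Family)
    (φ : ProductFunctional p) (w : x.Family) (a : p.Family) :
    ‖∑ i : Fin n × Fin k, (γ i.1 * c i.2) • x.gnsVec φ (x.tautological.famApply
        (x.rankOneProjections.toVectors.famAct (T i.2) (b i.1)) (x.famAct w a))‖ ≤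
      ‖∑ i, c i • x.tautological.tensorAction (T i)‖ *
        ‖∑ j, γ j • x.gnsVec φ (x.tautological.famApply (b j) (x.famAct w a))‖ := by
  have h1 := x.norm_toOp_apply_le (∑ i, c i • x.tautological.tensorAction (T i))
    (∑ j, γ j • x.tmul (x.tautological.famApply (b j) w)) (p.toVectors.gnsVec φ a)
  have e0 : ∀ w, x.toOp (x.tmul w) (p.toVectors.gnsVec φ a) = x.gnsVec φ (x.famAct w a) :=
    fun w => x.tensorOp_gnsVec w φ a
  have e1 : ∀ i w, Adjointable.toCLM (x.tautological.tensorAction (T i)) (x.tmul w) =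
      x.tmul (x.tautological.famApply (T i) w) :=
    fun i w => x.tautological.tensorAction_tmul (T i) w
  rw [← Adjointable.toCLM_apply] at h1
  simp only [map_sum, map_smul, _root_.sum_apply, _root_.smul_apply, e1, e0] at h1
  simp only [Fintype.sum_prod_type, CorrespondenceFamily.famApply_famAct,
    CorrespondenceFamily.famApply_famAct_right]
  refine le_of_eq_of_le (congrArg _ ?_) h1
  simp only [Finset.smul_sum, smul_smul]

/-- The left side is an operator norm on an orthogonal sum over product functionals `ψ`. On each
summand, the transfer reduces the bound to `norm_sum_gnsVec_tautological_le`, where the norm on `X`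
appears. -/
theorem norm_ofFormal_le_tautological (c : x.rankOneProjections.Family →₀ ℂ) :
    ‖x.rankOneProjections.ofFormal c‖ ≤
      ‖x.tautological.globalAction (x.rankOneProjections.ofFormal c)‖ := by
  obtain ⟨k, c', T, hc⟩ := c.exists_eq_sum_smul_single
  have e1 : ‖x.rankOneProjections.ofFormal c‖ =
      ‖∑ i, c' i • x.rankOneProjections.toVectors.tensorOp (T i)‖ := by
    rw [x.rankOneProjections.norm_ofFormal, hc]
    simp only [map_sum, map_smul, Finsupp.linearCombination_single, one_smul]
  have e2 : x.tautological.globalAction (x.rankOneProjections.ofFormal c) =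
      ∑ i, c' i • x.tautological.tensorAction (T i) := by
    rw [CorrespondenceFamily.globalAction_ofFormal, hc]
    simp only [map_sum, map_smul, Finsupp.linearCombination_single, one_smul]
  rw [e1, e2]
  generalize hN : ‖∑ i, c' i • x.tautological.tensorAction (T i)‖ = N
  have hN0 : 0 ≤ N := hN ▸ norm_nonneg _
  have key : ∀ ξ, ‖(∑ i, c' i • x.rankOneProjections.toVectors.tensorOp (T i))
      (x.rankOneProjections.toVectors.formalVec ξ)‖ ≤
        N * ‖x.rankOneProjections.toVectors.formalVec ξ‖ := by
    intro ξ
    have h := norm_le_of_blocks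
      ((∑ i, c' i • x.rankOneProjections.toVectors.tensorOp (T i)).toLinearMap ∘ₗ
        x.rankOneProjections.toVectors.formalVec) x.rankOneProjections.toVectors.formalVec hN0
      ?_ ?_ ?_ ξ
    · exact h
    · intro φ φ' w w' hne
      simp only [LinearMap.comp_apply, formalVec_single, ContinuousLinearMap.coe_coe,
        _root_.sum_apply, _root_.smul_apply, tensorOp_gnsVec, sum_inner, inner_sum, inner_smul_left,
        inner_smul_right, inner_gnsVec_of_ne _ hne, mul_zero, Finset.sum_const_zero]
    · intro φ φ' w w' hne
      rw [formalVec_single, formalVec_single, inner_gnsVec_of_ne _ hne]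
    · intro ψ n γ b
      have h1 := x.norm_sum_gnsVec_rankOne_le ψ b
        (fun i : Fin n × Fin k => x.rankOneProjections.toVectors.famAct (T i.2) (b i.1)) γ
        (fun i => γ i.1 * c' i.2) hN0 fun φ w a => by
          rw [← hN]
          exact x.norm_sum_gnsVec_tautological_le c' T γ b φ w a
      have h2 : x.rankOneProjections.toVectors.formalVec (∑ i, γ i • Finsupp.single (ψ, b i) 1) =
          ∑ i, γ i • x.rankOneProjections.toVectors.gnsVec ψ (b i) := by
        simp only [map_sum, map_smul, formalVec_single]
      rw [LinearMap.comp_apply, h2]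
      refine le_of_eq_of_le (congrArg _ ?_) h1
      simp only [map_sum, map_smul, ContinuousLinearMap.coe_coe, _root_.sum_apply, _root_.smul_apply,
        tensorOp_gnsVec, Fintype.sum_prod_type, Finset.smul_sum, smul_smul]
  refine ContinuousLinearMap.opNorm_le_bound _ hN0 fun ζ => ?_
  refine x.rankOneProjections.toVectors.denseRange_formalVec.induction_on ζ
    (isClosed_le (by fun_prop) (by fun_prop)) key

theorem norm_tautological_globalAction (S : x.rankOneProjections.RestrictedTensor) :
    ‖x.tautological.globalAction S‖ = ‖S‖ := by
  refine le_antisymm (NonUnitalStarAlgHom.norm_apply_le _ _) ?_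
  refine x.rankOneProjections.denseRange_ofFormal.induction_on
    (p := fun S => ‖S‖ ≤ ‖x.tautological.globalAction S‖) S
    (isClosed_le continuous_norm ?_) x.norm_ofFormal_le_tautological
  exact x.tautological.globalActionCLM.continuous.norm

end CompatibleVectors

end Restricted

/-! ### Norms, adjoints and limits of rank one operators. -/

namespace Adjointable

variable {A X : Type*} [NonUnitalCStarAlgebra A] [NormedAddCommGroup X]
    [NormedSpace ℂ X] [CompleteSpace X] [HilbertModule A X]

theorem star_rankOne (ξ η : X) : star (rankOne ξ η : Adjointable A X) = rankOne η ξ := by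
  refine star_eq fun y z => ?_
  rw [rankOne_apply, rankOne_apply, act_inn, inn_act, star_inn]

theorem norm_act_le (x : X) (a : A) : ‖act x a‖ ≤ ‖x‖ * ‖a‖ := by
  refine norm_le_of_inn (A := A) (by positivity) fun y => ?_
  rw [inn_act]
  calc _ ≤ ‖inn (A := A) y x‖ * ‖a‖ := norm_mul_le _ _
    _ ≤ ‖y‖ * ‖x‖ * ‖a‖ := by gcongr; exact norm_inn_le _ _
    _ = _ := by ring

theorem norm_rankOne_le (ξ η : X) : ‖(rankOne ξ η : Adjointable A X)‖ ≤ ‖ξ‖ * ‖η‖ := by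
  refine ContinuousLinearMap.opNorm_le_bound _ (by positivity) fun y => ?_
  refine (norm_act_le ξ (inn (A := A) η y)).trans ?_
  rw [mul_assoc]
  gcongr
  exact norm_inn_le _ _

/-- The map `ξ ↦ T_{ξ,η}`. -/
noncomputable def rankOneLeft (η : X) : X →L[ℂ] Adjointable A X :=
  LinearMap.mkContinuous
    { toFun := fun ξ => rankOne ξ η
      map_add' := fun ξ ξ' => Subtype.ext (ContinuousLinearMap.ext fun y =>
        add_act ξ ξ' (inn (A := A) η y))
      map_smul' := fun c ξ => Subtype.ext (ContinuousLinearMap.ext fun y =>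
        smul_act c ξ (inn (A := A) η y)) } ‖η‖
    fun ξ => (norm_rankOne_le ξ η).trans_eq (mul_comm _ _)

theorem rankOne_mem_compacts (ξ η : X) : (rankOne ξ η : Adjointable A X) ∈ compacts A X :=
  Submodule.le_topologicalClosure _ (Submodule.subset_span ⟨(ξ, η), rfl⟩)

theorem isClosed_compacts : IsClosed (compacts A X : Set (Adjointable A X)) :=
  Submodule.isClosed_topologicalClosure _

end Adjointable

theorem NonUnitalStarAlgHom.continuous_of_cstar {A B : Type*} [NonUnitalCStarAlgebra A]
    [NonUnitalCStarAlgebra B] (f : A →⋆ₙₐ[ℂ] B) : Continuous f :=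
  AddMonoidHomClass.continuous_of_bound f 1 fun a => by
    rw [one_mul]; exact NonUnitalStarAlgHom.norm_apply_le f a

/-! ### Simple tensors with one varying entry, and tensors of compact operators. -/

section Restricted

variable {I : Type*}

open Classical in
/-- The family `q` with the entry at `v` replaced by `t`. -/
noncomputable def RestrictedFamily.update {Y : I → Type*} {q : ∀ v, Y v} (w : RestrictedFamily q)
    (v : I) (t : Y v) : RestrictedFamily q :=
  ⟨Function.update w.1 v t, by
    filter_upwards [w.2, (Set.finite_singleton v).compl_mem_cofinite] with u h1 h2
    rw [Function.update_of_ne h2, h1]⟩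

open Classical in
theorem RestrictedFamily.update_self {Y : I → Type*} {q : ∀ v, Y v} (w : RestrictedFamily q)
    (v : I) (t : Y v) : w.update v t v = t := by
  change Function.update w.1 v t v = t
  rw [Function.update_self]

open Classical in
theorem RestrictedFamily.update_of_ne {Y : I → Type*} {q : ∀ v, Y v} (w : RestrictedFamily q)
    {v u : I} (h : u ≠ v) (t : Y v) : w.update v t u = w u := by
  change Function.update w.1 v t u = w.1 u
  rw [Function.update_of_ne h]

theorem RestrictedFamily.ext_of_ne {Y : I → Type*} {q : ∀ v, Y v} {w z : RestrictedFamily q}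
    (v : I) (h : w v = z v) (h' : ∀ u, u ≠ v → w u = z u) : w = z :=
  RestrictedFamily.ext (funext fun u => by
    by_cases hu : u = v
    · subst hu; exact h
    · exact h' u hu)

variable {A : I → Type*} [∀ v, NonUnitalCStarAlgebra (A v)]

open scoped InnerProductSpace

section Update

variable {p : ProjectionFamily A} {X : I → Type*}
    [∀ v, NormedAddCommGroup (X v)] [∀ v, NormedSpace ℂ (X v)] [∀ v, CompleteSpace (X v)]
    [∀ v, HilbertModule (A v) (X v)] (x : CompatibleVectors p X)

namespace CompatibleVectors

open Classical in
-- The second factor does not involve `t`, so the inner product is linear in the entry at `v`. This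
-- is the source of the multilinearity of simple tensors.
theorem inner_gnsVec_update (φ : ProductFunctional p) (z w : x.Family) (v : I) (t : X v) :
    ⟪x.gnsVec φ z, x.gnsVec φ (w.update v t)⟫_ℂ = φ.toFun v (inn (z v) t) *
      ∏ᶠ u, if u = v then 1 else φ.toFun u (inn (z u) (w u)) := by
  have h : ∀ᶠ u in cofinite, φ.toFun u (inn (z u) (w.update v t u)) = 1 := by
    filter_upwards [z.2, (w.update v t).2, φ.normalized, x.inn_vec] with u h1 h2 h3 h4
    rw [h1, h2, h4, h3]
  rw [inner_gnsVec, finprod_eq_mul_finprod_ite h v, RestrictedFamily.update_self]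
  congr 1
  refine finprod_congr fun u => ?_
  split_ifs with hu
  · rfl
  · rw [w.update_of_ne hu]

theorem gnsVec_update_add (φ : ProductFunctional p) (w : x.Family) (v : I) (s t : X v) :
    x.gnsVec φ (w.update v (s + t)) = x.gnsVec φ (w.update v s) + x.gnsVec φ (w.update v t) := by
  refine KernelSpace.ext_inner_δ fun ⟨ψ, z⟩ => ?_
  change ⟪x.gnsVec ψ z, _⟫_ℂ = ⟪x.gnsVec ψ z, _⟫_ℂ
  by_cases h : ψ = φ
  · rw [h, inner_add_right, inner_gnsVec_update, inner_gnsVec_update, inner_gnsVec_update, inn_add,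
      map_add, add_mul]
  · rw [inner_add_right, x.inner_gnsVec_of_ne h, x.inner_gnsVec_of_ne h, x.inner_gnsVec_of_ne h,
      add_zero]

theorem gnsVec_update_smul (φ : ProductFunctional p) (w : x.Family) (v : I) (c : ℂ) (t : X v) :
    x.gnsVec φ (w.update v (c • t)) = c • x.gnsVec φ (w.update v t) := by
  refine KernelSpace.ext_inner_δ fun ⟨ψ, z⟩ => ?_
  change ⟪x.gnsVec ψ z, _⟫_ℂ = ⟪x.gnsVec ψ z, _⟫_ℂ
  by_cases h : ψ = φ
  · rw [h, inner_smul_right, inner_gnsVec_update, inner_gnsVec_update, inn_smul, map_smul,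
      smul_eq_mul, mul_assoc]
  · rw [inner_smul_right, x.inner_gnsVec_of_ne h, x.inner_gnsVec_of_ne h, mul_zero]

end CompatibleVectors

namespace ProjectionFamily

theorem famAct_update (a b : p.Family) (v : I) (s t : A v) :
    p.toVectors.famAct (a.update v s) (b.update v t) =
      (p.toVectors.famAct a b).update v (s * t) := by
  refine RestrictedFamily.ext_of_ne v ?_ fun u hu => ?_
  · rw [RestrictedFamily.update_self]
    change a.update v s v * b.update v t v = _
    rw [RestrictedFamily.update_self, RestrictedFamily.update_self]
  · rw [RestrictedFamily.update_of_ne _ hu]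
    change a.update v s u * b.update v t u = a u * b u
    rw [RestrictedFamily.update_of_ne _ hu, RestrictedFamily.update_of_ne _ hu]

theorem famAct_update_left (a b : p.Family) (v : I) (t : A v) :
    p.toVectors.famAct (a.update v t) b = (p.toVectors.famAct a b).update v (t * b v) := by
  refine RestrictedFamily.ext_of_ne v ?_ fun u hu => ?_
  · rw [RestrictedFamily.update_self]
    change a.update v t v * b v = _
    rw [RestrictedFamily.update_self]
  · rw [RestrictedFamily.update_of_ne _ hu]
    change a.update v t u * b u = a u * b u
    rw [RestrictedFamily.update_of_ne _ hu]

theorem tmul_update_add (a : p.Family) (v : I) (s t : A v) :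
    p.tmul (a.update v (s + t)) = p.tmul (a.update v s) + p.tmul (a.update v t) := by
  refine p.toOp.injective ?_
  rw [map_add, toOp_tmul, toOp_tmul, toOp_tmul]
  refine KernelSpace.ext_δ fun ⟨φ, b⟩ => ?_
  rw [_root_.add_apply, CompatibleVectors.tensorOp_gnsVec, CompatibleVectors.tensorOp_gnsVec,
    CompatibleVectors.tensorOp_gnsVec, famAct_update_left, famAct_update_left, famAct_update_left,
    add_mul, CompatibleVectors.gnsVec_update_add]

theorem tmul_update_smul (a : p.Family) (v : I) (c : ℂ) (t : A v) :
    p.tmul (a.update v (c • t)) = c • p.tmul (a.update v t) := by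
  refine p.toOp.injective ?_
  rw [map_smul, toOp_tmul, toOp_tmul]
  refine KernelSpace.ext_δ fun ⟨φ, b⟩ => ?_
  rw [_root_.smul_apply, CompatibleVectors.tensorOp_gnsVec, CompatibleVectors.tensorOp_gnsVec,
    famAct_update_left, famAct_update_left, smul_mul_assoc, CompatibleVectors.gnsVec_update_smul]

/-- The embedding `t ↦ t ⊗ (⊗ e u)` of the algebra at the place `v`, for projections `e u`. -/
noncomputable def singleHom (e : p.Family) (he : ∀ u, IsStarProjection (e u)) (v : I) :
    A v →⋆ₙₐ[ℂ] p.RestrictedTensor where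
  toFun t := p.tmul (e.update v t)
  map_smul' c t := tmul_update_smul e v c t
  map_zero' := by simpa using tmul_update_smul e v 0 0
  map_add' s t := tmul_update_add e v s t
  map_mul' s t := by
    rw [tmul_mul_tmul, famAct_update]
    congr 2
    exact RestrictedFamily.ext (funext fun u => (he u).isIdempotentElem.eq.symm)
  map_star' t := by
    rw [star_tmul]
    congr 1
    refine RestrictedFamily.ext_of_ne v ?_ fun u hu => ?_
    · change e.update v (star t) v = star (e.update v t v)
      rw [RestrictedFamily.update_self, RestrictedFamily.update_self]
    · change e.update v (star t) u = star (e.update v t u)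
      rw [RestrictedFamily.update_of_ne _ hu, RestrictedFamily.update_of_ne _ hu,
        (he u).isSelfAdjoint.star_eq]

end ProjectionFamily

/-- For unital algebras, the simple tensors depend continuously on each entry. -/
theorem ProjectionFamily.continuous_tmul_update {B : I → Type*} [∀ v, CStarAlgebra (B v)]
    {q : ProjectionFamily B} (a : q.Family) (v : I) :
    Continuous fun t : B v => q.tmul (a.update v t) := by
  classical
  -- `e` consists of projections with `a u * e u = a u`: where `a u` is the distinguished projection
  -- it serves as its own unit, elsewhere `e u = 1`. Then `a` with entry `t` is `a` with entry 1
  -- times the image of `t` under `singleHom`, which is continuous as a ⋆-homomorphism.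
  let e : q.Family := ⟨fun u => if a u = q.proj u ∧ IsStarProjection (q.proj u) then q.proj u else 1,
    by
      filter_upwards [a.2, q.isStarProjection] with u h1 h2
      rw [if_pos ⟨h1, h2⟩]⟩
  have he : ∀ u, IsStarProjection (e u) := by
    intro u
    change IsStarProjection (if _ then _ else _)
    split_ifs with h
    · exact h.2
    · exact IsStarProjection.one _
  have h : ∀ t, q.tmul (a.update v t) = q.tmul (a.update v 1) * singleHom e he v t := by
    intro t
    change _ = q.tmul (a.update v 1) * q.tmul (e.update v t)
    rw [tmul_mul_tmul, famAct_update, one_mul]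
    congr 2
    refine RestrictedFamily.ext (funext fun u => ?_)
    change a u = a u * if _ then _ else _
    split_ifs with h
    · rw [h.1, h.2.isIdempotentElem.eq]
    · rw [mul_one]
  rw [show (fun t => q.tmul (a.update v t)) =
    fun t => q.tmul (a.update v 1) * singleHom e he v t from funext h]
  exact continuous_const.mul (singleHom e he v).continuous_of_cstar

end Update

variable {A' : I → Type*} [∀ v, NonUnitalCStarAlgebra (A' v)]
    {p' : ProjectionFamily A'} {p : ProjectionFamily A} {X : I → Type*}
    [∀ v, NormedAddCommGroup (X v)] [∀ v, NormedSpace ℂ (X v)] [∀ v, CompleteSpace (X v)]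
    [∀ v, HilbertModule (A v) (X v)] {x : CompatibleVectors p X}

namespace CompatibleVectors

/-- On a simple tensor both sides are `⊗ ξ_v ⟨η_v, w_v⟩`, since inner product and action are
computed place by place. -/
theorem globalAction_tmul_rankOne (T : x.rankOneProjections.Family) (ξ η : x.Family)
    (h : ∀ v, T v = Adjointable.rankOne (ξ v) (η v)) :
    x.tautological.globalAction (x.rankOneProjections.tmul T) =
      Adjointable.rankOne (x.tmul ξ) (x.tmul η) := by
  refine x.ext_tmul fun w => ?_
  rw [x.tautological.isGlobalAction_globalAction, Adjointable.rankOne_apply, inn_tmul, act_tmul]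
  congr 1
  refine RestrictedFamily.ext (funext fun v => ?_)
  change T v (w v) = _
  rw [h]
  rfl

theorem globalAction_tmul_mem_compacts (T : x.rankOneProjections.Family)
    (hT : ∀ v, T v ∈ Adjointable.compacts (A v) (X v)) :
    x.tautological.globalAction (x.rankOneProjections.tmul T) ∈
      Adjointable.compacts p.RestrictedTensor x.RestrictedTensor := by
  classical
  -- Induction on the places where the factor is allowed to be an arbitrary compact operator instead
  -- of one of rank one.
  have claim : ∀ (S : Finset I) (T : x.rankOneProjections.Family),
      (∀ v ∉ S, ∃ ξ η, T v = Adjointable.rankOne ξ η) →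
      (∀ v, T v ∈ Adjointable.compacts (A v) (X v)) →
      x.tautological.globalAction (x.rankOneProjections.tmul T) ∈
        Adjointable.compacts p.RestrictedTensor x.RestrictedTensor := by
    intro S
    induction S using Finset.induction_on with
    | empty =>
      intro T h _
      -- Vectors representing a rank one operator are not unique. Taking `x_v` wherever `T v =
      -- p_{x_v}` ensures that `ξ` and `η` are restricted families.
      have h' : ∀ v, ∃ ξ η, T v = Adjointable.rankOne ξ η ∧
          (T v = x.rankOneProjections.proj v → ξ = x.vec v ∧ η = x.vec v) := by
        intro v
        by_cases hv : T v = x.rankOneProjections.proj v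
        · exact ⟨x.vec v, x.vec v, hv, fun _ => ⟨rfl, rfl⟩⟩
        · obtain ⟨ξ, η, e⟩ := h v (Finset.notMem_empty v)
          exact ⟨ξ, η, e, fun h => absurd h hv⟩
      choose ξ η e1 e2 using h'
      rw [globalAction_tmul_rankOne T ⟨ξ, T.2.mono fun v hv => (e2 v hv).1⟩
        ⟨η, T.2.mono fun v hv => (e2 v hv).2⟩ e1]
      exact Adjointable.rankOne_mem_compacts _ _
    | insert u S _ ih =>
      intro T h hT
      let L : Adjointable (A u) (X u) →ₗ[ℂ] Adjointable p.RestrictedTensor x.RestrictedTensor :=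
        { toFun := fun t => x.tautological.globalAction (x.rankOneProjections.tmul (T.update u t))
          map_add' := fun s t => by rw [ProjectionFamily.tmul_update_add, map_add]
          map_smul' := fun c t => by rw [ProjectionFamily.tmul_update_smul, map_smul]; rfl }
      have hL : Continuous L := x.tautological.globalAction.continuous_of_cstar.comp
        (ProjectionFamily.continuous_tmul_update T u)
      -- The entries at `u` that give a compact tensor form a closed subspace. By the induction
      -- hypothesis it contains the rank one operators, hence all compact ones.
      have h1 : Adjointable.compacts (A u) (X u) ≤
          (Adjointable.compacts p.RestrictedTensor x.RestrictedTensor).comap L := by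
        refine Submodule.topologicalClosure_minimal _ ?_ (Adjointable.isClosed_compacts.preimage hL)
        rw [Submodule.span_le]
        rintro _ ⟨⟨ξ, η⟩, rfl⟩
        refine ih _ (fun v hv => ?_) fun v => ?_
        · by_cases hvu : v = u
          · subst hvu
            exact ⟨ξ, η, T.update_self _ _⟩
          · rw [T.update_of_ne hvu]
            exact h v (by simp [hvu, hv])
        · by_cases hvu : v = u
          · subst hvu
            rw [T.update_self]
            exact Adjointable.rankOne_mem_compacts _ _
          · rw [T.update_of_ne hvu]
            exact hT v
      have h2 := h1 (hT u)
      have h3 : T.update u (T u) = T :=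
        RestrictedFamily.ext_of_ne u (T.update_self _ _) fun v hv => T.update_of_ne hv _
      change x.tautological.globalAction (x.rankOneProjections.tmul (T.update u (T u))) ∈
        Adjointable.compacts p.RestrictedTensor x.RestrictedTensor at h2
      rwa [h3] at h2
  have hfin := T.2
  rw [eventually_cofinite] at hfin
  refine claim hfin.toFinset T (fun v hv => ?_) hT
  rw [Set.Finite.mem_toFinset, Set.mem_ofPred_eq, not_not] at hv
  exact ⟨x.vec v, x.vec v, hv⟩

end CompatibleVectors

/-! ### The range of the global action of a coherent collection. -/

namespace CorrespondenceFamily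

variable (α : CorrespondenceFamily p' x)

/-- The simple tensor `⊗ α v (a v)`, for a coherent collection. -/
noncomputable def mapFamily (hα : α.IsCoherent) (a : p'.Family) : x.rankOneProjections.Family :=
  ⟨fun v => α.hom v (a v), by
    filter_upwards [a.2, hα] with v h1 h2
    rw [h1, h2]
    rfl⟩

/-- Coherence is what makes `⊗ α_v(a_v)` a restricted family relative to the projections `p_{x_v}`,
so that the action of a simple tensor comes from the restricted product of the algebras `End⋆(X v)`.
-/
theorem globalAction_tmul_eq_tautological (hα : α.IsCoherent) (a : p'.Family) :
    α.globalAction (p'.tmul a) =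
      x.tautological.globalAction (x.rankOneProjections.tmul (α.mapFamily hα a)) := by
  refine x.ext_tmul fun w => ?_
  rw [α.isGlobalAction_globalAction, x.tautological.isGlobalAction_globalAction]
  rfl

/-- The simple tensors land in the range of the inclusion, which is a closed subspace. -/
theorem range_globalAction_subset (hα : α.IsCoherent) :
    Set.range α.globalAction ⊆ Set.range x.tautological.globalAction := by
  rintro _ ⟨y, rfl⟩
  exact p'.mem_of_tmul_mem α.globalActionCLM
    (K := LinearMap.range x.tautological.globalActionCLM.toLinearMap)
    (isClosed_range_starHom x.tautological.globalAction)
    (fun a => ⟨_, (α.globalAction_tmul_eq_tautological hα a).symm⟩) y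

theorem IsCompact.range_globalAction_subset {α : CorrespondenceFamily p' x} (hα : α.IsCompact) :
    Set.range α.globalAction ⊆ Adjointable.compacts p.RestrictedTensor x.RestrictedTensor := by
  rintro _ ⟨y, rfl⟩
  refine p'.mem_of_tmul_mem α.globalActionCLM Adjointable.isClosed_compacts (fun a => ?_) y
  have h : α.globalActionCLM (p'.tmul a) = _ := α.globalAction_tmul_eq_tautological hα.1 a
  rw [h]
  exact CompatibleVectors.globalAction_tmul_mem_compacts _ fun v => hα.2 v ⟨a v, rfl⟩

/-- The operators `T_{ξ_v,η_v}` are lifted to `A' v` one by one. To obtain a restricted family,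
`p'_v` is chosen as the lift whenever it is one, which by coherence happens at almost all places. -/
theorem IsTypeI.rankOne_tmul_mem {α : CorrespondenceFamily p' x} (hα : α.IsTypeI) (ξ η : x.Family) :
    Adjointable.rankOne (x.tmul ξ) (x.tmul η) ∈ Set.range α.globalAction := by
  have h : ∀ v, ∃ a, α.hom v a = Adjointable.rankOne (ξ v) (η v) ∧
      (α.hom v (p'.proj v) = Adjointable.rankOne (ξ v) (η v) → a = p'.proj v) := by
    intro v
    by_cases hv : α.hom v (p'.proj v) = Adjointable.rankOne (ξ v) (η v)
    · exact ⟨_, hv, fun _ => rfl⟩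
    · obtain ⟨a, ha⟩ := hα.2 v (Adjointable.rankOne_mem_compacts (ξ v) (η v))
      exact ⟨a, ha, fun h => absurd h hv⟩
  choose a h1 h2 using h
  have ha : ∀ᶠ v in cofinite, a v = p'.proj v := by
    filter_upwards [ξ.2, η.2, hα.1] with v h3 h4 h5
    exact h2 v (by rw [h3, h4, h5])
  refine ⟨p'.tmul ⟨a, ha⟩, ?_⟩
  rw [α.globalAction_tmul_eq_tautological hα.1]
  exact CompatibleVectors.globalAction_tmul_rankOne _ ξ η h1

/-- The range is closed, so `ξ` in `T_{ξ,η}` can be extended from simple tensors to all vectors. As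
the range is stable under adjoints, which exchange `ξ` and `η`, the same argument extends `η`. -/
theorem IsTypeI.compacts_subset {α : CorrespondenceFamily p' x} (hα : α.IsTypeI) :
    (Adjointable.compacts p.RestrictedTensor x.RestrictedTensor :
      Set (Adjointable p.RestrictedTensor x.RestrictedTensor)) ⊆ Set.range α.globalAction := by
  let W : Submodule ℂ (Adjointable p.RestrictedTensor x.RestrictedTensor) :=
    LinearMap.range α.globalActionCLM.toLinearMap
  have hW : IsClosed (W : Set (Adjointable p.RestrictedTensor x.RestrictedTensor)) :=
    isClosed_range_starHom α.globalAction
  have hstar : ∀ T ∈ W, star T ∈ W := by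
    rintro _ ⟨y, rfl⟩
    exact ⟨star y, map_star α.globalAction y⟩
  have ext_left : ∀ η : x.RestrictedTensor,
      (∀ w, Adjointable.rankOne (x.tmul w) η ∈ W) → ∀ ξ, Adjointable.rankOne ξ η ∈ W := by
    intro η h ξ
    have h1 : Submodule.span ℂ (Set.range x.tmul) ≤
        W.comap (Adjointable.rankOneLeft η).toLinearMap := by
      rw [Submodule.span_le]
      rintro _ ⟨w, rfl⟩
      exact h w
    exact x.dense_span_tmul.induction (P := fun ξ => Adjointable.rankOne ξ η ∈ W) (fun y hy => h1 hy)
      (hW.preimage (Adjointable.rankOneLeft η).continuous) ξ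
  have hrank : ∀ ξ η : x.RestrictedTensor, Adjointable.rankOne ξ η ∈ W := by
    intro ξ η
    refine ext_left η (fun w => ?_) ξ
    rw [← Adjointable.star_rankOne]
    exact hstar _ (ext_left _ (fun z => hα.rankOne_tmul_mem z w) η)
  refine Submodule.topologicalClosure_minimal (t := W) _ ?_ hW
  rw [Submodule.span_le]
  rintro _ ⟨⟨ξ, η⟩, rfl⟩
  exact hrank ξ η

end CorrespondenceFamily

end Restricted

theorem proposition5 {I : Type*} {A' A X : I → Type*}
    [∀ v, NonUnitalCStarAlgebra (A' v)] [∀ v, NonUnitalCStarAlgebra (A v)]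
    [∀ v, NormedAddCommGroup (X v)] [∀ v, NormedSpace ℂ (X v)] [∀ v, CompleteSpace (X v)]
    [∀ v, HilbertModule (A v) (X v)]
    (p' : ProjectionFamily A') (p : ProjectionFamily A) (x : CompatibleVectors p X)
    (α : CorrespondenceFamily p' x) (hα : α.IsCoherent) :
    ∃ Φ : p'.RestrictedTensor →⋆ₙₐ[ℂ] Adjointable p.RestrictedTensor x.RestrictedTensor,
      -- `Φ` is the global action, the only one that acts place by place on simple tensors
      α.IsGlobalAction Φ ∧ (∀ Ψ, α.IsGlobalAction Ψ → Ψ = Φ) ∧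
      -- the natural inclusion of the restricted tensor product of the algebras `End⋆(X v)`
      (∃ j : x.rankOneProjections.RestrictedTensor →⋆ₙₐ[ℂ]
            Adjointable p.RestrictedTensor x.RestrictedTensor,
        x.tautological.IsGlobalAction j ∧ (∀ k, x.tautological.IsGlobalAction k → k = j) ∧
        Function.Injective j ∧ Set.range Φ ⊆ Set.range j) ∧
      (α.IsCompact →
        Set.range Φ ⊆ Adjointable.compacts p.RestrictedTensor x.RestrictedTensor) ∧
      (α.IsTypeI →
        (Adjointable.compacts p.RestrictedTensor x.RestrictedTensor :
          Set (Adjointable p.RestrictedTensor x.RestrictedTensor)) ⊆ Set.range Φ) := by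
  refine ⟨α.globalAction, α.isGlobalAction_globalAction, fun Ψ hΨ => hΨ.eq_globalAction,
    ⟨x.tautological.globalAction, x.tautological.isGlobalAction_globalAction,
      fun k hk => hk.eq_globalAction, ?_, α.range_globalAction_subset hα⟩,
    fun h => h.range_globalAction_subset, fun h => h.compacts_subset⟩
  exact (injective_iff_map_eq_zero x.tautological.globalAction).2 fun S hS => by
    rw [← norm_eq_zero, ← x.norm_tautological_globalAction, hS, norm_zero]
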